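/- Let $N$ be a smooth complete surface of revolution with rotation center $O$, radial diameter $s_0\in(0,\infty]$ and metric $ds^2+\Gamma(s)^2d\beta^2$ in geodesic polar coordinates $(s,\beta)$ at $O$, where $\Gamma$ is smooth and odd with $\Gamma'(0)=1$; if $s_0=\infty$, $\Gamma$ vanishes only at $0$; if $s_0<\infty$, $\Gamma$ is $2s_0$-periodic and vanishes exactly at the points $ns_0$, $n\in\mathbb Z$, where $\Gamma'(ns_0)=(-1)^n$ and $\Gamma''(ns_0)=0$. (For example $N=\mathbb S^2$: $s_0=\pi$, $\Gamma=\sin$; $N=\mathbb H^2$: $s_0=\infty$, $\Gamma=\sinh$.) Let $F(s)=\int_0^s\Gamma$ and, for $k,b,c,\mu\in\mathbb R$, $G=\frac{k^2}{2}\Gamma^2+bkF-k^2F^2$, both regarded as functions on $N$. Let $D$ be the Levi-Civita connection and $\mathcal J$ the rotation by $\pi/2$ in the tangent planes. For curves $W$ in $N$ consider the profile equation $$D_aW_a+\frac1aW_a+\frac1{a^2}\nabla G-\mu\nabla F+\frac ca\mathcal JW_a=0,\qquad a>0, \tag{1}$$ and write $s(a)=s(W(a))$ for the distance from $W(a)$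 to $O$. Solutions of (1) are classical ($C^2$) for $a>0$ and continuous at $a=0$. Suppose $c^2<-4(k^2+bk)$ and put $\kappa=\sqrt{-(k^2+bk)-\frac{c^2}{4}}$. Then $\kappa>0$, and there exist $a_\star>0$ and $s_*\in(0,s_0]$, $s_*<\infty$, with the following properties. (a) For every $\tilde s\in[0,s_*)$ there is a solution $W$ of (1), with domain containing $[0,a_\star]$, such that $s(0)=0$, $s(a_\star)=\tilde s$ and $s(a)<s_*$ for all $a\in[0,a_\star]$. It is unique on $[0,a_\star]$ up to a rotation of $N$ about $O$ among the solutions with these properties. It satisfies $s(a)=O(a^\kappa)$ and $|W_a(a)|=O(a^{\kappa-1})$ as $a\to0+$. (b) For every $\tilde s\in(0,s_*)$ the first order system $$as_a=r\Gamma\cos\gamma,\quad ar_a=\Big(-\Gamma_sr^2-\frac{G_s}{\Gamma}+\mu a^2\Big)\cos\gamma,\quad a\gamma_a=\Big(-\Gamma_sr+\frac{G_s}{r\Gamma}-\mu\frac{a^2}{r}\Big)\sin\gamma-c$$ for real functions $(s,r,\gamma)$ with $r>0$ has a solution for $a>0$, with domain containing $(0,a_\star]$, such that $s$ extends continuously by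 $s(0)=0$, $s(a_\star)=\tilde s$ and $|s(a)|<s_*$ on $[0,a_\star]$. It is unique on $(0,a_\star]$, up to adding a constant in $2\pi\mathbb Z$ to $\gamma$, among the solutions with these properties. It satisfies $s(a)=O(a^\kappa)$ and $r(a)\Gamma(s(a))/a=O(a^{\kappa-1})$ as $a\to0+$. -/

import Mathlib

open Set Filter Topology Asymptotics
open scoped ContDiff ENNReal

noncomputable section

namespace RevSurface

/-- `Γ` is the profile function of a (smooth, complete) surface of revolution with rotation
center `O` and radial diameter `s₀ ∈ (0, ∞]`: in geodesic polar coordinates `(s, β)` at `O` the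
metric is `ds² + Γ(s)² dβ²`.  For `s₀ < ∞` the function `Γ` is extended to an odd
`2 s₀`-periodic function.  The sphere is `s₀ = π`, `Γ = sin`; the hyperbolic plane is `s₀ = ∞`,
`Γ = sinh`. -/
structure IsProfileFunction (s₀ : ℝ≥0∞) (Γ : ℝ → ℝ) : Prop where
  s₀_pos : 0 < s₀
  smooth : ContDiff ℝ ∞ Γ
  odd : ∀ s, Γ (-s) = -Γ s
  deriv_zero : deriv Γ 0 = 1
  zero_iff_of_top : s₀ = ⊤ → ∀ s, Γ s = 0 ↔ s = 0
  periodic : s₀ ≠ ⊤ → Function.Periodic Γ (2 * s₀.toReal)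
  zero_iff : s₀ ≠ ⊤ → ∀ s, Γ s = 0 ↔ ∃ n : ℤ, s = n * s₀.toReal
  deriv_pole : s₀ ≠ ⊤ → ∀ n : ℤ, deriv Γ (n * s₀.toReal) = (-1) ^ n
  deriv_deriv_pole : s₀ ≠ ⊤ → ∀ n : ℤ, deriv (deriv Γ) (n * s₀.toReal) = 0

/-- The tangent plane `T_O N`.  Through the exponential map at `O`, its open disc of radius `s₀`
is a global chart (normal coordinates) of the surface `N` without the point at distance `s₀`
from `O` (which exists only if `s₀ < ∞`); `O` is the origin and the radial coordinate `s` of a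
point `x` is the Euclidean norm `‖x‖`. -/
abbrev Plane : Type := EuclideanSpace ℝ (Fin 2)

/-- Euclidean rotation of `x` by `π / 2`; as a vector field it is the coordinate field `∂_β`. -/
def perp (x : Plane) : Plane := !₂[-x 1, x 0]

/-- The rotation `R(θ)` of the surface, in normal coordinates. -/
def rot (θ : ℝ) (x : Plane) : Plane :=
  !₂[Real.cos θ * x 0 - Real.sin θ * x 1, Real.sin θ * x 0 + Real.cos θ * x 1]

/-- The matrix of the metric `ds² + Γ(s)² dβ²` in normal coordinates, that is
`g(v, w) = ⟨v, w⟩ + s⁻² ((Γ(s) / s)² - 1) ⟨x^⊥, v⟩ ⟨x^⊥, w⟩` with `s = ‖x‖`.  The radial unit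
vector has length one, `x^⊥` has length `Γ(s)`, and they are orthogonal; `g` is the identity
matrix at the origin. -/
def metric (Γ : ℝ → ℝ) (x : Plane) : Matrix (Fin 2) (Fin 2) ℝ :=
  fun i j => (if i = j then 1 else 0) +
    ((Γ ‖x‖ / ‖x‖) ^ 2 - 1) / ‖x‖ ^ 2 * perp x i * perp x j

/-- Partial derivative `∂_j f` in the normal coordinates. -/
def partialDeriv (f : Plane → ℝ) (j : Fin 2) (x : Plane) : ℝ :=
  fderiv ℝ f x (EuclideanSpace.single j 1)

/-- Christoffel symbols `Γ^i_{jl}` of the Levi-Civita connection of the metric. -/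
def christoffel (Γ : ℝ → ℝ) (x : Plane) (i j l : Fin 2) : ℝ :=
  (1 / 2) * ∑ m, (metric Γ x)⁻¹ i m *
    (partialDeriv (fun y => metric Γ y l m) j x + partialDeriv (fun y => metric Γ y j m) l x -
      partialDeriv (fun y => metric Γ y j l) m x)

/-- The covariant derivative `D_a W_a` of the velocity of the curve `W` along `W`. -/
def covAccel (Γ : ℝ → ℝ) (W : ℝ → Plane) (a : ℝ) : Plane :=
  WithLp.toLp 2 fun i => deriv (deriv W) a i +
    ∑ j, ∑ l, christoffel Γ (W a) i j l * deriv W a j * deriv W a l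

/-- The Riemannian gradient of a function `f` on the surface. -/
def grad (Γ : ℝ → ℝ) (f : Plane → ℝ) (x : Plane) : Plane :=
  WithLp.toLp 2 fun i => ∑ j, (metric Γ x)⁻¹ i j * partialDeriv f j x

/-- The complex structure `𝒥` on the tangent space at `x`: counterclockwise rotation by `π / 2`
with respect to the metric. -/
def complexStructure (Γ : ℝ → ℝ) (x v : Plane) : Plane :=
  (√(metric Γ x).det)⁻¹ •
    !₂[-(metric Γ x 1 0 * v 0 + metric Γ x 1 1 * v 1),
      metric Γ x 0 0 * v 0 + metric Γ x 0 1 * v 1]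

/-- The Riemannian length `|v|` of a tangent vector `v` at `x`. -/
def riemNorm (Γ : ℝ → ℝ) (x v : Plane) : ℝ :=
  √(∑ i, ∑ j, metric Γ x i j * v i * v j)

/-- `F(s) = ∫₀ˢ Γ`. -/
def potF (Γ : ℝ → ℝ) (s : ℝ) : ℝ := ∫ t in (0 : ℝ)..s, Γ t

/-- `G(s) = (k² / 2) Γ² + b k F - k² F²`. -/
def potG (Γ : ℝ → ℝ) (k b s : ℝ) : ℝ :=
  k ^ 2 / 2 * Γ s ^ 2 + b * k * potF Γ s - k ^ 2 * potF Γ s ^ 2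

/-- `W : [0, A) → N` is continuous, and on `(0, A)` it is a classical solution of
`D_a W_a + W_a / a + ∇G / a² - μ ∇F + (c / a) 𝒥 W_a = 0`. -/
structure IsProfileSolution (s₀ : ℝ≥0∞) (Γ : ℝ → ℝ) (k b c μ A : ℝ) (W : ℝ → Plane) : Prop where
  mem_chart : ∀ a ∈ Ico 0 A, ENNReal.ofReal ‖W a‖ < s₀
  continuousOn : ContinuousOn W (Ico 0 A)
  contDiffOn : ContDiffOn ℝ 2 W (Ioo 0 A)
  ode : ∀ a ∈ Ioo 0 A,
    covAccel Γ W a + (1 / a) • deriv W a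
      + (1 / a ^ 2) • grad Γ (fun x => potG Γ k b ‖x‖) (W a)
      - μ • grad Γ (fun x => potF Γ ‖x‖) (W a)
      + (c / a) • complexStructure Γ (W a) (deriv W a) = 0

/-- `W` is a solution whose domain contains `[0, a₁]`, with `s(0) = 0` and `s(a₁) = s₁`, which
stays in the disc `{s < δ}` around the rotation center for `a ∈ [0, a₁]`. -/
def IsLocalProfile (s₀ : ℝ≥0∞) (Γ : ℝ → ℝ) (k b c μ a₁ δ s₁ : ℝ) (W : ℝ → Plane) : Prop :=
  (∃ A, a₁ < A ∧ IsProfileSolution s₀ Γ k b c μ A W) ∧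
    ‖W 0‖ = 0 ∧ ‖W a₁‖ = s₁ ∧ ∀ a ∈ Icc 0 a₁, ‖W a‖ < δ

/-- `(s, r, γ)` solves on `(0, A)` the first order system
`a s_a = r Γ cos γ`, `a r_a = (-Γ_s r² - G_s / Γ + μ a²) cos γ`,
`a γ_a = (-Γ_s r + G_s / (r Γ) - μ a² / r) sin γ - c`,
where `r > 0`, and `s` is continuous on `[0, A)`. -/
structure IsPolarSolution (Γ : ℝ → ℝ) (k b c μ A : ℝ) (s r γ : ℝ → ℝ) : Prop where
  continuousOn : ContinuousOn s (Ico 0 A)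
  r_pos : ∀ a ∈ Ioo 0 A, 0 < r a
  deriv_s : ∀ a ∈ Ioo 0 A, HasDerivAt s (1 / a * (r a * Γ (s a) * Real.cos (γ a))) a
  deriv_r : ∀ a ∈ Ioo 0 A, HasDerivAt r
    (1 / a * ((-deriv Γ (s a) * r a ^ 2 - deriv (potG Γ k b) (s a) / Γ (s a) + μ * a ^ 2)
      * Real.cos (γ a))) a
  deriv_γ : ∀ a ∈ Ioo 0 A, HasDerivAt γ
    (1 / a * ((-deriv Γ (s a) * r a + deriv (potG Γ k b) (s a) / (r a * Γ (s a))
      - μ * (a ^ 2 / r a)) * Real.sin (γ a) - c)) a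

/-- `(s, r, γ)` is a solution of the first order system whose domain contains `(0, a₁]`, with
`s(0) = 0` and `s(a₁) = s₁`, and with `|s| < δ` on `[0, a₁]`. -/
def IsLocalPolar (Γ : ℝ → ℝ) (k b c μ a₁ δ s₁ : ℝ) (s r γ : ℝ → ℝ) : Prop :=
  (∃ A, a₁ < A ∧ IsPolarSolution Γ k b c μ A s r γ) ∧
    s 0 = 0 ∧ s a₁ = s₁ ∧ ∀ a ∈ Icc 0 a₁, |s a| < δ

/-- The exponent `κ = √(-(k² + b k) - c² / 4)`. -/
def kappa (k b c : ℝ) : ℝ := √(-(k ^ 2 + b * k) - c ^ 2 / 4)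

end RevSurface

end

open scoped Matrix

noncomputable section

namespace RevSurface

/-! Put `P = a s_a`. Rotational symmetry gives a first integral, the angular momentum `L = a Γ² β_a
+ c F`. It vanishes for every solution that tends to the center: if `L ≠ 0`, the centrifugal term of
order `L² / Γ³` makes `a P_a ≥ 1` near `a = 0`, so `P → -∞`, and then `s` grows as `a → 0` instead
of tending to zero (`angularMomentum_eq_zero`). With `L = 0` there remains the scalar equation `(a
d/da)² s = f(s) + μ a² Γ(s)`, where `f` is `redForce` at angular momentum zero. As `F / Γ² → 1/2` at
the center, `f'(0) = -(k² + b k) - c²/4 = κ²` (`exists_small_disc`). In the time `log a` the center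
is therefore a saddle with exponents `±κ`, and the solutions sought form its unstable manifold: one
for each small value of `s(a⋆)`, decaying like `a ^ κ`.

Existence (`exists_unstable_solution`): with `ξ = (a / a⋆) ^ η` and `s = ξ ^ (κ / η) y` the
singularity at `a = 0` becomes mild enough for a contraction argument for `y` on `[0, 2]`, where the
condition `s(a⋆) = s₁` reads `y(1) = s₁`.

Uniqueness (`IsReducedSolution.eqOn`): near the center the force is strictly increasing in `s`, so
the difference of two solutions with equal boundary values has no positive interior maximum.

The angular variable is recovered from `L = 0`. In the polar system `r cos γ = P / Γ` and `r sin γ =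
-c F / Γ²`; for curves `β_a = -c F / (a Γ²)`, which fixes `β` up to a constant, that is, up to a
rotation. Curves may also pass through the center, where polar coordinates break down;
`hasDerivAt_angMomentum_of_eq_zero` and `IsLocalProfile.ne_zero` deal with this. -/

section Expansions

/-! ### First order expansions at `0+` -/

/-- `f(s) = m + O(s)` as `s → 0+`. -/
def IsNear (f : ℝ → ℝ) (m : ℝ) : Prop := (fun s => f s - m) =O[𝓝[>] 0] fun s : ℝ => s

theorem IsNear.tendsto {f : ℝ → ℝ} {m : ℝ} (hf : IsNear f m) : Tendsto f (𝓝[>] 0) (𝓝 m) := by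
  have h : Tendsto (fun s => f s - m) (𝓝[>] 0) (𝓝 0) :=
    hf.trans_tendsto (tendsto_id.mono_left nhdsWithin_le_nhds)
  simpa using h.add_const m

theorem isNear_const (m : ℝ) : IsNear (fun _ => m) m := by
  simp [IsNear, isBigO_zero]

theorem IsNear.add {f g : ℝ → ℝ} {m n : ℝ} (hf : IsNear f m) (hg : IsNear g n) :
    IsNear (fun s => f s + g s) (m + n) :=
  (IsBigO.add hf hg).congr_left fun s => by ring

theorem IsNear.sub {f g : ℝ → ℝ} {m n : ℝ} (hf : IsNear f m) (hg : IsNear g n) :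
    IsNear (fun s => f s - g s) (m - n) :=
  (IsBigO.sub hf hg).congr_left fun s => by ring

theorem IsNear.mul {f g : ℝ → ℝ} {m n : ℝ} (hf : IsNear f m) (hg : IsNear g n) :
    IsNear (fun s => f s * g s) (m * n) := by
  have h1 : (fun s => (f s - m) * g s) =O[𝓝[>] 0] fun s : ℝ => s := by
    simpa using IsBigO.mul hf (hg.tendsto.isBigO_one ℝ)
  have h2 : (fun s => m * (g s - n)) =O[𝓝[>] 0] fun s : ℝ => s := IsBigO.const_mul_left hg m
  exact (h1.add h2).congr_left fun s => by ring

theorem IsNear.inv {f : ℝ → ℝ} {m : ℝ} (hf : IsNear f m) (hm : m ≠ 0) :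
    IsNear (fun s => (f s)⁻¹) m⁻¹ := by
  have h1 : (fun s => (f s - m) * (-(m⁻¹ * (f s)⁻¹))) =O[𝓝[>] 0] fun s : ℝ => s := by
    simpa using IsBigO.mul hf (((hf.tendsto.inv₀ hm).const_mul m⁻¹).neg.isBigO_one ℝ)
  refine h1.congr' ?_ EventuallyEq.rfl
  filter_upwards [hf.tendsto.eventually_ne hm] with s hs
  field_simp
  ring

theorem IsNear.of_hasDerivAt {f : ℝ → ℝ} {f' : ℝ} (hf : HasDerivAt f f' 0) :
    IsNear f (f 0) := by
  have h := hf.isBigO_sub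
  simp only [sub_zero] at h
  exact h.mono nhdsWithin_le_nhds

theorem IsNear.congr {f g : ℝ → ℝ} {m : ℝ} (hf : IsNear f m) (h : ∀ s, 0 < s → f s = g s) :
    IsNear g m := by
  refine IsBigO.congr' hf ?_ EventuallyEq.rfl
  filter_upwards [self_mem_nhdsWithin] with s hs
  rw [h s hs]

theorem isBigO_pow_succ_of_deriv {f f' : ℝ → ℝ} (n : ℕ) (hf : ∀ s, HasDerivAt f (f' s) s)
    (h0 : f 0 = 0) (hO : f' =O[𝓝[>] 0] fun s : ℝ => s ^ n) :
    f =O[𝓝[>] 0] fun s : ℝ => s ^ (n + 1) := by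
  obtain ⟨C, hC⟩ := hO.bound
  obtain ⟨r, hr, hrC⟩ := mem_nhdsGT_iff_exists_Ioo_subset.1 hC
  have hr : (0 : ℝ) < r := hr
  refine IsBigO.of_bound C ?_
  filter_upwards [Ioo_mem_nhdsGT hr] with s hs
  obtain ⟨t, ht, hts⟩ := exists_hasDerivAt_eq_slope f f' hs.1
    (fun x _ => (hf x).continuousAt.continuousWithinAt) (fun x _ => hf x)
  have h2 := hrC (show t ∈ Ioo 0 r from ⟨ht.1, ht.2.trans hs.2⟩)
  simp only [mem_ofPred_eq, Real.norm_eq_abs] at h2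
  have hs0 := hs.1
  rw [h0, sub_zero, sub_zero, eq_div_iff hs0.ne'] at hts
  rw [← hts, Real.norm_eq_abs, Real.norm_eq_abs, abs_mul, pow_succ, abs_mul, ← mul_assoc]
  have hpow : |t ^ n| ≤ |s ^ n| := by
    rw [abs_pow, abs_pow]
    exact pow_le_pow_left₀ (abs_nonneg _)
      (by rw [abs_of_pos ht.1, abs_of_pos hs0]; exact ht.2.le) n
  have hC0 : 0 ≤ C ∨ C < 0 := le_or_gt 0 C
  have : C * |t ^ n| ≤ C * |s ^ n| := by
    rcases hC0 with h | h
    · gcongr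
    · have h3 : 0 < |t ^ n| := abs_pos.2 (pow_ne_zero _ ht.1.ne')
      have h4 := abs_nonneg (f' t)
      nlinarith
  gcongr
  exact h2.trans this

/-! ### The potentials and the reduced force -/

variable {Γ : ℝ → ℝ}

theorem hasDerivAt_potF (hΓ : Continuous Γ) (s : ℝ) : HasDerivAt (potF Γ) (Γ s) s :=
  intervalIntegral.integral_hasDerivAt_right (hΓ.intervalIntegrable _ _)
    (hΓ.stronglyMeasurableAtFilter _ _) hΓ.continuousAt

theorem potF_zero : potF Γ 0 = 0 := by simp [potF]

theorem contDiff_deriv (hΓ : ContDiff ℝ ∞ Γ) : ContDiff ℝ ∞ (deriv Γ) :=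
  (contDiff_infty_iff_deriv.1 hΓ).2

theorem hasDerivAt_self (hΓ : ContDiff ℝ ∞ Γ) (s : ℝ) : HasDerivAt Γ (deriv Γ s) s :=
  ((contDiff_infty_iff_deriv.1 hΓ).1 s).hasDerivAt

theorem contDiff_potF (hΓ : ContDiff ℝ ∞ Γ) : ContDiff ℝ ∞ (potF Γ) := by
  rw [contDiff_infty_iff_deriv]
  refine ⟨fun s => (hasDerivAt_potF hΓ.continuous s).differentiableAt, ?_⟩
  rwa [show deriv (potF Γ) = Γ from funext fun s => (hasDerivAt_potF hΓ.continuous s).deriv]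

/-- The derivative of `potG`. -/
def potGDeriv (Γ : ℝ → ℝ) (k b s : ℝ) : ℝ :=
  k ^ 2 * Γ s * deriv Γ s + b * k * Γ s - 2 * k ^ 2 * potF Γ s * Γ s

theorem hasDerivAt_potG (hΓ : ContDiff ℝ ∞ Γ) (k b s : ℝ) :
    HasDerivAt (potG Γ k b) (potGDeriv Γ k b s) s := by
  have h1 := hasDerivAt_self hΓ s
  have h2 := hasDerivAt_potF hΓ.continuous s
  have h := (((h1.pow 2).const_mul (k ^ 2 / 2)).add (h2.const_mul (b * k))).sub
    ((h2.pow 2).const_mul (k ^ 2))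
  refine h.congr_deriv ?_
  simp only [potGDeriv]
  push_cast
  ring

theorem deriv_potG (hΓ : ContDiff ℝ ∞ Γ) (k b s : ℝ) :
    deriv (potG Γ k b) s = potGDeriv Γ k b s := (hasDerivAt_potG hΓ k b s).deriv

/-- The autonomous part of the radial force at angular momentum `L`. -/
def redForce (Γ : ℝ → ℝ) (k b c L s : ℝ) : ℝ :=
  deriv Γ s * (L - c * potF Γ s) ^ 2 / Γ s ^ 3 + c * (L - c * potF Γ s) / Γ s - potGDeriv Γ k b s

/-- The derivative of `redForce` at angular momentum zero. -/
def redForceDeriv (Γ : ℝ → ℝ) (k b c s : ℝ) : ℝ :=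
  c ^ 2 * (3 * (potF Γ s / Γ s ^ 2 * deriv Γ s) - 3 * (potF Γ s / Γ s ^ 2 * deriv Γ s) ^ 2 - 1
      + (potF Γ s / Γ s ^ 2) ^ 2 * (Γ s * deriv (deriv Γ) s))
    - (k ^ 2 * (deriv Γ s ^ 2 + Γ s * deriv (deriv Γ) s) + b * k * deriv Γ s
      - 2 * k ^ 2 * (Γ s ^ 2 + potF Γ s * deriv Γ s))

theorem hasDerivAt_redForce (hΓ : ContDiff ℝ ∞ Γ) (k b c : ℝ) {s : ℝ} (hs : Γ s ≠ 0) :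
    HasDerivAt (redForce Γ k b c 0) (redForceDeriv Γ k b c s) s := by
  have h1 := hasDerivAt_self hΓ s
  have h2 := hasDerivAt_potF hΓ.continuous s
  have h3 := hasDerivAt_self (contDiff_deriv hΓ) s
  have h4 := (h2.const_mul c).const_sub 0
  have h5 := ((h3.mul (h4.pow 2)).div (h1.pow 3) (pow_ne_zero _ hs)).add
    ((h4.const_mul c).div h1 hs)
  have h6 := (((h1.const_mul (k ^ 2)).mul h3).add (h1.const_mul (b * k))).sub
    ((h2.const_mul (2 * k ^ 2)).mul h1)
  refine (h5.sub h6).congr_deriv ?_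
  simp only [redForceDeriv, Pi.pow_apply, Pi.mul_apply]
  push_cast
  field_simp
  ring

theorem isNear_deriv (hΓ : ContDiff ℝ ∞ Γ) (h1 : deriv Γ 0 = 1) : IsNear (deriv Γ) 1 := by
  simpa [h1] using IsNear.of_hasDerivAt (hasDerivAt_self (contDiff_deriv hΓ) 0)

theorem isBigO_sub_self (hΓ : ContDiff ℝ ∞ Γ) (h0 : Γ 0 = 0) (h1 : deriv Γ 0 = 1) :
    (fun s => Γ s - s) =O[𝓝[>] 0] fun s : ℝ => s ^ 2 := by
  refine isBigO_pow_succ_of_deriv 1 (f' := fun s => deriv Γ s - 1)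
    (fun s => (hasDerivAt_self hΓ s).sub (hasDerivAt_id s)) (by simp [h0]) ?_
  simpa [IsNear] using isNear_deriv hΓ h1

theorem isNear_div_self (hΓ : ContDiff ℝ ∞ Γ) (h0 : Γ 0 = 0) (h1 : deriv Γ 0 = 1) :
    IsNear (fun s => Γ s / s) 1 := by
  have h := (isBigO_sub_self hΓ h0 h1).mul (isBigO_refl (fun s : ℝ => s⁻¹) (𝓝[>] 0))
  refine h.congr' ?_ ?_
  all_goals
    filter_upwards [self_mem_nhdsWithin] with s hs
    have hs : (0 : ℝ) < s := hs
    field_simp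

theorem isNear_potF_div_sq (hΓ : ContDiff ℝ ∞ Γ) (h0 : Γ 0 = 0) (h1 : deriv Γ 0 = 1) :
    IsNear (fun s => potF Γ s / s ^ 2) (1 / 2) := by
  have h2 : (fun s => potF Γ s - s ^ 2 / 2) =O[𝓝[>] 0] fun s : ℝ => s ^ 3 := by
    refine isBigO_pow_succ_of_deriv 2 (f' := fun s => Γ s - s) (fun s => ?_)
      (by simp [potF_zero]) (isBigO_sub_self hΓ h0 h1)
    refine ((hasDerivAt_potF hΓ.continuous s).sub ((hasDerivAt_pow 2 s).div_const 2)).congr_deriv ?_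
    norm_num
  have h := h2.mul (isBigO_refl (fun s : ℝ => (s ^ 2)⁻¹) (𝓝[>] 0))
  refine h.congr' ?_ ?_
  all_goals
    filter_upwards [self_mem_nhdsWithin] with s hs
    have hs : (0 : ℝ) < s := hs
    field_simp

theorem isNear_potF_div (hΓ : ContDiff ℝ ∞ Γ) (h0 : Γ 0 = 0) (h1 : deriv Γ 0 = 1) :
    IsNear (fun s => potF Γ s / Γ s ^ 2) (1 / 2) := by
  have hP := isNear_div_self hΓ h0 h1
  have h := (isNear_potF_div_sq hΓ h0 h1).mul ((hP.mul hP).inv (by norm_num))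
  norm_num at h
  refine IsNear.congr (by norm_num; exact h) fun s hs => ?_
  by_cases hz : Γ s = 0
  · simp [hz]
  · field_simp

/-- With `F / Γ² → 1/2` and `Γ' → 1` the bracket multiplying `c²` tends to `3/2 - 3/4 - 1 = -1/4`.
The rate `O(s)`, not just the limit, is what later makes the deviation of the force from its linear
part quadratic. -/
theorem isNear_redForceDeriv (hΓ : ContDiff ℝ ∞ Γ) (h0 : Γ 0 = 0) (h1 : deriv Γ 0 = 1)
    (k b c : ℝ) :
    IsNear (redForceDeriv Γ k b c) (-(k ^ 2 + b * k) - c ^ 2 / 4) := by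
  have hD := isNear_deriv hΓ h1
  have hG : IsNear Γ 0 := by simpa [h0] using IsNear.of_hasDerivAt (hasDerivAt_self hΓ 0)
  have hF : IsNear (potF Γ) 0 := by
    simpa [potF_zero] using IsNear.of_hasDerivAt (hasDerivAt_potF hΓ.continuous 0)
  have hDD := IsNear.of_hasDerivAt (hasDerivAt_self (contDiff_deriv (contDiff_deriv hΓ)) 0)
  have hQ := isNear_potF_div hΓ h0 h1
  have hu := hQ.mul hD
  have h := ((isNear_const (c ^ 2)).mul (((((isNear_const 3).mul hu).sub
    ((isNear_const 3).mul (hu.mul hu))).sub (isNear_const 1)).add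
      ((hQ.mul hQ).mul (hG.mul hDD)))).sub ((((isNear_const (k ^ 2)).mul ((hD.mul hD).add
        (hG.mul hDD))).add ((isNear_const (b * k)).mul hD)).sub
          ((isNear_const (2 * k ^ 2)).mul ((hG.mul hG).add (hF.mul hD))))
  have h' := h.congr (g := redForceDeriv Γ k b c) fun s _ => by simp only [redForceDeriv]; ring
  convert h' using 1
  ring

theorem tendsto_redForce_zero (hΓ : ContDiff ℝ ∞ Γ) (h0 : Γ 0 = 0) (h1 : deriv Γ 0 = 1)
    (k b c : ℝ) : Tendsto (redForce Γ k b c 0) (𝓝[>] 0) (𝓝 0) := by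
  have hD := isNear_deriv hΓ h1
  have hG : IsNear Γ 0 := by simpa [h0] using IsNear.of_hasDerivAt (hasDerivAt_self hΓ 0)
  have hF : IsNear (potF Γ) 0 := by
    simpa [potF_zero] using IsNear.of_hasDerivAt (hasDerivAt_potF hΓ.continuous 0)
  have hQ := isNear_potF_div hΓ h0 h1
  have h := ((((isNear_const (c ^ 2)).mul hD).mul ((hQ.mul hQ).mul hG)).sub
    (((isNear_const (c ^ 2)).mul hQ).mul hG)).sub
    (((((isNear_const (k ^ 2)).mul hG).mul hD).add ((isNear_const (b * k)).mul hG)).sub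
      (((isNear_const (2 * k ^ 2)).mul hF).mul hG))
  have h' := h.congr (g := redForce Γ k b c 0) fun s _ => by
    simp only [redForce, potGDeriv]
    by_cases hz : Γ s = 0
    · simp [hz]
    · field_simp
      ring
  simpa using h'.tendsto

/-- Division by zero returns zero, which is also the limit at `0+`; hence the force is continuous on
a closed interval starting at `0`. -/
theorem redForce_zero_zero (h0 : Γ 0 = 0) 
   (k b c : ℝ) : redForce Γ k b c 0 0 = 0 := by
  simp [redForce, potGDeriv, potF_zero, h0]

/-- Size estimates for `Γ`, its primitive and the radial force in a small disc. -/
theorem exists_small_disc (hΓ : ContDiff ℝ ∞ Γ) (h0 : Γ 0 = 0) (h1 : deriv Γ 0 = 1)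
    {s₀ : ℝ≥0∞} (hs₀ : 0 < s₀) (k b c : ℝ) :
    ∃ ρ : ℝ, 0 < ρ ∧ ENNReal.ofReal ρ < s₀ ∧ ∃ B : ℝ, 0 ≤ B ∧
      (∀ s, |s| ≤ ρ → 1 / 2 ≤ deriv Γ s ∧ deriv Γ s ≤ 2) ∧
      ContinuousOn (redForce Γ k b c 0) (Icc 0 ρ) ∧
      ∀ s t, 0 ≤ t → t ≤ s → s ≤ ρ →
        |redForce Γ k b c 0 s - redForce Γ k b c 0 t
          - (-(k ^ 2 + b * k) - c ^ 2 / 4) * (s - t)| ≤ B * s * (s - t) := by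
  obtain ⟨B, hB0, hB⟩ := (isNear_redForceDeriv hΓ h0 h1 k b c).exists_nonneg
  obtain ⟨ρ₁, hρ₁, hB⟩ := mem_nhdsGT_iff_exists_Ioo_subset.1 hB.bound
  have hρ₁ : (0 : ℝ) < ρ₁ := hρ₁
  obtain ⟨ρ₂, hρ₂, hD⟩ := Metric.continuous_iff'.1 (contDiff_deriv hΓ).continuous 0 (1 / 2)
    (by norm_num) |> Metric.eventually_nhds_iff.1
  obtain ⟨ρ₃, hρ₃, hρs⟩ : ∃ r : ℝ, 0 < r ∧ ENNReal.ofReal r < s₀ := by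
    obtain ⟨r, hr0, hr⟩ := ENNReal.lt_iff_exists_real_btwn.1 hs₀
    exact ⟨r, by simpa using hr.1, hr.2⟩
  -- `ρ₁` controls the expansion of the derivative of the force, `ρ₂` keeps `Γ'` within `1/2` of
  -- `1`, and `ρ₃` keeps the disc inside the chart.
  set ρ := min (ρ₁ / 2) (min (ρ₂ / 2) ρ₃) with hρdef
  have hρ : 0 < ρ := by positivity
  have hle1 : ρ < ρ₁ := (min_le_left _ _).trans_lt (by linarith)
  have hle2 : ρ < ρ₂ := (min_le_right _ _).trans_lt ((min_le_left _ _).trans_lt (by linarith))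
  have hle3 : ρ ≤ ρ₃ := (min_le_right _ _).trans (min_le_right _ _)
  have hder : ∀ s, |s| ≤ ρ → 1 / 2 ≤ deriv Γ s ∧ deriv Γ s ≤ 2 := by
    intro s hs
    have := hD (y := s) (by simpa using hs.trans_lt hle2)
    rw [Real.dist_eq, h1, abs_lt] at this
    constructor <;> linarith
  have hpos : ∀ s, 0 < s → s ≤ ρ → 0 < Γ s := by
    intro s hs hsρ
    obtain ⟨t, ht, hts⟩ := exists_hasDerivAt_eq_slope Γ (deriv Γ) hs
      hΓ.continuous.continuousOn (fun x _ => hasDerivAt_self hΓ x)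
    have h2 := (hder t (by rw [abs_of_pos ht.1]; linarith [ht.2])).1
    rw [h0, sub_zero, sub_zero, eq_div_iff hs.ne'] at hts
    rw [← hts]
    nlinarith
  have hcont : ContinuousOn (redForce Γ k b c 0) (Icc 0 ρ) := by
    intro s hs
    rcases hs.1.eq_or_lt with h | h
    · subst h
      have h3 : ContinuousWithinAt (redForce Γ k b c 0) (Ioi 0) 0 := by
        rw [ContinuousWithinAt, redForce_zero_zero h0]
        exact tendsto_redForce_zero hΓ h0 h1 k b c
      exact (continuousWithinAt_Ioi_iff_Ici.1 h3).mono Icc_subset_Ici_self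
    · exact (hasDerivAt_redForce hΓ k b c
        (hpos s h hs.2).ne').continuousAt.continuousWithinAt
  refine ⟨ρ, hρ, (ENNReal.ofReal_le_ofReal hle3).trans_lt hρs, B, hB0, hder, hcont, ?_⟩
  intro s t ht hts hsρ
  rcases hts.eq_or_lt with h | h
  · subst h; simp
  -- Mean value theorem: the slope differs from `κ²` by at most `B x` with `t < x < s`.
  obtain ⟨x, hx, hxs⟩ := exists_hasDerivAt_eq_slope (redForce Γ k b c 0) (redForceDeriv Γ k b c) h
    (hcont.mono (Icc_subset_Icc ht hsρ)) (fun x hx => hasDerivAt_redForce hΓ k b c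
      (hpos x (ht.trans_lt hx.1) (hx.2.le.trans hsρ)).ne')
  have h3 := hB (show x ∈ Ioo 0 ρ₁ from ⟨ht.trans_lt hx.1, by linarith [hx.2]⟩)
  simp only [mem_ofPred_eq, Real.norm_eq_abs, abs_of_pos (ht.trans_lt hx.1)] at h3
  rw [eq_div_iff (by linarith)] at hxs
  rw [← hxs, ← sub_mul, abs_mul, abs_of_pos (sub_pos.2 h)]
  have : B * x ≤ B * s := by gcongr; exact hx.2.le
  gcongr
  exact h3.trans this

end Expansions

section SingularEquation

/-! ### A singular initial value problem -/

/-- The averages `∫₀¹ t^p n(t ξ) dt`. -/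
def weightedMean (p : ℝ) (n : ℝ → ℝ) (ξ : ℝ) : ℝ := ∫ t in (0 : ℝ)..1, t ^ p * n (t * ξ)

theorem continuous_weightedMean {p : ℝ} (hp : 0 ≤ p) {n : ℝ → ℝ} (hn : Continuous n) :
    Continuous (weightedMean p n) := by
  refine intervalIntegral.continuous_parametric_intervalIntegral_of_continuous'
    (f := fun ξ t : ℝ => t ^ p * n (t * ξ)) ?_ 0 1
  have : Continuous fun t : ℝ => t ^ p := Real.continuous_rpow_const hp
  simp only [Function.uncurry_def]
  fun_prop

theorem abs_weightedMean_sub_le {p : ℝ} (hp : 0 ≤ p) {m n : ℝ → ℝ} (hm : Continuous m)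
    (hn : Continuous n) {C : ℝ} (h : ∀ ξ, |m ξ - n ξ| ≤ C) (ξ : ℝ) :
    |weightedMean p m ξ - weightedMean p n ξ| ≤ C := by
  have hc : Continuous fun t : ℝ => t ^ p := Real.continuous_rpow_const hp
  rw [weightedMean, weightedMean, ← intervalIntegral.integral_sub]
  · have := intervalIntegral.norm_integral_le_of_norm_le_const (a := (0 : ℝ)) (b := 1) (C := C)
      (f := fun t => t ^ p * m (t * ξ) - t ^ p * n (t * ξ)) fun t ht => by
        rw [uIoc_of_le zero_le_one] at ht
        rw [← mul_sub, norm_mul, Real.norm_eq_abs, Real.norm_eq_abs,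
          abs_of_nonneg (Real.rpow_nonneg ht.1.le p)]
        have h1 := Real.rpow_le_one ht.1.le ht.2 hp
        calc t ^ p * |m (t * ξ) - n (t * ξ)| ≤ 1 * C :=
              mul_le_mul h1 (h _) (abs_nonneg _) zero_le_one
          _ = C := one_mul C
    simpa using this
  · exact (hc.mul (hm.comp (by fun_prop))).intervalIntegrable _ _
  · exact (hc.mul (hn.comp (by fun_prop))).intervalIntegrable _ _

/-- Substituting `t ↦ t ξ` identifies the function with `∫₀^ξ t^p n(t) dt`. The mean is this
integral divided by `ξ ^ (p + 1)`, in a form that is continuous at `ξ = 0`. -/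
theorem hasDerivAt_rpow_mul_weightedMean {p : ℝ} (hp : 0 ≤ p) {n : ℝ → ℝ} (hn : Continuous n)
    {ξ : ℝ} (hξ : 0 < ξ) :
    HasDerivAt (fun x => x ^ (p + 1) * weightedMean p n x) (ξ ^ p * n ξ) ξ := by
  have hc : Continuous fun t : ℝ => t ^ p * n t := (Real.continuous_rpow_const hp).mul hn
  have h := intervalIntegral.integral_hasDerivAt_right (hc.intervalIntegrable 0 ξ)
    (hc.stronglyMeasurableAtFilter _ _) hc.continuousAt
  refine h.congr_of_eventuallyEq ?_
  filter_upwards [lt_mem_nhds hξ] with x hx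
  have h2 := intervalIntegral.mul_integral_comp_mul_right (a := 0) (b := 1)
    (f := fun t : ℝ => t ^ p * n t) (c := x)
  simp only [zero_mul, one_mul] at h2
  rw [← h2, weightedMean, Real.rpow_add hx, Real.rpow_one, mul_comm (x ^ p) x, mul_assoc,
    ← intervalIntegral.integral_const_mul]
  congr 1
  refine intervalIntegral.integral_congr fun t ht => ?_
  rw [uIcc_of_le zero_le_one] at ht
  simp only [Real.mul_rpow ht.1 hx.le]
  ring

/-- Banach fixed point for `y = s₁ + K ∫₁^ξ z`, with `z` the weighted mean of `N(ξ, y)`. On `[0, 2]`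
one has `|ξ - 1| ≤ 1`, so the contraction rate is `K ε ≤ 1/4`. The interval reaches beyond `1` so
that the value is prescribed at an interior point. -/
theorem exists_singular_solution {N : ℝ → ℝ → ℝ} (hN : Continuous (Function.uncurry N))
    {ε K p s₁ : ℝ} (hε : ∀ ξ y y', |N ξ y - N ξ y'| ≤ ε * |y - y'|) (hN0 : ∀ ξ, N ξ 0 = 0)
    (hε0 : 0 ≤ ε) (hK : 0 ≤ K) (hKε : K * ε ≤ 1 / 4) (hp : 0 ≤ p) (hs₁ : 0 ≤ s₁) :
    ∃ y z : ℝ → ℝ, Continuous y ∧ y 1 = s₁ ∧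
      (∀ ξ ∈ Icc (0 : ℝ) 2, |y ξ - s₁| ≤ s₁ / 3 ∧ |z ξ| ≤ ε * (4 / 3 * s₁)) ∧
      (∀ ξ, HasDerivAt y (K * z ξ) ξ) ∧
      ∀ ξ ∈ Ioo (0 : ℝ) 2,
        HasDerivAt (fun x => x ^ (p + 1) * z x) (ξ ^ p * N ξ (y ξ)) ξ := by
  have h02 : (0 : ℝ) ≤ 2 := by norm_num
  let n : C(Icc (0 : ℝ) 2, ℝ) → ℝ → ℝ := fun u ξ => N ξ (IccExtend h02 u ξ)
  have hn : ∀ u, Continuous (n u) := fun u =>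
    hN.comp (continuous_id.prodMk (u.continuous.Icc_extend' (h := h02)))
  have hnd : ∀ u v ξ, |n u ξ - n v ξ| ≤ ε * dist u v := by
    intro u v ξ
    refine (hε _ _ _).trans ?_
    gcongr
    exact ContinuousMap.dist_apply_le_dist (f := u) (g := v) (projIcc 0 2 h02 ξ)
  let z : C(Icc (0 : ℝ) 2, ℝ) → ℝ → ℝ := fun u => weightedMean p (n u)
  have hz : ∀ u, Continuous (z u) := fun u => continuous_weightedMean hp (hn u)
  have hzd : ∀ u v ξ, |z u ξ - z v ξ| ≤ ε * dist u v := fun u v ξ =>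
    abs_weightedMean_sub_le hp (hn u) (hn v) (hnd u v) ξ
  let Y : C(Icc (0 : ℝ) 2, ℝ) → ℝ → ℝ := fun u ξ => s₁ + K * ∫ x in (1 : ℝ)..ξ, z u x
  have hYd : ∀ u ξ, HasDerivAt (Y u) (K * z u ξ) ξ := fun u ξ =>
    ((intervalIntegral.integral_hasDerivAt_right ((hz u).intervalIntegrable _ _)
      ((hz u).stronglyMeasurableAtFilter _ _) (hz u).continuousAt).const_mul K).const_add s₁
  have hY : ∀ u, Continuous (Y u) := fun u =>
    continuous_iff_continuousAt.2 fun ξ => (hYd u ξ).continuousAt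
  have hYdist : ∀ u v, ∀ ξ ∈ Icc (0 : ℝ) 2, |Y u ξ - Y v ξ| ≤ 1 / 4 * dist u v := by
    intro u v ξ hξ
    have h1 : Y u ξ - Y v ξ = K * ∫ x in (1 : ℝ)..ξ, (z u x - z v x) := by
      simp only [Y]
      rw [intervalIntegral.integral_sub ((hz u).intervalIntegrable _ _)
        ((hz v).intervalIntegrable _ _)]
      ring
    have h2 := intervalIntegral.norm_integral_le_of_norm_le_const (a := (1 : ℝ)) (b := ξ)
      (C := ε * dist u v) (f := fun x => z u x - z v x) fun t _ => hzd u v t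
    rw [Real.norm_eq_abs] at h2
    have h3 : |ξ - 1| ≤ 1 := by rw [abs_le]; constructor <;> linarith [hξ.1, hξ.2]
    have h4 : ε * dist u v * |ξ - 1| ≤ ε * dist u v :=
      mul_le_of_le_one_right (by positivity) h3
    rw [h1, abs_mul, abs_of_nonneg hK]
    calc _ ≤ K * (ε * dist u v) := by gcongr; exact h2.trans h4
      _ = K * ε * dist u v := by ring
      _ ≤ _ := by gcongr
  let T : C(Icc (0 : ℝ) 2, ℝ) → C(Icc (0 : ℝ) 2, ℝ) := fun u =>
    ⟨fun ξ => Y u ξ, (hY u).comp continuous_subtype_val⟩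
  have hT : ContractingWith (1 / 4) T := by
    refine ⟨by rw [← NNReal.coe_lt_coe]; norm_num, LipschitzWith.of_dist_le_mul fun u v => ?_⟩
    rw [ContinuousMap.dist_le (by positivity)]
    intro ξ
    have := hYdist u v ξ ξ.2
    rw [Real.dist_eq]
    simpa [T] using this
  obtain ⟨u, hu⟩ : ∃ u, T u = u := ⟨_, hT.fixedPoint_isFixedPt⟩
  have huY : ∀ ξ ∈ Icc (0 : ℝ) 2, IccExtend h02 u ξ = Y u ξ := by
    intro ξ hξ
    rw [IccExtend_of_mem h02 u hξ]
    exact (DFunLike.congr_fun hu ⟨ξ, hξ⟩).symm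
  have hn0 : n 0 = 0 := by
    funext ξ
    exact (congrArg (N ξ) (by simp [IccExtend])).trans (hN0 ξ)
  have hz0 : ∀ ξ, z 0 ξ = 0 := fun ξ => by simp [z, weightedMean, hn0]
  have hY0 : ∀ ξ, Y 0 ξ = s₁ := fun ξ => by simp [Y, hz0]
  -- The map sends `0` to the constant `s₁` and contracts by `1/4`, so the fixed point has norm at
  -- most `s₁ / (1 - 1/4)`.
  have hnorm : dist u 0 ≤ 4 / 3 * s₁ := by
    have : dist u 0 ≤ s₁ + 1 / 4 * dist u 0 := by
      rw [ContinuousMap.dist_le (by positivity)]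
      intro ξ
      have h1 := hYdist u 0 ξ ξ.2
      have h2 : u ξ = Y u ξ := (DFunLike.congr_fun hu ξ).symm
      rw [hY0, ← h2] at h1
      rw [Real.dist_eq]
      simp only [ContinuousMap.zero_apply, sub_zero]
      calc |u ξ| = |s₁ + (u ξ - s₁)| := by ring_nf
        _ ≤ |s₁| + |u ξ - s₁| := abs_add_le _ _
        _ ≤ _ := by rw [abs_of_nonneg hs₁]; gcongr
    linarith
  refine ⟨Y u, z u, hY u, by simp [Y], fun ξ hξ => ⟨?_, ?_⟩, hYd u, fun ξ hξ => ?_⟩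
  · have h1 := hYdist u 0 ξ hξ
    rw [hY0] at h1
    linarith
  · have h1 := hzd u 0 ξ
    rw [hz0, sub_zero] at h1
    exact h1.trans (by gcongr)
  · rw [← huY ξ ⟨hξ.1.le, hξ.2.le⟩]
    exact hasDerivAt_rpow_mul_weightedMean hp (hn u) hξ.1

end SingularEquation

section Blowup

/-! ### The unstable solutions of the reduced equation -/

/-- The nonlinearity of the reduced equation after the substitution `s = ξ ^ q * y`. -/
def blowupForce (e Γ : ℝ → ℝ) (q m ν ξ y : ℝ) : ℝ :=
  ξ ^ (-(1 + q)) * (e (ξ ^ q * y) + ν * ξ ^ m * Γ (ξ ^ q * y))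

/-! ### Lipschitz bounds for the rescaled force -/

section BlowupForce

variable {e Γ : ℝ → ℝ} {B ρ σ q m ν : ℝ}

/-- Here the convention `0 ^ r = 0` for `r ≠ 0` supplies the value of the continuous extension. -/
theorem blowupForce_zero_left (hq : 2 ≤ q) (y : ℝ) : blowupForce e Γ q m ν 0 y = 0 := by
  rw [blowupForce, Real.zero_rpow (show -(1 + q) ≠ 0 by linarith), zero_mul]

/-- Count powers of `ξ`: the quadratic term gives `ξ ^ (-(1+q)) ξ ^ (2q) = ξ · ξ ^ (q-2)`, the
perturbation `ξ ^ (-(1+q)) ξ ^ (m+q) = ξ · ξ ^ (m-2)`. As `q, m ≥ 2`, a full factor `ξ` survives,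
which gives continuity at `ξ = 0`. -/
theorem abs_blowupForce_sub_le_of_le
    (heB : ∀ s t, 0 ≤ t → t ≤ s → s ≤ ρ → |e s - e t| ≤ B * s * (s - t))
    (hΓl : ∀ s t, 0 ≤ t → t ≤ s → s ≤ ρ → |Γ s - Γ t| ≤ 2 * (s - t))
    (hB : 0 ≤ B) (hq : 2 ≤ q) (hm : 2 ≤ m) (hσ : 2 ^ q * σ ≤ ρ)
    {x w w' : ℝ} (hx : x ∈ Icc (0 : ℝ) 2) (hw : 0 ≤ w) (hww : w ≤ w') (hw' : w' ≤ σ) :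
    |blowupForce e Γ q m ν x w' - blowupForce e Γ q m ν x w|
      ≤ (B * σ + 2 * |ν|) * (2 ^ q + 2 ^ m) * x * (w' - w) := by
  rcases hx.1.eq_or_lt with h | hx0
  · subst h
    simp [blowupForce_zero_left hq]
  have hxq : 0 < x ^ q := Real.rpow_pos_of_pos hx0 q
  have hx2 : x ^ q ≤ 2 ^ q := Real.rpow_le_rpow hx0.le hx.2 (by linarith)
  have hle : x ^ q * w' ≤ ρ := by
    refine le_trans ?_ hσ
    have := hw.trans hww
    gcongr
  have h1 := heB (x ^ q * w') (x ^ q * w) (by positivity) (by gcongr) hle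
  have h2 := hΓl (x ^ q * w') (x ^ q * w) (by positivity) (by gcongr) hle
  have e1 : x ^ (-(1 + q)) * (x ^ q * x ^ q) = x * x ^ (q - 2) := by
    nth_rewrite 4 [← Real.rpow_one x]
    rw [← Real.rpow_add hx0, ← Real.rpow_add hx0, ← Real.rpow_add hx0]
    ring_nf
  have e2 : x ^ (-(1 + q)) * (x ^ m * x ^ q) = x * x ^ (m - 2) := by
    nth_rewrite 4 [← Real.rpow_one x]
    rw [← Real.rpow_add hx0, ← Real.rpow_add hx0, ← Real.rpow_add hx0]
    ring_nf
  have b1 : x ^ (q - 2) ≤ 2 ^ q + 2 ^ m := by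
    have a1 : x ^ (q - 2) ≤ 2 ^ (q - 2) := Real.rpow_le_rpow hx0.le hx.2 (by linarith)
    have a2 : (2 : ℝ) ^ (q - 2) ≤ 2 ^ q :=
      Real.rpow_le_rpow_of_exponent_le one_le_two (by linarith)
    have a3 : (0 : ℝ) < 2 ^ m := by positivity
    linarith
  have b2 : x ^ (m - 2) ≤ 2 ^ q + 2 ^ m := by
    have a1 : x ^ (m - 2) ≤ 2 ^ (m - 2) := Real.rpow_le_rpow hx0.le hx.2 (by linarith)
    have a2 : (2 : ℝ) ^ (m - 2) ≤ 2 ^ m :=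
      Real.rpow_le_rpow_of_exponent_le one_le_two (by linarith)
    have a3 : (0 : ℝ) < 2 ^ q := by positivity
    linarith
  have hd : blowupForce e Γ q m ν x w' - blowupForce e Γ q m ν x w
      = x ^ (-(1 + q)) * ((e (x ^ q * w') - e (x ^ q * w))
        + ν * x ^ m * (Γ (x ^ q * w') - Γ (x ^ q * w))) := by
    simp only [blowupForce]; ring
  have hd0 : 0 ≤ w' - w := by linarith
  have hn : 0 < x ^ (-(1 + q)) := Real.rpow_pos_of_pos hx0 _
  have hxm : 0 < x ^ m := Real.rpow_pos_of_pos hx0 _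
  rw [hd, abs_mul, abs_of_pos hn]
  calc x ^ (-(1 + q)) * |(e (x ^ q * w') - e (x ^ q * w))
        + ν * x ^ m * (Γ (x ^ q * w') - Γ (x ^ q * w))|
      ≤ x ^ (-(1 + q)) * (B * (x ^ q * w') * (x ^ q * w' - x ^ q * w)
        + |ν| * x ^ m * (2 * (x ^ q * w' - x ^ q * w))) := by
        gcongr
        refine (abs_add_le _ _).trans (add_le_add h1 ?_)
        rw [abs_mul, abs_mul, abs_of_pos hxm]
        gcongr
    _ = (x ^ (-(1 + q)) * (x ^ q * x ^ q)) * (B * w' * (w' - w))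
        + (x ^ (-(1 + q)) * (x ^ m * x ^ q)) * (2 * |ν| * (w' - w)) := by ring
    _ = x ^ (q - 2) * (x * (B * w' * (w' - w))) + x ^ (m - 2) * (x * (2 * |ν| * (w' - w))) := by
        rw [e1, e2]; ring
    _ ≤ (2 ^ q + 2 ^ m) * (x * (B * σ * (w' - w)))
        + (2 ^ q + 2 ^ m) * (x * (2 * |ν| * (w' - w))) := by
        have := hw.trans hww
        gcongr
    _ = _ := by ring

theorem abs_blowupForce_sub_le
    (heB : ∀ s t, 0 ≤ t → t ≤ s → s ≤ ρ → |e s - e t| ≤ B * s * (s - t))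
    (hΓl : ∀ s t, 0 ≤ t → t ≤ s → s ≤ ρ → |Γ s - Γ t| ≤ 2 * (s - t))
    (hB : 0 ≤ B) (hq : 2 ≤ q) (hm : 2 ≤ m) (hσ : 2 ^ q * σ ≤ ρ)
    {x w w' : ℝ} (hx : x ∈ Icc (0 : ℝ) 2) (hw : w ∈ Icc 0 σ) (hw' : w' ∈ Icc 0 σ) :
    |blowupForce e Γ q m ν x w' - blowupForce e Γ q m ν x w|
      ≤ (B * σ + 2 * |ν|) * (2 ^ q + 2 ^ m) * x * |w' - w| := by
  rcases le_total w w' with h | h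
  · rw [abs_of_nonneg (sub_nonneg.2 h)]
    exact abs_blowupForce_sub_le_of_le heB hΓl hB hq hm hσ hx hw.1 h hw'.2
  · rw [abs_sub_comm, abs_sub_comm w', abs_of_nonneg (sub_nonneg.2 h)]
    exact abs_blowupForce_sub_le_of_le heB hΓl hB hq hm hσ hx hw'.1 h hw.2

theorem blowupForce_zero (he0 : e 0 = 0) (hΓ0 : Γ 0 = 0) (x : ℝ) :
    blowupForce e Γ q m ν x 0 = 0 := by simp [blowupForce, he0, hΓ0]

theorem continuousOn_blowupForce (he : Continuous e) (hΓ : Continuous Γ) (he0 : e 0 = 0)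
    (hΓ0 : Γ 0 = 0)
    (heB : ∀ s t, 0 ≤ t → t ≤ s → s ≤ ρ → |e s - e t| ≤ B * s * (s - t))
    (hΓl : ∀ s t, 0 ≤ t → t ≤ s → s ≤ ρ → |Γ s - Γ t| ≤ 2 * (s - t))
    (hB : 0 ≤ B) (hq : 2 ≤ q) (hm : 2 ≤ m) (hσ0 : 0 ≤ σ) (hσ : 2 ^ q * σ ≤ ρ) :
    ContinuousOn (fun z : ℝ × ℝ => blowupForce e Γ q m ν z.1 z.2) (Icc 0 2 ×ˢ Icc 0 σ) := by
  rintro ⟨x, w⟩ ⟨hx, hw⟩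
  have hx : x ∈ Icc (0 : ℝ) 2 := hx
  have hw : w ∈ Icc (0 : ℝ) σ := hw
  rcases hx.1.eq_or_lt with h | hx0
  · subst h
    rw [ContinuousWithinAt, blowupForce_zero_left hq]
    have hb : Tendsto (fun z : ℝ × ℝ => (B * σ + 2 * |ν|) * (2 ^ q + 2 ^ m) * z.1 * σ)
        (𝓝[Icc 0 2 ×ˢ Icc 0 σ] (0, w)) (𝓝 0) := by
      have hc : Continuous fun z : ℝ × ℝ => (B * σ + 2 * |ν|) * (2 ^ q + 2 ^ m) * z.1 * σ := by
        fun_prop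
      simpa using (hc.tendsto (0, w)).mono_left nhdsWithin_le_nhds
    refine squeeze_zero_norm' ?_ hb
    filter_upwards [self_mem_nhdsWithin] with z hz
    have h1 := abs_blowupForce_sub_le (ν := ν) heB hΓl hB hq hm hσ hz.1
      (show (0 : ℝ) ∈ Icc 0 σ from ⟨le_rfl, hσ0⟩) hz.2
    rw [blowupForce_zero he0 hΓ0, sub_zero, sub_zero, abs_of_nonneg hz.2.1] at h1
    refine h1.trans ?_
    have := hz.1.1
    have := hz.2.2
    gcongr
  · have h1 : ∀ r : ℝ, ContinuousAt (fun z : ℝ × ℝ => z.1 ^ r) (x, w) := fun r =>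
      continuousAt_fst.rpow_const (Or.inl hx0.ne')
    have h2 : ContinuousAt (fun z : ℝ × ℝ => z.1 ^ q * z.2) (x, w) := (h1 q).mul continuousAt_snd
    exact ((h1 _).mul ((he.continuousAt.comp' h2).add
      ((continuousAt_const.mul (h1 m)).mul (hΓ.continuousAt.comp' h2)))).continuousWithinAt

end BlowupForce

/-- In the blown-up variable `ξ`, the reduced equation has for every small `s₁ > 0` a solution
which passes through `s₁` at `ξ = 1`. -/
theorem exists_blowup_solution {κ η B ρ σ ν s₁ : ℝ} {e Γ : ℝ → ℝ} (hη : 0 < η) (hη1 : η ≤ 1)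
    (hηκ : η ≤ κ / 2) (he : Continuous e) (hΓ : Continuous Γ) (he0 : e 0 = 0) (hΓ0 : Γ 0 = 0)
    (heB : ∀ s t, 0 ≤ t → t ≤ s → s ≤ ρ → |e s - e t| ≤ B * s * (s - t))
    (hΓl : ∀ s t, 0 ≤ t → t ≤ s → s ≤ ρ → |Γ s - Γ t| ≤ 2 * (s - t))
    (hB : 0 ≤ B) (hσ0 : 0 ≤ σ) (hσ : 2 ^ (κ / η) * σ ≤ ρ)
    (hsmall : (B * σ + 2 * |ν|) * (2 ^ (κ / η) + 2 ^ (2 / η)) ≤ η ^ 2 / 8)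
    (hs₁ : 0 < s₁) (hs₁σ : 4 / 3 * s₁ ≤ σ) :
    ∃ S P : ℝ → ℝ, Continuous S ∧ S 0 = 0 ∧ S 1 = s₁ ∧ ∀ ξ ∈ Ioo (0 : ℝ) 2,
      0 < S ξ ∧ S ξ ≤ ρ ∧ S ξ ≤ 4 / 3 * s₁ * ξ ^ (κ / η) ∧ 0 < P ξ ∧ P ξ ≤ 2 * κ * S ξ ∧
      HasDerivAt S (P ξ / (η * ξ)) ξ ∧
      HasDerivAt P ((κ ^ 2 * S ξ + e (S ξ) + ν * ξ ^ (2 / η) * Γ (S ξ)) / (η * ξ)) ξ := by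
  have hκ : 0 < κ := by linarith
  set q := κ / η with hq
  set m := 2 / η with hm
  have hq2 : 2 ≤ q := by rw [hq, le_div_iff₀ hη]; linarith
  have hm2 : 2 ≤ m := by rw [hm, le_div_iff₀ hη]; linarith
  have hqη : η * q = κ := by rw [hq]; field_simp
  -- Clamping to `[0, t]` makes the nonlinearity globally defined and Lipschitz. The solution found
  -- has `y` in `[0, σ]`, where the clamp is inactive.
  let cl : ℝ → ℝ → ℝ := fun t x => max 0 (min x t)
  have hclc : ∀ t, Continuous (cl t) := fun t => by fun_prop
  have hclm : ∀ t, 0 ≤ t → ∀ x, cl t x ∈ Icc 0 t := fun t ht x =>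
    ⟨le_max_left _ _, max_le ht (min_le_right _ _)⟩
  have hcle : ∀ t, ∀ x ∈ Icc 0 t, cl t x = x := fun t x hx => by
    simp [cl, min_eq_left hx.2, max_eq_right hx.1]
  have hcll : ∀ t x x', |cl t x - cl t x'| ≤ |x - x'| := fun t x x' => by
    have h1 := abs_max_sub_max_le_abs (min x t) (min x' t) 0
    have h2 := abs_min_sub_min_le_max x t x' t
    simp only [sub_self, abs_zero, abs_nonneg, sup_of_le_left] at h2
    rw [max_comm, max_comm _ (0 : ℝ)] at h1
    exact h1.trans h2
  let N : ℝ → ℝ → ℝ := fun ξ y => blowupForce e Γ q m ν (cl 2 ξ) (cl σ y)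
  have hN : Continuous (Function.uncurry N) := by
    rw [← continuousOn_univ]
    refine (continuousOn_blowupForce (ν := ν) he hΓ he0 hΓ0 heB hΓl hB hq2 hm2 hσ0 hσ).comp
      (f := fun z : ℝ × ℝ => (cl 2 z.1, cl σ z.2)) (by fun_prop) fun z _ =>
        ⟨hclm 2 two_pos.le _, hclm σ hσ0 _⟩
  have hε : ∀ ξ y y', |N ξ y - N ξ y'| ≤ η ^ 2 / 4 * |y - y'| := by
    intro ξ y y'
    have h1 := abs_blowupForce_sub_le (ν := ν) heB hΓl hB hq2 hm2 hσ (hclm 2 two_pos.le ξ)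
      (hclm σ hσ0 y') (hclm σ hσ0 y)
    have h2 := hclm 2 two_pos.le ξ
    refine h1.trans (mul_le_mul ?_ (hcll _ _ _) (abs_nonneg _) (by positivity))
    calc _ ≤ η ^ 2 / 8 * cl 2 ξ := mul_le_mul_of_nonneg_right hsmall h2.1
      _ ≤ η ^ 2 / 8 * 2 := by have := h2.2; gcongr
      _ = _ := by ring
  -- Set `P - κ S = ξ ^ (q+1) z / η`. Then `η ξ S' = P` becomes `y' = z / η²`, and the equation for
  -- `P` becomes `(ξ ^ (2q+1) z)' = ξ ^ (2q) N(ξ, y)`. Hence `K = 1 / η²`, `p = 2q`, and `K · η² / 4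
  -- = 1/4`.
  obtain ⟨y, z, hyc, hy1, hyz, hy', hz'⟩ := exists_singular_solution hN (K := 1 / η ^ 2)
    (p := 2 * q) hε (fun ξ => by
      simp only [N, hcle σ 0 ⟨le_rfl, hσ0⟩]; exact blowupForce_zero he0 hΓ0 _)
    (by positivity) (by positivity) (by field_simp; norm_num) (by linarith) hs₁.le
  refine ⟨fun ξ => ξ ^ q * y ξ, fun ξ => κ * (ξ ^ q * y ξ) + ξ ^ (-q) * (ξ ^ (2 * q + 1) * z ξ) / η,
    (Real.continuous_rpow_const (by linarith)).mul hyc,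
    by simp [Real.zero_rpow (show q ≠ 0 by linarith)], by simp [hy1], ?_⟩
  intro ξ hξ
  have hξ0 := hξ.1
  obtain ⟨hyb, hzb⟩ := hyz ξ ⟨hξ.1.le, hξ.2.le⟩
  rw [abs_le] at hyb hzb
  have hyl : 2 / 3 * s₁ ≤ y ξ := by linarith
  have hyu : y ξ ≤ 4 / 3 * s₁ := by linarith
  have hξq : 0 < ξ ^ q := Real.rpow_pos_of_pos hξ0 q
  have hyp : 0 < y ξ := by linarith
  have hξq2 : ξ ^ q ≤ 2 ^ q := Real.rpow_le_rpow hξ0.le hξ.2.le (by linarith)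
  have e1 : ξ ^ (-q) * ξ ^ (2 * q + 1) = ξ ^ q * ξ := by
    nth_rewrite 4 [← Real.rpow_one ξ]
    rw [← Real.rpow_add hξ0, ← Real.rpow_add hξ0]
    ring_nf
  have hPform : κ * (ξ ^ q * y ξ) + ξ ^ (-q) * (ξ ^ (2 * q + 1) * z ξ) / η
      = ξ ^ q * (κ * y ξ + ξ * z ξ / η) := by
    rw [← mul_assoc (ξ ^ (-q)), e1]; ring
  -- As `η ≤ κ / 2`, this correction is at most half of `κ y ≥ 2 κ s₁ / 3`; this gives both `P > 0`
  -- and `P ≤ 2 κ S`.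
  have hzη : |ξ * z ξ / η| ≤ κ * s₁ / 3 := by
    rw [abs_div, abs_mul, abs_of_pos hξ0, abs_of_pos hη, div_le_iff₀ hη]
    calc ξ * |z ξ| ≤ 2 * (η ^ 2 / 4 * (4 / 3 * s₁)) := by
          have := hξ.2.le
          gcongr
          exact abs_le.2 hzb
      _ = (2 * η) * s₁ / 3 * η := by ring
      _ ≤ κ * s₁ / 3 * η := by gcongr; linarith
  rw [abs_le] at hzη
  have hκy : κ * (2 / 3 * s₁) ≤ κ * y ξ := by gcongr
  have hκs : 0 < κ * s₁ := by positivity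
  refine ⟨by positivity, ?_, ?_, ?_, ?_, ?_, ?_⟩
  · refine le_trans (show ξ ^ q * y ξ ≤ 2 ^ q * σ from ?_) hσ
    have : y ξ ≤ σ := by linarith
    gcongr
  · calc ξ ^ q * y ξ ≤ ξ ^ q * (4 / 3 * s₁) := by gcongr
      _ = _ := by ring
  · simp only [hPform]
    refine mul_pos hξq ?_
    linarith
  · simp only [hPform]
    calc _ ≤ ξ ^ q * (2 * κ * y ξ) := by gcongr; linarith
      _ = _ := by ring
  · have h := (Real.hasDerivAt_rpow_const (p := q) (Or.inl hξ0.ne')).mul (hy' ξ)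
    refine h.congr_deriv ?_
    simp only [hPform]
    rw [Real.rpow_sub_one hξ0.ne', ← hqη]
    field_simp
  · have h1 := (Real.hasDerivAt_rpow_const (p := q) (Or.inl hξ0.ne')).mul (hy' ξ)
    have h2 := (Real.hasDerivAt_rpow_const (p := -q) (Or.inl hξ0.ne')).mul (hz' ξ hξ)
    refine ((h1.const_mul κ).add (h2.div_const η)).congr_deriv ?_
    have hNf : N ξ (y ξ) = ξ ^ (-(1 + q)) * (e (ξ ^ q * y ξ)
        + ν * ξ ^ m * Γ (ξ ^ q * y ξ)) := by
      simp only [N, hcle 2 ξ ⟨hξ.1.le, hξ.2.le⟩, hcle σ (y ξ) ⟨hyp.le, by linarith⟩, blowupForce]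
    rw [hNf, Real.rpow_sub_one hξ0.ne', Real.rpow_sub_one hξ0.ne', neg_add,
      Real.rpow_add hξ0 (-1), Real.rpow_neg_one, Real.rpow_add hξ0 (2 * q), two_mul,
      Real.rpow_add hξ0, Real.rpow_one,
      Real.rpow_neg hξ0.le]
    beta_reduce
    generalize ξ ^ q = X at *
    rw [← hqη]
    field_simp
    ring

end Blowup

/-! ### Return to the variable `a`: the unstable manifold -/

section Unstable

/-- For a saddle at the origin, perturbed by `μ a² Γ`, every small `s₁ > 0` is the value at `a₁`
of a solution which tends to the origin as `a → 0`, at the rate of the linearized equation. -/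
theorem exists_unstable_solution {κ B ρ : ℝ} {f Γ : ℝ → ℝ} (μ : ℝ) (hκ : 0 < κ) (hρ : 0 < ρ)
    (hB : 0 ≤ B) (hf : ContinuousOn f (Icc 0 ρ)) (hΓ : Continuous Γ) (hf0 : f 0 = 0)
    (hΓ0 : Γ 0 = 0)
    (hfB : ∀ s t, 0 ≤ t → t ≤ s → s ≤ ρ → |f s - f t - κ ^ 2 * (s - t)| ≤ B * s * (s - t))
    (hΓl : ∀ s t, 0 ≤ t → t ≤ s → s ≤ ρ → |Γ s - Γ t| ≤ 2 * (s - t)) :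
    ∃ a₁ δ : ℝ, 0 < a₁ ∧ 0 < δ ∧ δ ≤ ρ ∧ B * δ + 2 * (|μ| * a₁ ^ 2) ≤ κ ^ 2 / 2 ∧
      ∀ s₁ ∈ Ioo 0 δ, ∃ A C : ℝ, a₁ < A ∧ ∃ s P : ℝ → ℝ, Continuous s ∧ s 0 = 0 ∧ s a₁ = s₁ ∧
        ∀ a ∈ Ioo 0 A, 0 < s a ∧ s a ≤ ρ ∧ s a ≤ C * a ^ κ ∧ 0 < P a ∧ P a ≤ 2 * κ * s a ∧
          HasDerivAt s (P a / a) a ∧ HasDerivAt P ((f (s a) + μ * a ^ 2 * Γ (s a)) / a) a := by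
  -- This makes both exponents `κ / η` and `2 / η` at least `2`.
  set η := min κ 2 / 2 with hη
  have hη0 : 0 < η := by positivity
  have hη1 : η ≤ 1 := by linarith [min_le_right κ 2]
  have hηκ : η ≤ κ / 2 := by linarith [min_le_left κ 2]
  set D : ℝ := 2 ^ (κ / η) + 2 ^ (2 / η) with hD
  have h2q : (1 : ℝ) ≤ 2 ^ (κ / η) := Real.one_le_rpow one_le_two (by positivity)
  have h2m : (1 : ℝ) ≤ 2 ^ (2 / η) := Real.one_le_rpow one_le_two (by positivity)
  have hD1 : 1 ≤ D := by linarith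
  -- The smallness budget `η² / 8` is shared equally: `σ` makes the quadratic term cost at most `η²
  -- / 16`, and `a₁` below does the same for the `μ` term. The summands `1` in `B + 1` and `|μ| + 1`
  -- avoid division by zero.
  set σ := min (ρ / 2 ^ (κ / η)) (η ^ 2 / (16 * D * (B + 1))) with hσ
  have hσ0 : 0 < σ := by positivity
  have hσρ : 2 ^ (κ / η) * σ ≤ ρ := by
    have := min_le_left (ρ / 2 ^ (κ / η)) (η ^ 2 / (16 * D * (B + 1)))
    rw [← hσ, le_div_iff₀ (by positivity)] at this
    linarith
  have hσB : B * σ * D ≤ η ^ 2 / 16 := by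
    have := min_le_right (ρ / 2 ^ (κ / η)) (η ^ 2 / (16 * D * (B + 1)))
    rw [← hσ, le_div_iff₀ (by positivity)] at this
    have : 0 ≤ σ * D := by positivity
    nlinarith
  set a₁ := √(η ^ 2 / (32 * D * (|μ| + 1))) with ha₁
  have ha₁0 : 0 < a₁ := by positivity
  have ha₁sq : a₁ ^ 2 = η ^ 2 / (32 * D * (|μ| + 1)) := Real.sq_sqrt (by positivity)
  have haμ : 2 * (|μ| * a₁ ^ 2) * D ≤ η ^ 2 / 16 := by
    have h1 : a₁ ^ 2 * (32 * D * (|μ| + 1)) = η ^ 2 := by rw [ha₁sq]; field_simp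
    have : 0 ≤ a₁ ^ 2 * D := by positivity
    nlinarith
  have hsum : (B * σ + 2 * |μ * a₁ ^ 2|) * D ≤ η ^ 2 / 8 := by
    rw [abs_mul, abs_of_nonneg (sq_nonneg a₁)]
    linarith
  have hσρ' : σ ≤ ρ := le_trans (by nlinarith) hσρ
  refine ⟨a₁, σ / 2, ha₁0, by positivity, by linarith, ?_, ?_⟩
  -- Follows from `hsum` with `D ≥ 1` and `η ≤ κ / 2`. This bound will make the radial force
  -- increasing, as uniqueness requires.
  · have h1 : 0 ≤ B * σ := by positivity
    have h2 : 0 ≤ 2 * (|μ| * a₁ ^ 2) := by positivity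
    nlinarith
  intro s₁ hs₁
  -- The nonlinear part of `f`, extended by constants outside `[0, ρ]` to be continuous everywhere;
  -- the solution never leaves `[0, ρ]`.
  let e : ℝ → ℝ := IccExtend hρ.le (domRestrict (Icc 0 ρ) fun s => f s - κ ^ 2 * s)
  have he : ∀ s ∈ Icc 0 ρ, e s = f s - κ ^ 2 * s := fun s hs => IccExtend_of_mem _ _ hs
  have hec : Continuous e := (continuousOn_iff_continuous_domRestrict.1
    (hf.sub (by fun_prop : Continuous fun s : ℝ => κ ^ 2 * s).continuousOn)).Icc_extend'
  have heB : ∀ s t, 0 ≤ t → t ≤ s → s ≤ ρ → |e s - e t| ≤ B * s * (s - t) := by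
    intro s t ht hts hs
    rw [he s ⟨ht.trans hts, hs⟩, he t ⟨ht, hts.trans hs⟩]
    convert hfB s t ht hts hs using 2
    ring
  obtain ⟨S, Q, hS, hS0, hS1, h⟩ := exists_blowup_solution (ν := μ * a₁ ^ 2) hη0 hη1 hηκ hec hΓ
    (by rw [he 0 ⟨le_rfl, hρ.le⟩, hf0]; ring) hΓ0 heB hΓl hB hσ0.le hσρ hsum hs₁.1
    (by linarith [hs₁.2])
  have hξd : ∀ a, 0 < a → HasDerivAt (fun a => (a / a₁) ^ η) (η * (a / a₁) ^ η / a) a := by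
    intro a ha
    have h1 := ((hasDerivAt_id a).div_const a₁).rpow_const (p := η) (Or.inl (by
      simp only [id]; positivity))
    refine h1.congr_deriv ?_
    simp only [id]
    rw [Real.rpow_sub_one (by positivity)]
    field_simp
  -- The end of the domain corresponds to `ξ = 2`, and `a₁` to `ξ = 1`.
  refine ⟨a₁ * 2 ^ (1 / η), 4 / 3 * s₁ / a₁ ^ κ, ?_, fun a => S ((a / a₁) ^ η),
    fun a => Q ((a / a₁) ^ η), ?_, ?_, ?_, ?_⟩
  · have : (1 : ℝ) < 2 ^ (1 / η) := Real.one_lt_rpow one_lt_two (by positivity)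
    nlinarith
  · exact hS.comp ((Real.continuous_rpow_const hη0.le).comp (by fun_prop))
  · simp [Real.zero_rpow hη0.ne', hS0]
  · simp [div_self ha₁0.ne', hS1]
  intro a ha
  have ha0 := ha.1
  have hx0 : 0 < (a / a₁) ^ η := by positivity
  have hx2 : (a / a₁) ^ η < 2 := by
    have h1 : a / a₁ < 2 ^ (1 / η) := by rw [div_lt_iff₀ ha₁0]; linarith [ha.2]
    have h2 := Real.rpow_lt_rpow (by positivity) h1 hη0
    rwa [← Real.rpow_mul two_pos.le, one_div_mul_cancel hη0.ne', Real.rpow_one] at h2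
  obtain ⟨h1, h2, h3, h4, h5, h6, h7⟩ := h _ ⟨hx0, hx2⟩
  refine ⟨h1, h2, ?_, h4, h5, ?_, ?_⟩
  · have e1 : ((a / a₁) ^ η) ^ (κ / η) = a ^ κ / a₁ ^ κ := by
      rw [← Real.rpow_mul (by positivity), mul_div_cancel₀ _ hη0.ne',
        Real.div_rpow ha0.le ha₁0.le]
    rw [e1] at h3
    calc _ ≤ _ := h3
      _ = _ := by ring
  · refine (h6.comp a (hξd a ha0)).congr_deriv ?_
    field_simp
  · refine (h7.comp a (hξd a ha0)).congr_deriv ?_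
    have e2 : a₁ ^ 2 * ((a / a₁) ^ η) ^ (2 / η) = a ^ 2 := by
      rw [← Real.rpow_mul (by positivity), mul_div_cancel₀ _ hη0.ne', Real.rpow_two]
      field_simp
    rw [he _ ⟨h1.le, h2⟩, mul_assoc μ, e2]
    field_simp
    ring

end Unstable

section PolarForm

/-! ### The profile equation in polar form -/

theorem norm_sq_plane (x : Plane) : ‖x‖ ^ 2 = x 0 ^ 2 + x 1 ^ 2 := by
  rw [EuclideanSpace.norm_sq_eq, Fin.sum_univ_two, Real.norm_eq_abs, Real.norm_eq_abs, sq_abs,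
    sq_abs]

/-- The coefficient of the deviation of the metric from the Euclidean one. -/
def metricCoeff (Γ : ℝ → ℝ) (s : ℝ) : ℝ := ((Γ s / s) ^ 2 - 1) / s ^ 2

/-- The derivative of `metricCoeff`, divided by the radius. -/
def metricCoeffDeriv (Γ : ℝ → ℝ) (s : ℝ) : ℝ :=
  (2 * Γ s * deriv Γ s - 2 * s) / s ^ 5 - 4 * (Γ s ^ 2 - s ^ 2) / s ^ 6

/-- The components of `perp` as continuous linear forms. -/
def perpForm (i : Fin 2) : Plane →L[ℝ] ℝ :=
  if i = 0 then -EuclideanSpace.proj 1 else EuclideanSpace.proj 0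

theorem perpForm_apply (i : Fin 2) (x : Plane) : perpForm i x = perp x i := by
  fin_cases i <;> simp [perpForm, perp]

variable {Γ : ℝ → ℝ}

theorem hasDerivAt_metricCoeff {s : ℝ} (hs : 0 < s) (h : HasDerivAt Γ (deriv Γ s) s) :
    HasDerivAt (metricCoeff Γ) (metricCoeffDeriv Γ s * s) s := by
  have h1 := (((h.div (hasDerivAt_id s) hs.ne').pow 2).sub_const 1).div
    (hasDerivAt_pow 2 s) (by positivity)
  refine h1.congr_deriv ?_
  simp only [metricCoeffDeriv, Pi.div_apply, Pi.pow_apply, id]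
  push_cast
  field_simp
  ring

theorem hasFDerivAt_comp_norm {f : ℝ → ℝ} {f' : ℝ} {x : Plane} (hx : x ≠ 0)
    (hf : HasDerivAt f f' ‖x‖) :
    HasFDerivAt (fun y : Plane => f ‖y‖) ((f' / ‖x‖) • innerSL ℝ x) x := by
  have h0 : ‖x‖ ≠ 0 := norm_ne_zero_iff.2 hx
  have h1 : HasFDerivAt (fun y : Plane => √(‖y‖ ^ 2))
      ((1 / (2 * √(‖x‖ ^ 2))) • (2 • innerSL ℝ x)) x :=
    (hasStrictFDerivAt_norm_sq x).hasFDerivAt.sqrt (pow_ne_zero 2 h0)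
  simp only [Real.sqrt_sq (norm_nonneg _)] at h1
  refine (hf.comp_hasFDerivAt x h1).congr_fderiv ?_
  ext v
  simp
  field_simp

theorem partialDeriv_comp_norm {f : ℝ → ℝ} {f' : ℝ} {x : Plane} (hx : x ≠ 0)
    (hf : HasDerivAt f f' ‖x‖) (l : Fin 2) :
    partialDeriv (fun y => f ‖y‖) l x = f' / ‖x‖ * x l := by
  rw [partialDeriv, (hasFDerivAt_comp_norm hx hf).fderiv]
  simp [EuclideanSpace.inner_single_right]

theorem metric_eq (x : Plane) (i j : Fin 2) :
    metric Γ x i j = (if i = j then 1 else 0) + metricCoeff Γ ‖x‖ * perp x i * perp x j := rfl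

theorem partialDeriv_metric {x : Plane} (hx : x ≠ 0)
    (h : HasDerivAt Γ (deriv Γ ‖x‖) ‖x‖) (i j l : Fin 2) :
    partialDeriv (fun y => metric Γ y i j) l x =
      metricCoeffDeriv Γ ‖x‖ * x l * perp x i * perp x j
      + metricCoeff Γ ‖x‖ * (perpForm i (EuclideanSpace.single l 1) * perp x j
        + perp x i * perpForm j (EuclideanSpace.single l 1)) := by
  have h0 : 0 < ‖x‖ := norm_pos_iff.2 hx
  have h1 := hasFDerivAt_comp_norm hx (hasDerivAt_metricCoeff h0 h)
  have h2 := ((h1.mul (perpForm i).hasFDerivAt).mul (perpForm j).hasFDerivAt).const_add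
    (if i = j then (1 : ℝ) else 0)
  have h3 : (fun y => metric Γ y i j) = fun y => (if i = j then (1 : ℝ) else 0) +
      metricCoeff Γ ‖y‖ * perpForm i y * perpForm j y := by
    funext y
    rw [metric_eq, perpForm_apply, perpForm_apply]
  have h4 : HasFDerivAt (fun y => metric Γ y i j) _ x := h3 ▸ h2
  rw [partialDeriv, h4.fderiv]
  simp only [add_apply, smul_apply, innerSL_apply_apply,
    smul_eq_mul, EuclideanSpace.inner_single_right, Pi.mul_apply, perpForm_apply]
  simp
  field_simp
  ring

/-- The metric has eigenvectors `x` and `x^⊥`, with eigenvalues `1` and `(Γ(s) / s)²`. Pairing with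
them removes the inverse metric from the Christoffel symbols and gradients, so it is never computed.
-/
theorem vecMul_metric_self (x : Plane) : (fun i => x i) ᵥ* metric Γ x = fun i => x i := by
  funext j
  fin_cases j <;> simp [Matrix.vecMul, dotProduct, metric_eq, perp] <;> ring

theorem vecMul_metric_perp {x : Plane} (hx : x ≠ 0) :
    (fun i => perp x i) ᵥ* metric Γ x = (Γ ‖x‖ / ‖x‖) ^ 2 • fun i => perp x i := by
  have h0 : ‖x‖ ≠ 0 := norm_ne_zero_iff.2 hx
  have h1 : (Γ ‖x‖ / ‖x‖) ^ 2 = 1 + metricCoeff Γ ‖x‖ * (x 0 ^ 2 + x 1 ^ 2) := by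
    rw [← norm_sq_plane, metricCoeff]
    field_simp
    ring
  rw [h1]
  funext j
  fin_cases j <;> simp [Matrix.vecMul, dotProduct, metric_eq, perp] <;> ring

theorem det_metric {x : Plane} (hx : x ≠ 0) : (metric Γ x).det = (Γ ‖x‖ / ‖x‖) ^ 2 := by
  have h0 : ‖x‖ ≠ 0 := norm_ne_zero_iff.2 hx
  have h1 : (Γ ‖x‖ / ‖x‖) ^ 2 = 1 + metricCoeff Γ ‖x‖ * (x 0 ^ 2 + x 1 ^ 2) := by
    rw [← norm_sq_plane, metricCoeff]
    field_simp
    ring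
  rw [h1, Matrix.det_fin_two]
  simp [metric_eq, perp]
  ring

theorem isUnit_det_metric {x : Plane} (hx : x ≠ 0) (hΓ : Γ ‖x‖ ≠ 0) :
    IsUnit (metric Γ x).det := by
  have h0 : ‖x‖ ≠ 0 := norm_ne_zero_iff.2 hx
  rw [det_metric hx, isUnit_iff_ne_zero]
  positivity

theorem sum_mul_inv_metric {x : Plane} (hx : x ≠ 0) (hΓ : Γ ‖x‖ ≠ 0) (T : Fin 2 → ℝ) :
    ∑ i, x i * ∑ m, (metric Γ x)⁻¹ i m * T m = x 0 * T 0 + x 1 * T 1 := by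
  have h : (fun i => x i) ᵥ* (metric Γ x)⁻¹ = fun i => x i := by
    conv_lhs => rw [← vecMul_metric_self (Γ := Γ) x]
    rw [Matrix.vecMul_vecMul, Matrix.mul_nonsing_inv _ (isUnit_det_metric hx hΓ),
      Matrix.vecMul_one]
  have h' : (fun i => x i) ⬝ᵥ ((metric Γ x)⁻¹ *ᵥ T) = (fun i => x i) ⬝ᵥ T := by
    rw [Matrix.dotProduct_mulVec, h]
  simpa [dotProduct, Matrix.mulVec, Fin.sum_univ_two] using h'

theorem sum_perp_mul_inv_metric {x : Plane} (hx : x ≠ 0) (hΓ : Γ ‖x‖ ≠ 0) (T : Fin 2 → ℝ) :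
    (Γ ‖x‖ / ‖x‖) ^ 2 * ∑ i, perp x i * ∑ m, (metric Γ x)⁻¹ i m * T m =
      -x 1 * T 0 + x 0 * T 1 := by
  have h : ((Γ ‖x‖ / ‖x‖) ^ 2 • fun i => perp x i) ᵥ* (metric Γ x)⁻¹ = fun i => perp x i := by
    rw [← vecMul_metric_perp (Γ := Γ) hx]
    rw [Matrix.vecMul_vecMul, Matrix.mul_nonsing_inv _ (isUnit_det_metric hx hΓ),
      Matrix.vecMul_one]
  have h' : ((Γ ‖x‖ / ‖x‖) ^ 2 • fun i => perp x i) ⬝ᵥ ((metric Γ x)⁻¹ *ᵥ T)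
      = (fun i => perp x i) ⬝ᵥ T := by
    rw [Matrix.dotProduct_mulVec, h]
  rw [smul_dotProduct] at h'
  simpa [dotProduct, Matrix.mulVec, Fin.sum_univ_two, perp] using h'

/-- The left-hand side of the profile equation at a point `x` with velocity `v` and second
derivative `w`. -/
def profileField (Γ : ℝ → ℝ) (k b c μ a : ℝ) (x v w : Plane) : Plane :=
  (WithLp.toLp 2 fun i => w i + ∑ j, ∑ l, christoffel Γ x i j l * v j * v l)
    + (1 / a) • v + (1 / a ^ 2) • grad Γ (fun x => potG Γ k b ‖x‖) x
    - μ • grad Γ (fun x => potF Γ ‖x‖) x + (c / a) • complexStructure Γ x v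

/-- In polar terms `x × v = s² β_a` and `x · w = s s_aa - s² β_a²`; the Christoffel contribution
replaces the Euclidean centrifugal term `s² β_a²` by `s Γ Γ' β_a²`. -/
theorem radial_profileField (hΓ : ContDiff ℝ ∞ Γ) (k b c μ a : ℝ) {x : Plane} (hx : x ≠ 0)
    (hpos : 0 < Γ ‖x‖) (v w : Plane) :
    ∑ i, x i * profileField Γ k b c μ a x v w i =
      (x 0 * w 0 + x 1 * w 1)
      + (1 / ‖x‖ ^ 2 - Γ ‖x‖ * deriv Γ ‖x‖ / ‖x‖ ^ 3) * (x 0 * v 1 - x 1 * v 0) ^ 2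
      + 1 / a * (x 0 * v 0 + x 1 * v 1) + 1 / a ^ 2 * (potGDeriv Γ k b ‖x‖ * ‖x‖)
      - μ * (Γ ‖x‖ * ‖x‖) - c / a * (Γ ‖x‖ / ‖x‖ * (x 0 * v 1 - x 1 * v 0)) := by
  have h0 : 0 < ‖x‖ := norm_pos_iff.2 hx
  have hn := norm_sq_plane x
  have hC : ∀ j l, ∑ i, x i * christoffel Γ x i j l = 1 / 2 * (x 0 *
      (partialDeriv (fun y => metric Γ y l 0) j x + partialDeriv (fun y => metric Γ y j 0) l x
        - partialDeriv (fun y => metric Γ y j l) 0 x) + x 1 *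
      (partialDeriv (fun y => metric Γ y l 1) j x + partialDeriv (fun y => metric Γ y j 1) l x
        - partialDeriv (fun y => metric Γ y j l) 1 x)) := by
    intro j l
    rw [← sum_mul_inv_metric hx hpos.ne' fun m => partialDeriv (fun y => metric Γ y l m) j x
      + partialDeriv (fun y => metric Γ y j m) l x - partialDeriv (fun y => metric Γ y j l) m x]
    simp only [christoffel, Fin.sum_univ_two]
    ring
  have hC' : ∑ i, x i * (∑ j, ∑ l, christoffel Γ x i j l * v j * v l)
      = (1 / ‖x‖ ^ 2 - Γ ‖x‖ * deriv Γ ‖x‖ / ‖x‖ ^ 3) * (x 0 * v 1 - x 1 * v 0) ^ 2 := by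
    have e1 : ∑ i, x i * (∑ j, ∑ l, christoffel Γ x i j l * v j * v l)
        = ∑ j, ∑ l, (∑ i, x i * christoffel Γ x i j l) * v j * v l := by
      simp only [Fin.sum_univ_two]; ring
    have e2 : 1 / ‖x‖ ^ 2 - Γ ‖x‖ * deriv Γ ‖x‖ / ‖x‖ ^ 3
        = -(2 * metricCoeff Γ ‖x‖ + 1 / 2 * metricCoeffDeriv Γ ‖x‖ * (x 0 ^ 2 + x 1 ^ 2)) := by
      rw [← hn, metricCoeff, metricCoeffDeriv]
      field_simp
      ring
    rw [e1, e2]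
    simp only [hC, partialDeriv_metric hx (hasDerivAt_self hΓ _), Fin.sum_univ_two,
      perpForm_apply]
    simp [perp]
    ring
  have hG : ∑ i, x i * grad Γ (fun x => potG Γ k b ‖x‖) x i = potGDeriv Γ k b ‖x‖ * ‖x‖ := by
    have := sum_mul_inv_metric hx hpos.ne' fun m => partialDeriv (fun x => potG Γ k b ‖x‖) m x
    simp only [partialDeriv_comp_norm hx (hasDerivAt_potG hΓ k b _)] at this
    simp only [grad, partialDeriv_comp_norm hx (hasDerivAt_potG hΓ k b _), this]
    calc _ = potGDeriv Γ k b ‖x‖ / ‖x‖ * (x 0 ^ 2 + x 1 ^ 2) := by ring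
      _ = _ := by rw [← hn]; field_simp
  have hF : ∑ i, x i * grad Γ (fun x => potF Γ ‖x‖) x i = Γ ‖x‖ * ‖x‖ := by
    have := sum_mul_inv_metric hx hpos.ne' fun m => partialDeriv (fun x => potF Γ ‖x‖) m x
    simp only [partialDeriv_comp_norm hx (hasDerivAt_potF hΓ.continuous _)] at this
    simp only [grad, partialDeriv_comp_norm hx (hasDerivAt_potF hΓ.continuous _), this]
    calc _ = Γ ‖x‖ / ‖x‖ * (x 0 ^ 2 + x 1 ^ 2) := by ring
      _ = _ := by rw [← hn]; field_simp
  have hJ : ∑ i, x i * complexStructure Γ x v i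
      = -(Γ ‖x‖ / ‖x‖ * (x 0 * v 1 - x 1 * v 0)) := by
    have h1 := congrFun (vecMul_metric_perp (Γ := Γ) hx) 0
    have h2 := congrFun (vecMul_metric_perp (Γ := Γ) hx) 1
    simp only [Matrix.vecMul, dotProduct, Fin.sum_univ_two, perp, Pi.smul_apply, smul_eq_mul,
      PiLp.toLp_apply, Matrix.cons_val_zero, Matrix.cons_val_one] at h1 h2
    rw [complexStructure, det_metric hx, Real.sqrt_sq (by positivity)]
    simp only [Fin.sum_univ_two, PiLp.smul_apply, smul_eq_mul,
      Matrix.cons_val_zero, Matrix.cons_val_one]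
    have : x 0 * ((Γ ‖x‖ / ‖x‖)⁻¹ * -(metric Γ x 1 0 * v 0 + metric Γ x 1 1 * v 1))
        + x 1 * ((Γ ‖x‖ / ‖x‖)⁻¹ * (metric Γ x 0 0 * v 0 + metric Γ x 0 1 * v 1))
        = -(Γ ‖x‖ / ‖x‖)⁻¹ * ((-x 1 * metric Γ x 0 0 + x 0 * metric Γ x 1 0) * v 0
          + (-x 1 * metric Γ x 0 1 + x 0 * metric Γ x 1 1) * v 1) := by ring
    rw [this, h1, h2]
    field_simp
    ring
  simp only [Fin.sum_univ_two] at hC' hG hF hJ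
  simp only [profileField, Fin.sum_univ_two, PiLp.add_apply, PiLp.sub_apply, PiLp.smul_apply,
    smul_eq_mul]
  linear_combination hC' + 1 / a ^ 2 * hG - μ * hF + c / a * hJ

/-- The factor `(Γ / s)²` is the eigenvalue of the metric at `x^⊥` and cancels its inverse. The
potentials drop out because their gradients are radial. -/
theorem angular_profileField (hΓ : ContDiff ℝ ∞ Γ) (k b c μ a : ℝ) {x : Plane} (hx : x ≠ 0)
    (hpos : 0 < Γ ‖x‖) (v w : Plane) :
    (Γ ‖x‖ / ‖x‖) ^ 2 * ∑ i, perp x i * profileField Γ k b c μ a x v w i =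
      (Γ ‖x‖ / ‖x‖) ^ 2 * (x 0 * w 1 - x 1 * w 0)
      + (2 * Γ ‖x‖ * deriv Γ ‖x‖ / ‖x‖ ^ 2 - 2 * Γ ‖x‖ ^ 2 / ‖x‖ ^ 3) / ‖x‖
        * (x 0 * v 0 + x 1 * v 1) * (x 0 * v 1 - x 1 * v 0)
      + 1 / a * ((Γ ‖x‖ / ‖x‖) ^ 2 * (x 0 * v 1 - x 1 * v 0))
      + c / a * (Γ ‖x‖ / ‖x‖ * (x 0 * v 0 + x 1 * v 1)) := by
  have h0 : 0 < ‖x‖ := norm_pos_iff.2 hx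
  have hn := norm_sq_plane x
  have hC : ∀ j l, (Γ ‖x‖ / ‖x‖) ^ 2 * ∑ i, perp x i * christoffel Γ x i j l = 1 / 2 * (-x 1 *
      (partialDeriv (fun y => metric Γ y l 0) j x + partialDeriv (fun y => metric Γ y j 0) l x
        - partialDeriv (fun y => metric Γ y j l) 0 x) + x 0 *
      (partialDeriv (fun y => metric Γ y l 1) j x + partialDeriv (fun y => metric Γ y j 1) l x
        - partialDeriv (fun y => metric Γ y j l) 1 x)) := by
    intro j l
    rw [← sum_perp_mul_inv_metric hx hpos.ne' fun m => partialDeriv (fun y => metric Γ y l m) j x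
      + partialDeriv (fun y => metric Γ y j m) l x - partialDeriv (fun y => metric Γ y j l) m x]
    simp only [christoffel, Fin.sum_univ_two]
    ring
  have hC' : (Γ ‖x‖ / ‖x‖) ^ 2 * ∑ i, perp x i * (∑ j, ∑ l, christoffel Γ x i j l * v j * v l)
      = (2 * Γ ‖x‖ * deriv Γ ‖x‖ / ‖x‖ ^ 2 - 2 * Γ ‖x‖ ^ 2 / ‖x‖ ^ 3) / ‖x‖
        * (x 0 * v 0 + x 1 * v 1) * (x 0 * v 1 - x 1 * v 0) := by
    have e1 : (Γ ‖x‖ / ‖x‖) ^ 2 * ∑ i, perp x i * (∑ j, ∑ l, christoffel Γ x i j l * v j * v l)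
        = ∑ j, ∑ l, ((Γ ‖x‖ / ‖x‖) ^ 2 * ∑ i, perp x i * christoffel Γ x i j l) * v j * v l := by
      simp only [Fin.sum_univ_two]; ring
    have e2 : (2 * Γ ‖x‖ * deriv Γ ‖x‖ / ‖x‖ ^ 2 - 2 * Γ ‖x‖ ^ 2 / ‖x‖ ^ 3) / ‖x‖
        = 2 * metricCoeff Γ ‖x‖ + metricCoeffDeriv Γ ‖x‖ * (x 0 ^ 2 + x 1 ^ 2) := by
      rw [← hn, metricCoeff, metricCoeffDeriv]
      field_simp
      ring
    rw [e1, e2]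
    simp only [hC]
    simp only [partialDeriv_metric hx (hasDerivAt_self hΓ _), Fin.sum_univ_two, perpForm_apply]
    simp [perp]
    ring
  have hG : (Γ ‖x‖ / ‖x‖) ^ 2 * ∑ i, perp x i * grad Γ (fun x => potG Γ k b ‖x‖) x i = 0 := by
    have := sum_perp_mul_inv_metric hx hpos.ne' fun m =>
      partialDeriv (fun x => potG Γ k b ‖x‖) m x
    simp only [partialDeriv_comp_norm hx (hasDerivAt_potG hΓ k b _)] at this
    simp only [grad, partialDeriv_comp_norm hx (hasDerivAt_potG hΓ k b _), this]
    ring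
  have hF : (Γ ‖x‖ / ‖x‖) ^ 2 * ∑ i, perp x i * grad Γ (fun x => potF Γ ‖x‖) x i = 0 := by
    have := sum_perp_mul_inv_metric hx hpos.ne' fun m => partialDeriv (fun x => potF Γ ‖x‖) m x
    simp only [partialDeriv_comp_norm hx (hasDerivAt_potF hΓ.continuous _)] at this
    simp only [grad, partialDeriv_comp_norm hx (hasDerivAt_potF hΓ.continuous _), this]
    ring
  have hJ : (Γ ‖x‖ / ‖x‖) ^ 2 * ∑ i, perp x i * complexStructure Γ x v i
      = Γ ‖x‖ / ‖x‖ * (x 0 * v 0 + x 1 * v 1) := by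
    have h1 := congrFun (vecMul_metric_self (Γ := Γ) x) 0
    have h2 := congrFun (vecMul_metric_self (Γ := Γ) x) 1
    simp only [Matrix.vecMul, dotProduct, Fin.sum_univ_two] at h1 h2
    rw [complexStructure, det_metric hx, Real.sqrt_sq (by positivity)]
    simp only [Fin.sum_univ_two, PiLp.smul_apply, smul_eq_mul, PiLp.toLp_apply, perp,
      Matrix.cons_val_zero, Matrix.cons_val_one]
    have : -x 1 * ((Γ ‖x‖ / ‖x‖)⁻¹ * -(metric Γ x 1 0 * v 0 + metric Γ x 1 1 * v 1))
        + x 0 * ((Γ ‖x‖ / ‖x‖)⁻¹ * (metric Γ x 0 0 * v 0 + metric Γ x 0 1 * v 1))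
        = (Γ ‖x‖ / ‖x‖)⁻¹ * ((x 0 * metric Γ x 0 0 + x 1 * metric Γ x 1 0) * v 0
          + (x 0 * metric Γ x 0 1 + x 1 * metric Γ x 1 1) * v 1) := by ring
    rw [this, h1, h2]
    field_simp
  simp only [Fin.sum_univ_two, perp, PiLp.toLp_apply, Matrix.cons_val_zero,
    Matrix.cons_val_one] at hC' hG hF hJ
  simp only [profileField, Fin.sum_univ_two, PiLp.add_apply, PiLp.sub_apply, PiLp.smul_apply,
    smul_eq_mul, perp, PiLp.toLp_apply, Matrix.cons_val_zero, Matrix.cons_val_one]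
  linear_combination hC' + 1 / a ^ 2 * hG - μ * hF + c / a * hJ

/-- Off the center, `x` and `x^⊥` form a basis, so the two scalar equations carry the whole vector
equation. -/
theorem profileField_eq_zero_iff (k b c μ a : ℝ) {x : Plane} (hx : x ≠ 0)
    (hpos : 0 < Γ ‖x‖) (v w : Plane) :
    profileField Γ k b c μ a x v w = 0 ↔ ∑ i, x i * profileField Γ k b c μ a x v w i = 0 ∧
      (Γ ‖x‖ / ‖x‖) ^ 2 * ∑ i, perp x i * profileField Γ k b c μ a x v w i = 0 := by
  generalize profileField Γ k b c μ a x v w = E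
  refine ⟨fun h => by simp [h], fun ⟨h1, h2⟩ => ?_⟩
  have h0 : 0 < ‖x‖ := norm_pos_iff.2 hx
  have hn := norm_sq_plane x
  have h3 := (mul_eq_zero.1 h2).resolve_left (by positivity)
  simp only [Fin.sum_univ_two, perp, PiLp.toLp_apply, Matrix.cons_val_zero,
    Matrix.cons_val_one] at h1 h3
  have e0 : ‖x‖ ^ 2 * E 0 = 0 := by rw [hn]; linear_combination x 0 * h1 - x 1 * h3
  have e1 : ‖x‖ ^ 2 * E 1 = 0 := by rw [hn]; linear_combination x 1 * h1 + x 0 * h3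
  have p2 : ‖x‖ ^ 2 ≠ 0 := by positivity
  ext i
  fin_cases i
  · simpa using (mul_eq_zero.1 e0).resolve_left p2
  · simpa using (mul_eq_zero.1 e1).resolve_left p2

end PolarForm

section ReducedUniqueness

/-! ### Uniqueness for the reduced equation -/

/-- Maximum principle: a function on `[0, T]` with `a (a w')' > 0` wherever `w > 0`, and with
nonpositive boundary values, is nonpositive. -/
theorem nonpos_of_convex_where_pos {w w₁ : ℝ → ℝ} {T : ℝ} (hw : ContinuousOn w (Icc 0 T))
    (h0 : w 0 ≤ 0) (hT : w T ≤ 0)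
    (h : ∀ a ∈ Ioo 0 T, 0 < w a → (∀ᶠ x in 𝓝 a, HasDerivAt w (w₁ x / x) x) ∧
      ∃ d, 0 < d ∧ HasDerivAt w₁ d a) :
    ∀ a ∈ Icc 0 T, w a ≤ 0 := by
  intro a ha
  by_contra! hpos
  obtain ⟨m, hm, hmax⟩ := isCompact_Icc.exists_isMaxOn ⟨a, ha⟩ hw
  have hwm : 0 < w m := hpos.trans_le (hmax ha)
  have hm0 : 0 < m := hm.1.lt_of_ne fun h => by rw [← h] at hwm; linarith
  have hmT : m < T := hm.2.lt_of_ne fun h => by rw [h] at hwm; linarith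
  obtain ⟨hd, d, hd0, hd1⟩ := h m ⟨hm0, hmT⟩ hwm
  have hloc : IsLocalMax w m := hmax.isLocalMax (Icc_mem_nhds hm0 hmT)
  have hz : w₁ m / m = 0 := hloc.hasDerivAt_eq_zero hd.self_of_nhds
  have hz1 : w₁ m = 0 := by simpa [hm0.ne'] using hz
  have hde : deriv w =ᶠ[𝓝 m] fun x => w₁ x / x := hd.mono fun x hx => hx.deriv
  have hdd : HasDerivAt (deriv w) (d / m) m := by
    refine ((hd1.div (hasDerivAt_id m) hm0.ne').congr_of_eventuallyEq hde).congr_deriv ?_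
    simp only [id, hz1]
    field_simp
    ring
  have hdm : 0 < d / m := by positivity
  -- The second derivative test makes the maximum also a local minimum. So `w` is constant near `m`,
  -- contradicting a positive second derivative.
  have hmin : IsLocalMin w m := isLocalMin_of_deriv_deriv_pos (by rwa [hdd.deriv])
    (hde.self_of_nhds.trans hz) hd.self_of_nhds.continuousAt
  have hconst : w =ᶠ[𝓝 m] fun _ => w m := by
    filter_upwards [hloc, hmin] with x h1 h2 using le_antisymm h1 h2
  have : deriv (deriv w) m = 0 := by
    have h1 : deriv w =ᶠ[𝓝 m] fun _ => 0 := hconst.deriv.trans (by simp)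
    rw [h1.deriv_eq]
    simp
  rw [hdd.deriv] at this
  linarith

/-- `(s, P)` solves `a s' = P`, `a P' = f(a, s)` on `(0, a₁)`, with `s` in `(0, δ)` and continuous
up to the boundary, and `s(0) = 0`. -/
structure IsReducedSolution (f : ℝ → ℝ → ℝ) (a₁ δ : ℝ) (s P : ℝ → ℝ) : Prop where
  continuousOn : ContinuousOn s (Icc 0 a₁)
  zero : s 0 = 0
  mem : ∀ a ∈ Ioo 0 a₁, s a ∈ Ioo 0 δ
  deriv_s : ∀ a ∈ Ioo 0 a₁, HasDerivAt s (P a / a) a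
  deriv_P : ∀ a ∈ Ioo 0 a₁, HasDerivAt P (f a (s a) / a) a

/-- Where `s > t`, monotonicity of the force gives `a (a (s - t)')' > 0`, so the maximum principle
applies to `s - t`. -/
theorem IsReducedSolution.le {f : ℝ → ℝ → ℝ} {a₁ δ : ℝ} {s P t Q : ℝ → ℝ}
    (hs : IsReducedSolution f a₁ δ s P) (ht : IsReducedSolution f a₁ δ t Q)
    (hf : ∀ a ∈ Ioo 0 a₁, ∀ x y, 0 ≤ y → y < x → x < δ → f a y < f a x) (h : s a₁ = t a₁) :
    ∀ a ∈ Icc 0 a₁, s a ≤ t a := by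
  intro a ha
  refine sub_nonpos.1 (nonpos_of_convex_where_pos (w := fun a => s a - t a)
    (w₁ := fun a => P a - Q a) (hs.continuousOn.sub ht.continuousOn) (by simp [hs.zero, ht.zero])
    (by simp [h]) (fun x hx hpos => ⟨?_, (f x (s x) - f x (t x)) / x, ?_, ?_⟩) a ha)
  · filter_upwards [isOpen_Ioo.mem_nhds hx] with y hy
    exact ((hs.deriv_s y hy).sub (ht.deriv_s y hy)).congr_deriv (sub_div _ _ _).symm
  · have := hf x hx (s x) (t x) (ht.mem x hx).1.le (sub_pos.1 hpos) (hs.mem x hx).2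
    exact div_pos (sub_pos.2 this) hx.1
  · exact ((hs.deriv_P x hx).sub (ht.deriv_P x hx)).congr_deriv (sub_div _ _ _).symm

theorem IsReducedSolution.eqOn {f : ℝ → ℝ → ℝ} {a₁ δ : ℝ} {s P t Q : ℝ → ℝ}
    (hs : IsReducedSolution f a₁ δ s P) (ht : IsReducedSolution f a₁ δ t Q)
    (hf : ∀ a ∈ Ioo 0 a₁, ∀ x y, 0 ≤ y → y < x → x < δ → f a y < f a x) (h : s a₁ = t a₁) :
    EqOn s t (Icc 0 a₁) ∧ EqOn P Q (Ioo 0 a₁) := by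
  have h1 : EqOn s t (Icc 0 a₁) := fun a ha =>
    le_antisymm (hs.le ht hf h a ha) (ht.le hs hf h.symm a ha)
  refine ⟨h1, fun a ha => ?_⟩
  have h2 : s =ᶠ[𝓝 a] t := by
    filter_upwards [isOpen_Ioo.mem_nhds ha] with x hx using h1 ⟨hx.1.le, hx.2.le⟩
  have h3 := (hs.deriv_s a ha).unique ((ht.deriv_s a ha).congr_of_eventuallyEq h2)
  have := ha.1
  field_simp at h3
  exact h3

/-- If `a P' ≥ 1` near `0`, then `P → -∞`. -/
theorem tendsto_atBot_of_one_le {P g : ℝ → ℝ} {T : ℝ} (hT : 0 < T)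
    (hP : ∀ a ∈ Ioo 0 T, HasDerivAt P (g a / a) a) (hg : ∀ a ∈ Ioo 0 T, 1 ≤ g a) :
    Tendsto P (𝓝[>] 0) atBot := by
  have hd : ∀ a ∈ Ioo 0 T, HasDerivAt (fun a => P a - Real.log a) (g a / a - a⁻¹) a :=
    fun a ha => (hP a ha).sub (Real.hasDerivAt_log ha.1.ne')
  -- Thus `P ≤ log a + const` near `0`.
  have hmono : MonotoneOn (fun a => P a - Real.log a) (Ioo 0 T) := by
    refine monotoneOn_of_deriv_nonneg (convex_Ioo 0 T)
      (fun a ha => (hd a ha).continuousAt.continuousWithinAt) (fun a ha => ?_) fun a ha => ?_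
    · rw [interior_Ioo] at ha
      exact (hd a ha).differentiableAt.differentiableWithinAt
    · rw [interior_Ioo] at ha
      rw [(hd a ha).deriv, ← one_div, ← sub_div]
      exact div_nonneg (by linarith [hg a ha]) ha.1.le
  have hh : T / 2 ∈ Ioo 0 T := ⟨by linarith, by linarith⟩
  refine tendsto_atBot_mono' _ ?_
    (tendsto_atBot_add_const_right _ (P (T / 2) - Real.log (T / 2)) Real.tendsto_log_nhdsGT_zero)
  filter_upwards [Ioo_mem_nhdsGT hh.1] with a ha
  have := hmono ⟨ha.1, ha.2.trans hh.2⟩ hh ha.2.le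
  simp only at this
  linarith

/-- The angular momentum of a solution which tends to the center vanishes. -/
theorem angularMomentum_eq_zero {Γ : ℝ → ℝ} (hΓ : ContDiff ℝ ∞ Γ) (h0 : Γ 0 = 0)
    (h1 : deriv Γ 0 = 1) {k b c μ L a₁ δ : ℝ} (ha₁ : 0 < a₁) (hpos : ∀ s ∈ Ioo 0 δ, 0 < Γ s)
    {s P : ℝ → ℝ}
    (h : IsReducedSolution (fun a s => redForce Γ k b c L s + μ * a ^ 2 * Γ s) a₁ δ s P) :
    L = 0 := by
  by_contra hL
  have hmem : ∀ᶠ a in 𝓝[>] (0 : ℝ), a ∈ Ioo 0 a₁ := Ioo_mem_nhdsGT ha₁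
  have hs0 : Tendsto s (𝓝[>] 0) (𝓝 0) := by
    have h2 := (h.continuousOn 0 ⟨le_rfl, ha₁.le⟩).tendsto
    rw [h.zero] at h2
    exact h2.mono_left (nhdsWithin_le_iff.2 (mem_of_superset hmem Ioo_subset_Icc_self))
  have hG : Tendsto (fun a => Γ (s a)) (𝓝[>] 0) (𝓝 0) := by
    simpa only [Function.comp_def, h0] using (hΓ.continuous.tendsto 0).comp hs0
  have hD : Tendsto (fun a => deriv Γ (s a)) (𝓝[>] 0) (𝓝 1) := by
    simpa only [Function.comp_def, h1] using ((contDiff_deriv hΓ).continuous.tendsto 0).comp hs0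
  have hF : Tendsto (fun a => potF Γ (s a)) (𝓝[>] 0) (𝓝 0) := by
    simpa only [Function.comp_def, potF_zero] using
      ((contDiff_potF hΓ).continuous.tendsto 0).comp hs0
  have ha : Tendsto (fun a : ℝ => a) (𝓝[>] 0) (𝓝 0) := tendsto_id.mono_left nhdsWithin_le_nhds
  have hQ : Tendsto (fun a => potGDeriv Γ k b (s a)) (𝓝[>] 0) (𝓝 0) := by
    have := (((hG.const_mul (k ^ 2)).mul hD).add (hG.const_mul (b * k))).sub
      ((hF.const_mul (2 * k ^ 2)).mul hG)
    simpa [potGDeriv] using this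
  -- This is `Γ³` times the force: only the centrifugal term survives in the limit, so the force
  -- itself tends to `+∞` when `L ≠ 0`.
  have hlim : Tendsto (fun a => deriv Γ (s a) * (L - c * potF Γ (s a)) ^ 2
      + c * (L - c * potF Γ (s a)) * Γ (s a) ^ 2
      - potGDeriv Γ k b (s a) * Γ (s a) ^ 3 + μ * a ^ 2 * Γ (s a) ^ 4) (𝓝[>] 0) (𝓝 (L ^ 2)) := by
    have hLF := (hF.const_mul c).const_sub L
    have := (((hD.mul (hLF.pow 2)).add ((hLF.const_mul c).mul (hG.pow 2))).sub
      (hQ.mul (hG.pow 3))).add (((ha.pow 2).const_mul μ).mul (hG.pow 4))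
    simpa using this
  have hL2 : 0 < L ^ 2 := by positivity
  have e1 := hlim.eventually_const_lt (show L ^ 2 / 2 < L ^ 2 by linarith)
  have e2 := (hG.pow 3).eventually_lt_const (show (0 : ℝ) ^ 3 < L ^ 2 / 2 by simpa using hL2)
  have hforce : ∀ᶠ a in 𝓝[>] (0 : ℝ), a ∈ Ioo 0 a₁ ∧
      1 ≤ redForce Γ k b c L (s a) + μ * a ^ 2 * Γ (s a) := by
    filter_upwards [e1, e2, hmem] with a h2 h3 h4
    have hg := hpos _ (h.mem a h4)
    refine ⟨h4, ?_⟩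
    have e : redForce Γ k b c L (s a) + μ * a ^ 2 * Γ (s a)
        = (deriv Γ (s a) * (L - c * potF Γ (s a)) ^ 2
          + c * (L - c * potF Γ (s a)) * Γ (s a) ^ 2
          - potGDeriv Γ k b (s a) * Γ (s a) ^ 3 + μ * a ^ 2 * Γ (s a) ^ 4) / Γ (s a) ^ 3 := by
      rw [redForce]
      field_simp
    rw [e, le_div_iff₀ (by positivity)]
    linarith
  obtain ⟨T, hT, hTs⟩ := mem_nhdsGT_iff_exists_Ioo_subset.1 hforce
  have hP := tendsto_atBot_of_one_le hT (fun a ha => h.deriv_P a (hTs ha).1)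
    fun a ha => (hTs ha).2
  obtain ⟨T', hT', hTs'⟩ := mem_nhdsGT_iff_exists_Ioo_subset.1
    (hmem.and (hP.eventually_le_atBot (-1)))
  -- Once `P ≤ -1`, the same comparison applied to `-s` gives `s → +∞`, contradicting `s → 0`.
  have hneg := tendsto_atBot_of_one_le (P := fun a => -s a) (g := fun a => -P a) hT'
    (fun a ha => (h.deriv_s a (hTs' ha).1).neg.congr_deriv (neg_div _ _).symm)
    fun a ha => by linarith [(hTs' ha).2]
  exact not_tendsto_nhds_of_tendsto_atBot hneg _ hs0.neg

end ReducedUniqueness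

section PolarUniqueness

/-! ### Small discs around the center -/

/-- The radial force at angular momentum `L`. -/
def radialForce (Γ : ℝ → ℝ) (k b c μ L a s : ℝ) : ℝ := redForce Γ k b c L s + μ * a ^ 2 * Γ s

/-- In the disc of radius `δ` the profile function is close to the identity, and for `a < a₁` the
radial force at angular momentum zero is increasing and at most linear. -/
structure IsSmallDisc (Γ : ℝ → ℝ) (k b c μ a₁ δ : ℝ) : Prop where
  smooth : ContDiff ℝ ∞ Γ
  zero : Γ 0 = 0
  deriv_zero : deriv Γ 0 = 1
  pos : 0 < a₁
  deriv_bounds : ∀ s, |s| ≤ δ → 1 / 2 ≤ deriv Γ s ∧ deriv Γ s ≤ 2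
  force_lt : ∀ a ∈ Ioo 0 a₁, ∀ x y, 0 ≤ y → y < x → x < δ →
    radialForce Γ k b c μ 0 a y < radialForce Γ k b c μ 0 a x
  force_le : ∃ K, ∀ a ∈ Ioo 0 a₁, ∀ x ∈ Ioo 0 δ, |radialForce Γ k b c μ 0 a x| ≤ K * x

variable {Γ : ℝ → ℝ} {k b c μ a₁ δ : ℝ}

theorem abs_sub_le_of_deriv_bounds {ρ : ℝ} (hΓ : ContDiff ℝ ∞ Γ)
    (hd : ∀ s, |s| ≤ ρ → 1 / 2 ≤ deriv Γ s ∧ deriv Γ s ≤ 2) {s t : ℝ} (hs : |s| ≤ ρ)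
    (ht : |t| ≤ ρ) : |Γ s - Γ t| ≤ 2 * |s - t| := by
  have := (convex_Icc (-ρ) ρ).norm_image_sub_le_of_norm_hasDerivWithin_le (f := Γ) (C := 2)
    (fun x _ => (hasDerivAt_self hΓ x).hasDerivWithinAt) (fun x hx => by
      have := hd x (abs_le.2 hx)
      rw [Real.norm_eq_abs, abs_le]
      constructor <;> linarith) (abs_le.1 ht) (abs_le.1 hs)
  simpa using this

theorem half_le_of_deriv_bounds {ρ : ℝ} (hΓ : ContDiff ℝ ∞ Γ) (h0 : Γ 0 = 0)
    (hd : ∀ s, |s| ≤ ρ → 1 / 2 ≤ deriv Γ s ∧ deriv Γ s ≤ 2) {s : ℝ} (hs : 0 < s) (hsρ : s ≤ ρ) :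
    s / 2 ≤ Γ s := by
  obtain ⟨t, ht, hts⟩ := exists_hasDerivAt_eq_slope Γ (deriv Γ) hs
    hΓ.continuous.continuousOn (fun x _ => hasDerivAt_self hΓ x)
  have h2 := (hd t (by rw [abs_of_pos ht.1]; linarith [ht.2])).1
  rw [h0, sub_zero, sub_zero, eq_div_iff hs.ne'] at hts
  nlinarith

theorem abs_potF_le_of_deriv_bounds {ρ : ℝ} (hΓ : ContDiff ℝ ∞ Γ) (h0 : Γ 0 = 0)
    (hd : ∀ s, |s| ≤ ρ → 1 / 2 ≤ deriv Γ s ∧ deriv Γ s ≤ 2) {s : ℝ} (hs : 0 ≤ s) (hsρ : s ≤ ρ) :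
    |potF Γ s| ≤ 2 * s ^ 2 := by
  have := intervalIntegral.norm_integral_le_of_norm_le_const (a := 0) (b := s) (f := Γ)
    (C := 2 * s) fun t ht => by
      rw [uIoc_of_le hs] at ht
      have h1 := abs_sub_le_of_deriv_bounds hΓ hd (s := t) (t := 0)
        (by rw [abs_of_pos ht.1]; linarith [ht.2]) (by simpa using hs.trans hsρ)
      rw [h0, sub_zero, sub_zero, abs_of_pos ht.1] at h1
      exact h1.trans (by linarith [ht.2])
  rw [sub_zero, abs_of_nonneg hs] at this
  calc |potF Γ s| ≤ 2 * s * s := this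
    _ = _ := by ring

theorem IsSmallDisc.Γ_pos (h : IsSmallDisc Γ k b c μ a₁ δ) {s : ℝ} (hs : s ∈ Ioo 0 δ) :
    0 < Γ s := by
  have := half_le_of_deriv_bounds h.smooth h.zero h.deriv_bounds hs.1 hs.2.le
  linarith [hs.1]

/-- A function with zero derivative on `(0, T)` is constant there. -/
theorem eqOn_of_hasDerivAt_zero {f : ℝ → ℝ} {T : ℝ} (hf : ∀ a ∈ Ioo 0 T, HasDerivAt f 0 a) :
    ∃ L, ∀ a ∈ Ioo 0 T, f a = L := by
  by_cases hT : 0 < T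
  · refine ⟨f (T / 2), fun a ha => ?_⟩
    exact isOpen_Ioo.is_const_of_deriv_eq_zero isPreconnected_Ioo
      (fun x hx => (hf x hx).differentiableAt.differentiableWithinAt)
      (fun x hx => (hf x hx).deriv) ha ⟨by linarith, by linarith⟩
  · exact ⟨0, fun a ha => absurd (ha.1.trans ha.2) hT⟩

/-! ### The polar system: uniqueness -/

/-- The equation for `s` is linear up to a bounded factor, since `|Γ(s)| ≤ 2 |s|`. A zero at some `a
> 0` would propagate to `a₁` by Gronwall, against `s₁ > 0`; a negative value would force a zero by
the intermediate value theorem. -/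
theorem IsLocalPolar.pos (hD : IsSmallDisc Γ k b c μ a₁ δ) {s₁ : ℝ} (hs₁ : 0 < s₁)
    {s r γ : ℝ → ℝ} (h : IsLocalPolar Γ k b c μ a₁ δ s₁ s r γ) : ∀ a ∈ Ioc 0 a₁, 0 < s a := by
  obtain ⟨⟨A, hA, hsol⟩, hs0, hsa, hlt⟩ := h
  have hne : ∀ a ∈ Ioc 0 a₁, s a ≠ 0 := by
    intro a ha hz
    have hsub : ∀ x ∈ Icc a a₁, x ∈ Ioo 0 A := fun x hx =>
      ⟨ha.1.trans_le hx.1, hx.2.trans_lt hA⟩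
    have hcont : ContinuousOn (fun x => 1 / x * (r x * Real.cos (γ x))) (Icc a a₁) := by
      intro x hx
      have h1 := (hsol.deriv_r x (hsub x hx)).continuousAt
      have h2 := (hsol.deriv_γ x (hsub x hx)).continuousAt
      have h3 : ContinuousAt (fun x : ℝ => 1 / x) x :=
        continuousAt_const.div continuousAt_id (hsub x hx).1.ne'
      exact (h3.mul (h1.mul (Real.continuous_cos.continuousAt.comp' h2))).continuousWithinAt
    obtain ⟨K, hK⟩ := isCompact_Icc.exists_bound_of_continuousOn hcont
    have hg := norm_le_gronwallBound_of_norm_deriv_right_le (f := s) (δ := 0) (K := 2 * K)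
      (ε := 0) (a := a) (b := a₁)
      (fun x hx => (hsol.deriv_s x (hsub x hx)).continuousAt.continuousWithinAt)
      (fun x hx => (hsol.deriv_s x (hsub x ⟨hx.1, hx.2.le⟩)).hasDerivWithinAt) (by simp [hz])
      (fun x hx => by
        have hx' : x ∈ Icc a a₁ := ⟨hx.1, hx.2.le⟩
        have h1 := abs_sub_le_of_deriv_bounds hD.smooth hD.deriv_bounds (s := s x) (t := 0)
          (hlt x ⟨ha.1.le.trans hx.1, hx.2.le⟩).le
          (by simpa using (abs_nonneg _).trans (hlt x ⟨ha.1.le.trans hx.1, hx.2.le⟩).le)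
        rw [hD.zero, sub_zero, sub_zero] at h1
        have h2 := hK x hx'
        have e : 1 / x * (r x * Γ (s x) * Real.cos (γ x))
            = 1 / x * (r x * Real.cos (γ x)) * Γ (s x) := by ring
        rw [e, norm_mul, add_zero]
        calc _ ≤ K * (2 * |s x|) := mul_le_mul h2 h1 (abs_nonneg _) ((norm_nonneg _).trans h2)
          _ = _ := by rw [Real.norm_eq_abs]; ring) a₁ ⟨ha.2, le_rfl⟩
    rw [gronwallBound_ε0_δ0, hsa, Real.norm_eq_abs] at hg
    exact hs₁.ne' (abs_nonpos_iff.1 hg)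
  intro a ha
  by_contra! hneg
  have hcont : ContinuousOn s (Icc a a₁) :=
    hsol.continuousOn.mono fun x hx => ⟨ha.1.le.trans hx.1, hx.2.trans_lt hA⟩
  obtain ⟨x, hx, hx0⟩ := intermediate_value_Icc ha.2 hcont
    (show (0 : ℝ) ∈ Icc (s a) (s a₁) from ⟨hneg, by rw [hsa]; exact hs₁.le⟩)
  exact hne x ⟨ha.1.trans_le hx.1, hx.2⟩ hx0

/-- The system conserves `r Γ² sin γ + c F`. Using its value `L` to eliminate `r sin γ` closes the
equations for `s` and `P = r Γ cos γ`; then `L = 0` because `s → 0`. -/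
theorem IsLocalPolar.reduced (hD : IsSmallDisc Γ k b c μ a₁ δ) {s₁ : ℝ} (hs₁ : 0 < s₁)
    {s r γ : ℝ → ℝ} (h : IsLocalPolar Γ k b c μ a₁ δ s₁ s r γ) :
    IsReducedSolution (radialForce Γ k b c μ 0) a₁ δ s
        (fun a => r a * Γ (s a) * Real.cos (γ a)) ∧
      ∀ a ∈ Ioo 0 a₁, r a * Γ (s a) ^ 2 * Real.sin (γ a) + c * potF Γ (s a) = 0 := by
  have hpos := h.pos hD hs₁
  obtain ⟨⟨A, hA, hsol⟩, hs0, hsa, hlt⟩ := h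
  have hsub : ∀ x ∈ Ioo 0 a₁, x ∈ Ioo 0 A := fun x hx => ⟨hx.1, hx.2.trans hA⟩
  have hmem : ∀ a ∈ Ioo 0 a₁, s a ∈ Ioo 0 δ := fun a ha =>
    ⟨hpos a ⟨ha.1, ha.2.le⟩, (le_abs_self _).trans_lt (hlt a ⟨ha.1.le, ha.2.le⟩)⟩
  have hL : ∀ a ∈ Ioo 0 a₁, HasDerivAt
      (fun a => r a * Γ (s a) ^ 2 * Real.sin (γ a) + c * potF Γ (s a)) 0 a := by
    intro a ha
    have h1 := hsol.deriv_s a (hsub a ha)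
    have h2 := hsol.deriv_r a (hsub a ha)
    have h3 := hsol.deriv_γ a (hsub a ha)
    have hr := hsol.r_pos a (hsub a ha)
    have hg := hD.Γ_pos (hmem a ha)
    have ha0 := ha.1
    have h4 := (hasDerivAt_self hD.smooth (s a)).comp a h1
    have h5 := (hasDerivAt_potF hD.smooth.continuous (s a)).comp a h1
    refine (((h2.mul (h4.pow 2)).mul h3.sin).add (h5.const_mul c)).congr_deriv ?_
    simp only [Function.comp_apply, Pi.mul_apply, Pi.pow_apply]
    push_cast
    field_simp
    ring
  obtain ⟨L, hLc⟩ := eqOn_of_hasDerivAt_zero hL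
  have hred : IsReducedSolution (radialForce Γ k b c μ L) a₁ δ s
      (fun a => r a * Γ (s a) * Real.cos (γ a)) := by
    refine ⟨hsol.continuousOn.mono fun x hx => ⟨hx.1, hx.2.trans_lt hA⟩, hs0, hmem,
      fun a ha => ?_, fun a ha => ?_⟩
    · exact (hsol.deriv_s a (hsub a ha)).congr_deriv (by ring)
    · have h1 := hsol.deriv_s a (hsub a ha)
      have h2 := hsol.deriv_r a (hsub a ha)
      have h3 := hsol.deriv_γ a (hsub a ha)
      have hr := hsol.r_pos a (hsub a ha)
      have hg := hD.Γ_pos (hmem a ha)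
      have ha0 := ha.1
      have h4 := (hasDerivAt_self hD.smooth (s a)).comp a h1
      refine ((h2.mul h4).mul h3.cos).congr_deriv ?_
      have hLF : L - c * potF Γ (s a) = r a * Γ (s a) ^ 2 * Real.sin (γ a) := by
        rw [← hLc a ha]; ring
      simp only [Function.comp_apply, Pi.mul_apply, radialForce, redForce, hLF,
        deriv_potG hD.smooth]
      field_simp
      linear_combination (μ * a ^ 2 * Γ (s a) - potGDeriv Γ k b (s a))
        * (Real.sin_sq_add_cos_sq (γ a))
  have hL0 : L = 0 := angularMomentum_eq_zero hD.smooth hD.zero hD.deriv_zero hD.pos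
    (fun s hs => hD.Γ_pos hs) hred
  subst hL0
  exact ⟨hred, hLc⟩

/-- Two continuous functions which agree on `(0, T)` agree on `(0, T]`. -/
theorem eqOn_Ioc_of_eqOn_Ioo {X : Type*} [TopologicalSpace X] [T2Space X] {f g : ℝ → X} {T : ℝ}
    (h : EqOn f g (Ioo 0 T)) (hf : ContinuousAt f T) (hg : ContinuousAt g T) :
    EqOn f g (Ioc 0 T) := by
  intro a ha
  rcases ha.2.lt_or_eq with h1 | h1
  · exact h ⟨ha.1, h1⟩
  · rw [h1] at ha ⊢
    have h2 : f =ᶠ[𝓝[<] T] g := by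
      filter_upwards [Ioo_mem_nhdsLT ha.1] with x hx using h hx
    exact tendsto_nhds_unique ((hf.tendsto.mono_left nhdsWithin_le_nhds).congr' h2)
      (hg.tendsto.mono_left nhdsWithin_le_nhds)

/-- The maximum principle identifies `s` and `P`, and `L = 0` identifies `r sin γ`; so `r > 0`, `cos
γ` and `sin γ` agree. The two angles then have the same derivative and differ by a constant in
`2πℤ`. Continuity adds the endpoint `a₁`. -/
theorem IsLocalPolar.unique (hD : IsSmallDisc Γ k b c μ a₁ δ) {s₁ : ℝ} (hs₁ : 0 < s₁)
    {s r γ s' r' γ' : ℝ → ℝ} (h : IsLocalPolar Γ k b c μ a₁ δ s₁ s r γ)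
    (h' : IsLocalPolar Γ k b c μ a₁ δ s₁ s' r' γ') :
    ∃ n : ℤ, ∀ a ∈ Ioc 0 a₁, s' a = s a ∧ r' a = r a ∧ γ' a = γ a + n * (2 * Real.pi) := by
  obtain ⟨hR, hL⟩ := h.reduced hD hs₁
  obtain ⟨hR', hL'⟩ := h'.reduced hD hs₁
  have hsa : s a₁ = s' a₁ := by rw [h.2.2.1, h'.2.2.1]
  obtain ⟨hss, hPP⟩ := hR.eqOn hR' hD.force_lt hsa
  obtain ⟨⟨A, hA, hsol⟩, hs0, -, hlt⟩ := h
  obtain ⟨⟨A', hA', hsol'⟩, hs0', -, hlt'⟩ := h'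
  have hsub : ∀ x ∈ Ioo 0 a₁, x ∈ Ioo 0 A := fun x hx => ⟨hx.1, hx.2.trans hA⟩
  have hsub' : ∀ x ∈ Ioo 0 a₁, x ∈ Ioo 0 A' := fun x hx => ⟨hx.1, hx.2.trans hA'⟩
  have key : ∀ a ∈ Ioo 0 a₁, r' a = r a ∧ Real.cos (γ' a) = Real.cos (γ a) ∧
      Real.sin (γ' a) = Real.sin (γ a) := by
    intro a ha
    have hg := hD.Γ_pos (hR.mem a ha)
    have hr := hsol.r_pos a (hsub a ha)
    have hr' := hsol'.r_pos a (hsub' a ha)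
    have e1 := hPP ha
    have e2 := hL a ha
    have e3 := hL' a ha
    have es := hss ⟨ha.1.le, ha.2.le⟩
    simp only [← es] at e1 e3
    have c1 : r a * Real.cos (γ a) = r' a * Real.cos (γ' a) :=
      mul_left_cancel₀ hg.ne' (by linear_combination e1)
    have c2 : r a * Real.sin (γ a) = r' a * Real.sin (γ' a) :=
      mul_left_cancel₀ (pow_ne_zero 2 hg.ne') (by linear_combination e2 - e3)
    have c3 : r' a ^ 2 = r a ^ 2 := by
      have s1 := Real.sin_sq_add_cos_sq (γ a)
      have s2 := Real.sin_sq_add_cos_sq (γ' a)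
      calc r' a ^ 2 = (r' a * Real.cos (γ' a)) ^ 2 + (r' a * Real.sin (γ' a)) ^ 2 := by
            linear_combination -r' a ^ 2 * s2
        _ = r a ^ 2 := by rw [← c1, ← c2]; linear_combination r a ^ 2 * s1
    have c4 : r' a = r a := (pow_left_inj₀ hr'.le hr.le two_ne_zero).1 c3
    rw [c4] at c1 c2
    exact ⟨c4, (mul_left_cancel₀ hr.ne' c1).symm, (mul_left_cancel₀ hr.ne' c2).symm⟩
  have hγ : ∀ a ∈ Ioo 0 a₁, HasDerivAt (fun a => γ' a - γ a) 0 a := by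
    intro a ha
    refine ((hsol'.deriv_γ a (hsub' a ha)).sub (hsol.deriv_γ a (hsub a ha))).congr_deriv ?_
    obtain ⟨k1, k2, k3⟩ := key a ha
    rw [k1, k3, hss ⟨ha.1.le, ha.2.le⟩, sub_self]
  obtain ⟨θ, hθ⟩ := eqOn_of_hasDerivAt_zero hγ
  have hpos := hD.pos
  have hh : a₁ / 2 ∈ Ioo 0 a₁ := ⟨by linarith, by linarith⟩
  obtain ⟨n, hn⟩ : ∃ n : ℤ, θ = n * (2 * Real.pi) := by
    obtain ⟨-, k2, k3⟩ := key _ hh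
    have : Real.cos θ = 1 := by
      rw [← hθ _ hh, Real.cos_sub, k2, k3]
      linear_combination Real.sin_sq_add_cos_sq (γ (a₁ / 2))
    obtain ⟨n, hn⟩ := (Real.cos_eq_one_iff θ).1 this
    exact ⟨n, hn.symm⟩
  have hm : a₁ ∈ Ioo 0 A := ⟨hpos, hA⟩
  have hm' : a₁ ∈ Ioo 0 A' := ⟨hpos, hA'⟩
  have hrc := eqOn_Ioc_of_eqOn_Ioo (fun a ha => (key a ha).1) (hsol'.deriv_r _ hm').continuousAt
    (hsol.deriv_r _ hm).continuousAt
  have hγc := eqOn_Ioc_of_eqOn_Ioo (f := γ') (g := fun a => γ a + n * (2 * Real.pi))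
    (fun a ha => by simp only; linear_combination hθ a ha + hn)
    (hsol'.deriv_γ _ hm').continuousAt ((hsol.deriv_γ _ hm).continuousAt.add continuousAt_const)
  exact ⟨n, fun a ha => ⟨(hss ⟨ha.1.le, ha.2⟩).symm, hrc ha, hγc ha⟩⟩

end PolarUniqueness

section ProfileCurves

/-! ### Profile curves in polar form -/

variable {Γ : ℝ → ℝ} {k b c μ a₁ δ : ℝ}

theorem norm_plane (x : Plane) : ‖x‖ = √(x 0 ^ 2 + x 1 ^ 2) := by
  rw [← norm_sq_plane, Real.sqrt_sq (norm_nonneg _)]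

theorem hasDerivAt_coord {W : ℝ → Plane} {v : Plane} {a : ℝ} (h : HasDerivAt W v a) (i : Fin 2) :
    HasDerivAt (fun a => W a i) (v i) a :=
  (EuclideanSpace.proj i : Plane →L[ℝ] ℝ).hasFDerivAt.comp_hasDerivAt a h

theorem hasDerivAt_norm_curve {W : ℝ → Plane} {v : Plane} {a : ℝ} (h : HasDerivAt W v a)
    (h0 : W a ≠ 0) :
    HasDerivAt (fun a => ‖W a‖) ((W a 0 * v 0 + W a 1 * v 1) / ‖W a‖) a := by
  have hn : 0 < ‖W a‖ := norm_pos_iff.2 h0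
  have h1 := (((hasDerivAt_coord h 0).pow 2).add ((hasDerivAt_coord h 1).pow 2)).sqrt (by
    simp only [Pi.add_apply, Pi.pow_apply]
    rw [← norm_sq_plane]; positivity)
  simp only [Pi.add_apply, Pi.pow_apply, ← norm_plane] at h1
  refine h1.congr_deriv ?_
  push_cast
  field_simp

/-- The Euclidean angular momentum of a curve. -/
def cross (W : ℝ → Plane) (a : ℝ) : ℝ := W a 0 * deriv W a 1 - W a 1 * deriv W a 0

/-- The Euclidean radial momentum of a curve. -/
def radial (W : ℝ → Plane) (a : ℝ) : ℝ := W a 0 * deriv W a 0 + W a 1 * deriv W a 1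

/-- The conserved angular momentum of a profile curve. -/
def angMomentum (Γ : ℝ → ℝ) (c : ℝ) (W : ℝ → Plane) (a : ℝ) : ℝ :=
  a * ((Γ ‖W a‖ / ‖W a‖) ^ 2 * cross W a) + c * potF Γ ‖W a‖

/-! ### Evolution of the momenta along a curve -/

section Curve

variable {W : ℝ → Plane} {a : ℝ}

theorem hasDerivAt_cross (h1 : HasDerivAt W (deriv W a) a)
    (h2 : HasDerivAt (deriv W) (deriv (deriv W) a) a) :
    HasDerivAt (cross W) (W a 0 * deriv (deriv W) a 1 - W a 1 * deriv (deriv W) a 0) a := by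
  refine (((hasDerivAt_coord h1 0).mul (hasDerivAt_coord h2 1)).sub
    ((hasDerivAt_coord h1 1).mul (hasDerivAt_coord h2 0))).congr_deriv ?_
  ring

theorem hasDerivAt_radial (h1 : HasDerivAt W (deriv W a) a)
    (h2 : HasDerivAt (deriv W) (deriv (deriv W) a) a) :
    HasDerivAt (radial W) (deriv W a 0 ^ 2 + deriv W a 1 ^ 2
      + (W a 0 * deriv (deriv W) a 0 + W a 1 * deriv (deriv W) a 1)) a := by
  refine (((hasDerivAt_coord h1 0).mul (hasDerivAt_coord h2 0)).add
    ((hasDerivAt_coord h1 1).mul (hasDerivAt_coord h2 1))).congr_deriv ?_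
  ring

/-- This is a multiple of the angular component of the equation: the factor `a` absorbs the damping
`W_a / a`, and the term in `𝒥 W_a` integrates to `c F`. -/
theorem hasDerivAt_angMomentum (hΓ : ContDiff ℝ ∞ Γ) (h1 : HasDerivAt W (deriv W a) a)
    (h2 : HasDerivAt (deriv W) (deriv (deriv W) a) a) (h0 : W a ≠ 0) (hpos : 0 < Γ ‖W a‖)
    (ha : 0 < a)
    (hode : profileField Γ k b c μ a (W a) (deriv W a) (deriv (deriv W) a) = 0) :
    HasDerivAt (angMomentum Γ c W) 0 a := by
  have hn : 0 < ‖W a‖ := norm_pos_iff.2 h0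
  have hang := ((profileField_eq_zero_iff k b c μ a h0 hpos _ _).1 hode).2
  rw [angular_profileField hΓ k b c μ a h0 hpos] at hang
  have e1 := hasDerivAt_norm_curve h1 h0
  have e2 := (hasDerivAt_self hΓ _).comp a e1
  have e3 := (hasDerivAt_potF hΓ.continuous _).comp a e1
  refine (((hasDerivAt_id a).mul (((e2.div e1 hn.ne').pow 2).mul (hasDerivAt_cross h1 h2))).add
    (e3.const_mul c)).congr_deriv ?_
  simp only [Function.comp_apply, Pi.mul_apply, Pi.pow_apply, Pi.div_apply, id, cross]
  push_cast
  field_simp at hang ⊢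
  linear_combination hang

theorem hasDerivAt_radialMomentum (hΓ : ContDiff ℝ ∞ Γ) (h1 : HasDerivAt W (deriv W a) a)
    (h2 : HasDerivAt (deriv W) (deriv (deriv W) a) a) (h0 : W a ≠ 0) (hpos : 0 < Γ ‖W a‖)
    (ha : 0 < a)
    (hode : profileField Γ k b c μ a (W a) (deriv W a) (deriv (deriv W) a) = 0) :
    HasDerivAt (fun a => a * radial W a / ‖W a‖)
      (radialForce Γ k b c μ (angMomentum Γ c W a) a ‖W a‖ / a) a := by
  have hn : 0 < ‖W a‖ := norm_pos_iff.2 h0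
  have hn2 := norm_sq_plane (W a)
  have hrad := ((profileField_eq_zero_iff k b c μ a h0 hpos _ _).1 hode).1
  rw [radial_profileField hΓ k b c μ a h0 hpos] at hrad
  have e1 := hasDerivAt_norm_curve h1 h0
  refine (((hasDerivAt_id a).mul (hasDerivAt_radial h1 h2)).div e1 hn.ne').congr_deriv ?_
  have hLF : angMomentum Γ c W a - c * potF Γ ‖W a‖
      = a * ((Γ ‖W a‖ / ‖W a‖) ^ 2 * cross W a) := by rw [angMomentum]; ring
  simp only [Pi.mul_apply, id, radialForce, redForce, hLF]
  have hlag : (deriv W a 0 ^ 2 + deriv W a 1 ^ 2) * ‖W a‖ ^ 2 = radial W a ^ 2 + cross W a ^ 2 := by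
    rw [hn2, radial, cross]; ring
  have hc : W a 0 * deriv W a 1 - W a 1 * deriv W a 0 = cross W a := rfl
  have hr : W a 0 * deriv W a 0 + W a 1 * deriv W a 1 = radial W a := rfl
  rw [hc, hr] at hrad
  rw [hr]
  have hw : W a 0 * deriv (deriv W) a 0 + W a 1 * deriv (deriv W) a 1
      = -((1 / ‖W a‖ ^ 2 - Γ ‖W a‖ * deriv Γ ‖W a‖ / ‖W a‖ ^ 3) * cross W a ^ 2
      + 1 / a * radial W a + 1 / a ^ 2 * (potGDeriv Γ k b ‖W a‖ * ‖W a‖)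
      - μ * (Γ ‖W a‖ * ‖W a‖) - c / a * (Γ ‖W a‖ / ‖W a‖ * cross W a)) := by
    linear_combination hrad
  have hv : deriv W a 0 ^ 2 + deriv W a 1 ^ 2 = (radial W a ^ 2 + cross W a ^ 2) / ‖W a‖ ^ 2 := by
    rw [← hlag]; field_simp
  rw [hw, hv]
  field_simp
  ring

/-- The equation is not needed at the center. The cross product vanishes there together with its
derivative `W × W_aa`, its coefficient stays bounded, and `F = O(‖W‖²)`; so every term is `o(x -
a)`. -/
theorem hasDerivAt_angMomentum_of_eq_zero (hD : IsSmallDisc Γ k b c μ a₁ δ) (hδ : 0 < δ)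
    (h1 : HasDerivAt W (deriv W a) a) (h2 : HasDerivAt (deriv W) (deriv (deriv W) a) a)
    (h0 : W a = 0) : HasDerivAt (angMomentum Γ c W) 0 a := by
  have hL0 : angMomentum Γ c W a = 0 := by simp [angMomentum, h0, potF_zero]
  have hsmall : ∀ᶠ x in 𝓝 a, ‖W x‖ < δ :=
    h1.continuousAt.norm.eventually_lt_const (by simpa [h0] using hδ)
  have hcr : (cross W) =o[𝓝 a] fun x => x - a := by
    have hc0 : cross W a = 0 := by simp [cross, h0]
    simpa [h0, hc0] using (hasDerivAt_cross h1 h2).isLittleO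
  have hsq : (fun x => ‖W x‖ ^ 2) =o[𝓝 a] fun x => x - a := by
    have := (((hasDerivAt_coord h1 0).pow 2).add ((hasDerivAt_coord h1 1).pow 2)).isLittleO
    simpa [h0, norm_sq_plane] using this
  have hF : (fun x => potF Γ ‖W x‖) =O[𝓝 a] fun x => ‖W x‖ ^ 2 := by
    refine IsBigO.of_bound 2 ?_
    filter_upwards [hsmall] with x hx
    rw [Real.norm_eq_abs, Real.norm_eq_abs, abs_of_nonneg (sq_nonneg ‖W x‖)]
    exact abs_potF_le_of_deriv_bounds hD.smooth hD.zero hD.deriv_bounds (norm_nonneg _) hx.le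
  have hψ : (fun x => x * (Γ ‖W x‖ / ‖W x‖) ^ 2) =O[𝓝 a] fun _ => (1 : ℝ) := by
    have hid : (fun x : ℝ => x) =O[𝓝 a] fun _ => (1 : ℝ) :=
      (continuousAt_id (x := a)).tendsto.isBigO_one ℝ
    have hb : (fun x => (Γ ‖W x‖ / ‖W x‖) ^ 2) =O[𝓝 a] fun _ => (1 : ℝ) := by
      refine IsBigO.of_bound 4 ?_
      filter_upwards [hsmall] with x hx
      have hq : |Γ ‖W x‖ / ‖W x‖| ≤ 2 := by
        have := abs_sub_le_of_deriv_bounds hD.smooth hD.deriv_bounds (s := ‖W x‖) (t := 0)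
          (by simpa using hx.le) (by simpa using hδ.le)
        rw [hD.zero, sub_zero, sub_zero] at this
        rw [abs_div]
        exact div_le_of_le_mul₀ (abs_nonneg _) two_pos.le this
      rw [norm_pow, norm_one, Real.norm_eq_abs]
      nlinarith [abs_nonneg (Γ ‖W x‖ / ‖W x‖)]
    simpa using hid.mul hb
  rw [hasDerivAt_iff_isLittleO, hL0]
  simp only [sub_zero, smul_zero]
  have h3 := hψ.mul_isLittleO hcr
  simp only [one_mul] at h3
  refine (h3.add ((hF.trans_isLittleO hsq).const_mul_left c)).congr_left fun x => ?_
  simp only [angMomentum]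
  ring

end Curve

theorem IsProfileSolution.hasDerivAt {s₀ : ℝ≥0∞} {A : ℝ} {W : ℝ → Plane}
    (h : IsProfileSolution s₀ Γ k b c μ A W) {a : ℝ} (ha : a ∈ Ioo 0 A) :
    HasDerivAt W (deriv W a) a ∧ HasDerivAt (deriv W) (deriv (deriv W) a) a := by
  have h1 := h.contDiffOn
  rw [show (2 : WithTop ℕ∞) = 1 + 1 from rfl, contDiffOn_succ_iff_deriv_of_isOpen isOpen_Ioo] at h1
  have hn := isOpen_Ioo.mem_nhds ha
  exact ⟨(h1.1.differentiableAt hn).hasDerivAt,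
    ((h1.2.2.differentiableOn one_ne_zero).differentiableAt hn).hasDerivAt⟩

/-- The momentum is constant, also across passages through the center. If there is such a passage it
is zero there; otherwise the polar argument applies to `‖W‖`. -/
theorem IsLocalProfile.angMomentum_eq_zero (hD : IsSmallDisc Γ k b c μ a₁ δ) (hδ : 0 < δ)
    {s₀ : ℝ≥0∞} {s₁ : ℝ} {W : ℝ → Plane} (h : IsLocalProfile s₀ Γ k b c μ a₁ δ s₁ W) :
    ∀ a ∈ Ioo 0 a₁, angMomentum Γ c W a = 0 := by
  obtain ⟨⟨A, hA, hsol⟩, hW0, hWa, hlt⟩ := h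
  have hsub : ∀ x ∈ Ioo 0 a₁, x ∈ Ioo 0 A := fun x hx => ⟨hx.1, hx.2.trans hA⟩
  have hpos : ∀ a ∈ Ioo 0 a₁, W a ≠ 0 → 0 < Γ ‖W a‖ := fun a ha h0 =>
    hD.Γ_pos ⟨norm_pos_iff.2 h0, hlt a ⟨ha.1.le, ha.2.le⟩⟩
  have hd : ∀ a ∈ Ioo 0 a₁, HasDerivAt (angMomentum Γ c W) 0 a := by
    intro a ha
    obtain ⟨h1, h2⟩ := hsol.hasDerivAt (hsub a ha)
    by_cases h0 : W a = 0
    · exact hasDerivAt_angMomentum_of_eq_zero hD hδ h1 h2 h0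
    · exact hasDerivAt_angMomentum hD.smooth h1 h2 h0 (hpos a ha h0) ha.1 (hsol.ode a (hsub a ha))
  obtain ⟨L, hL⟩ := eqOn_of_hasDerivAt_zero hd
  suffices L = 0 by subst this; exact hL
  by_cases hz : ∃ a ∈ Ioo 0 a₁, W a = 0
  · obtain ⟨a, ha, h0⟩ := hz
    rw [← hL a ha]
    simp [angMomentum, h0, potF_zero]
  push Not at hz
  refine angularMomentum_eq_zero hD.smooth hD.zero hD.deriv_zero (k := k) (b := b) (μ := μ)
    (c := c) hD.pos (fun s hs => hD.Γ_pos hs) (s := fun a => ‖W a‖)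
    (P := fun a => a * radial W a / ‖W a‖) (δ := δ) ?_
  refine ⟨(hsol.continuousOn.mono fun x hx => ⟨hx.1, hx.2.trans_lt hA⟩).norm, hW0,
    fun a ha => ⟨norm_pos_iff.2 (hz a ha), hlt a ⟨ha.1.le, ha.2.le⟩⟩, fun a ha => ?_,
    fun a ha => ?_⟩
  · obtain ⟨h1, h2⟩ := hsol.hasDerivAt (hsub a ha)
    refine (hasDerivAt_norm_curve h1 (hz a ha)).congr_deriv ?_
    have := ha.1
    have := norm_pos_iff.2 (hz a ha)
    rw [radial]
    field_simp
  · obtain ⟨h1, h2⟩ := hsol.hasDerivAt (hsub a ha)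
    have := hasDerivAt_radialMomentum hD.smooth h1 h2 (hz a ha) (hpos a ha (hz a ha)) ha.1
      (hsol.ode a (hsub a ha))
    rwa [hL a ha] at this

end ProfileCurves

section ProfileUniqueness

/-! ### Profile curves: uniqueness -/

variable {Γ : ℝ → ℝ} {k b c μ a₁ δ : ℝ} {s₀ : ℝ≥0∞} {s₁ : ℝ} {W : ℝ → Plane}

theorem IsLocalProfile.hasDerivAt_norm (hD : IsSmallDisc Γ k b c μ a₁ δ)
    (h : IsLocalProfile s₀ Γ k b c μ a₁ δ s₁ W) {a : ℝ} (ha : a ∈ Ioo 0 a₁) (h0 : W a ≠ 0) :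
    HasDerivAt (fun a => ‖W a‖) (a * radial W a / ‖W a‖ / a) a ∧
      HasDerivAt (fun a => a * radial W a / ‖W a‖) (radialForce Γ k b c μ 0 a ‖W a‖ / a) a := by
  have hδ : 0 < δ := (norm_nonneg _).trans_lt (h.2.2.2 a ⟨ha.1.le, ha.2.le⟩)
  have hL := h.angMomentum_eq_zero hD hδ a ha
  obtain ⟨⟨A, hA, hsol⟩, hW0, hWa, hlt⟩ := h
  have ha' : a ∈ Ioo 0 A := ⟨ha.1, ha.2.trans hA⟩
  obtain ⟨h1, h2⟩ := hsol.hasDerivAt ha'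
  have hn := norm_pos_iff.2 h0
  have ha0 := ha.1
  constructor
  · refine (hasDerivAt_norm_curve h1 h0).congr_deriv ?_
    rw [radial]
    field_simp
  · have := hasDerivAt_radialMomentum hD.smooth h1 h2 h0
      (hD.Γ_pos ⟨hn, hlt a ⟨ha.1.le, ha.2.le⟩⟩) ha.1 (hsol.ode a ha')
    rwa [hL] at this

theorem radialForce_zero_right (h0 : Γ 0 = 0) (a : ℝ) : radialForce Γ k b c μ 0 a 0 = 0 := by
  rw [radialForce, redForce_zero_zero h0, h0]; ring

theorem IsLocalProfile.continuousOn_norm (h : IsLocalProfile s₀ Γ k b c μ a₁ δ s₁ W) :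
    ContinuousOn (fun a => ‖W a‖) (Icc 0 a₁) := by
  obtain ⟨⟨A, hA, hsol⟩, -⟩ := h
  exact (hsol.continuousOn.mono fun x hx => ⟨hx.1, hx.2.trans_lt hA⟩).norm

/-- Maximum principle for `‖W‖` against the zero solution. Differentiability is needed only where
`‖W‖ > 0`, so the singularity of the norm is harmless. -/
theorem IsLocalProfile.eq_zero_of_le (hD : IsSmallDisc Γ k b c μ a₁ δ)
    (h : IsLocalProfile s₀ Γ k b c μ a₁ δ s₁ W) {T : ℝ} (hT : T ∈ Icc 0 a₁) (h0 : W T = 0) :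
    ∀ a ∈ Icc 0 T, W a = 0 := by
  intro a ha
  refine norm_le_zero_iff.1 (nonpos_of_convex_where_pos (w := fun a => ‖W a‖)
    (w₁ := fun a => a * radial W a / ‖W a‖)
    (h.continuousOn_norm.mono (Icc_subset_Icc_right hT.2)) h.2.1.le (by simp [h0])
    (fun x hx hpos => ⟨?_, _, ?_, (h.hasDerivAt_norm hD ⟨hx.1, hx.2.trans_le hT.2⟩
      (norm_pos_iff.1 hpos)).2⟩) a ha)
  · have hx' : x ∈ Ioo 0 a₁ := ⟨hx.1, hx.2.trans_le hT.2⟩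
    have hc : ContinuousAt (fun a => ‖W a‖) x :=
      (h.hasDerivAt_norm hD hx' (norm_pos_iff.1 hpos)).1.continuousAt
    filter_upwards [isOpen_Ioo.mem_nhds hx', hc.eventually_const_lt hpos] with y hy hy0
    exact (h.hasDerivAt_norm hD hy (norm_pos_iff.1 hy0)).1
  · have hx' : x ∈ Ioo 0 a₁ := ⟨hx.1, hx.2.trans_le hT.2⟩
    have := hD.force_lt x hx' ‖W x‖ 0 le_rfl hpos (h.2.2.2 x ⟨hx'.1.le, hx'.2.le⟩)
    rw [radialForce_zero_right hD.zero] at this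
    exact div_pos this hx.1

theorem abs_radial_le (W : ℝ → Plane) (a : ℝ) : |radial W a| ≤ ‖W a‖ * ‖deriv W a‖ := by
  have := abs_real_inner_le_norm (W a) (deriv W a)
  rw [PiLp.inner_apply, Fin.sum_univ_two] at this
  simp only [RCLike.inner_apply, conj_trivial] at this
  rw [radial]
  convert this using 2
  ring

/-- Take the last zero `t`, which precedes `a₁` since `s₁ > 0`. The curve vanishes before `t`, so
its velocity vanishes at `t`, and `(‖W‖, P)` tends to zero as `x → t+`. The force is at most linear
in `‖W‖`, so Gronwall gives zero beyond `t` as well, a contradiction. -/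
theorem IsLocalProfile.ne_zero (hD : IsSmallDisc Γ k b c μ a₁ δ) (hs₁ : 0 < s₁)
    (h : IsLocalProfile s₀ Γ k b c μ a₁ δ s₁ W) : ∀ a ∈ Ioo 0 a₁, W a ≠ 0 := by
  intro a₀ ha₀ hz
  have hcont := h.continuousOn_norm
  obtain ⟨t, ⟨ht, htz⟩, htmax⟩ : ∃ t, IsGreatest {a | a ∈ Icc a₀ a₁ ∧ ‖W a‖ = 0} t := by
    refine IsCompact.exists_isGreatest ?_ ⟨a₀, ⟨le_rfl, ha₀.2.le⟩, by simp [hz]⟩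
    have h1 : IsClosed (Icc a₀ a₁ ∩ (fun a => ‖W a‖) ⁻¹' {0}) :=
      (hcont.mono (Icc_subset_Icc_left ha₀.1.le)).preimage_isClosed_of_isClosed isClosed_Icc
        isClosed_singleton
    exact isCompact_Icc.of_isClosed_subset h1 inter_subset_left
  have ht0 : 0 < t := ha₀.1.trans_le ht.1
  have hta : t < a₁ := ht.2.lt_of_ne fun he => by
    rw [he, h.2.2.1] at htz; exact hs₁.ne' htz
  have hleft := h.eq_zero_of_le hD ⟨ht0.le, ht.2⟩ (norm_eq_zero.1 htz)
  have hne : ∀ x ∈ Ioo t a₁, W x ≠ 0 := fun x hx hx0 =>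
    (htmax ⟨⟨ht.1.trans hx.1.le, hx.2.le⟩, by simp [hx0]⟩).not_gt hx.1
  obtain ⟨A, hA, hsol⟩ := h.1
  obtain ⟨h1, h2⟩ := hsol.hasDerivAt (show t ∈ Ioo 0 A from ⟨ht0, hta.trans hA⟩)
  have hv : deriv W t = 0 := by
    have e1 : HasDerivWithinAt W 0 (Iic t) t := by
      refine (hasDerivWithinAt_const t (Iic t) (0 : Plane)).congr_of_eventuallyEq ?_
        (norm_eq_zero.1 htz)
      filter_upwards [Ioc_mem_nhdsLE ht0] with x hx using hleft x ⟨hx.1.le, hx.2⟩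
    exact (uniqueDiffWithinAt_Iic t).eq_deriv _ h1.hasDerivWithinAt e1
  obtain ⟨K, hK⟩ := hD.force_le
  set P : ℝ → ℝ := fun a => a * radial W a / ‖W a‖ with hP
  have hPle : ∀ x, 0 < x → ‖P x‖ ≤ x * ‖deriv W x‖ := by
    intro x hx
    rw [hP, Real.norm_eq_abs, abs_div, abs_mul, abs_of_pos hx, abs_norm]
    refine div_le_of_le_mul₀ (norm_nonneg _) (by positivity) ?_
    calc x * |radial W x| ≤ x * (‖W x‖ * ‖deriv W x‖) := by gcongr; exact abs_radial_le W x
      _ = _ := by ring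
  have hlim : Tendsto (fun x => ‖((‖W x‖, P x) : ℝ × ℝ)‖) (𝓝[>] t) (𝓝 0) := by
    have e1 : Tendsto (fun x => ‖W x‖) (𝓝 t) (𝓝 0) := by
      simpa [htz] using h1.continuousAt.norm.tendsto
    have e2 : Tendsto (fun x => x * ‖deriv W x‖) (𝓝 t) (𝓝 0) := by
      simpa [hv] using (continuousAt_id (x := t)).tendsto.mul h2.continuousAt.norm.tendsto
    refine squeeze_zero' (Eventually.of_forall fun x => norm_nonneg _) ?_
      ((show Tendsto (fun x => ‖W x‖ + x * ‖deriv W x‖) (𝓝 t) (𝓝 0) by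
        simpa using e1.add e2).mono_left nhdsWithin_le_nhds)
    filter_upwards [self_mem_nhdsWithin] with x hx
    have hx0 : 0 < x := ht0.trans hx
    rw [Prod.norm_mk, norm_norm]
    refine max_le ?_ ((hPle x hx0).trans ?_)
    · have : 0 ≤ x * ‖deriv W x‖ := by positivity
      linarith
    · linarith [norm_nonneg (W x)]
  set x₁ := (t + a₁) / 2 with hx₁
  have hx₁m : x₁ ∈ Ioo t a₁ := ⟨by linarith, by linarith⟩
  -- Gronwall constant of the system for `(‖W‖, P)`: the factor `1 / y` is at most `1 / t` to the
  -- right of `t`. The initial point `x` will tend to `t` while `x₁` stays fixed.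
  set M := (1 + |K|) / t with hM
  have hM0 : 0 ≤ M := by positivity
  have hbound : ∀ x ∈ Ioo t x₁, ‖((‖W x₁‖, P x₁) : ℝ × ℝ)‖
      ≤ ‖((‖W x‖, P x) : ℝ × ℝ)‖ * Real.exp (M * (x₁ - t)) := by
    intro x hx
    have hin : ∀ y ∈ Icc x x₁, y ∈ Ioo 0 a₁ ∧ W y ≠ 0 := fun y hy =>
      ⟨⟨ht0.trans (hx.1.trans_le hy.1), hy.2.trans_lt hx₁m.2⟩,
        hne y ⟨hx.1.trans_le hy.1, hy.2.trans_lt hx₁m.2⟩⟩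
    have hder : ∀ y ∈ Icc x x₁, HasDerivAt (fun y => ((‖W y‖, P y) : ℝ × ℝ))
        (P y / y, radialForce Γ k b c μ 0 y ‖W y‖ / y) y := fun y hy =>
      (h.hasDerivAt_norm hD (hin y hy).1 (hin y hy).2).1.prodMk
        (h.hasDerivAt_norm hD (hin y hy).1 (hin y hy).2).2
    have hg := norm_le_gronwallBound_of_norm_deriv_right_le (K := M) (ε := 0)
      (fun y hy => (hder y hy).continuousAt.continuousWithinAt)
      (fun y hy => (hder y ⟨hy.1, hy.2.le⟩).hasDerivWithinAt) le_rfl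
      (fun y hy => by
        have hy' : y ∈ Icc x x₁ := ⟨hy.1, hy.2.le⟩
        have hty : t ≤ y := hx.1.le.trans hy.1
        have hy0 : 0 < y := ht0.trans_le hty
        have hWy := norm_pos_iff.2 (hin y hy').2
        have hf := hK y (hin y hy').1 ‖W y‖ ⟨hWy,
          h.2.2.2 y ⟨(hin y hy').1.1.le, (hin y hy').1.2.le⟩⟩
        have n1 : ‖W y‖ ≤ ‖((‖W y‖, P y) : ℝ × ℝ)‖ := by
          rw [Prod.norm_mk, norm_norm]; exact le_max_left _ _
        have n2 : ‖P y‖ ≤ ‖((‖W y‖, P y) : ℝ × ℝ)‖ := by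
          rw [Prod.norm_mk]; exact le_max_right _ _
        have n0 : 0 ≤ ‖((‖W y‖, P y) : ℝ × ℝ)‖ := norm_nonneg _
        rw [add_zero, hM, div_mul_eq_mul_div, Prod.norm_mk, norm_div (P y) y,
          norm_div (radialForce Γ k b c μ 0 y ‖W y‖) y,
          Real.norm_eq_abs y, abs_of_pos hy0]
        refine max_le ?_ ?_
        · refine div_le_div₀ (by positivity) ?_ ht0 hty
          nlinarith [abs_nonneg K]
        · refine div_le_div₀ (by positivity) ?_ ht0 hty
          rw [Real.norm_eq_abs]
          calc _ ≤ K * ‖W y‖ := hf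
            _ ≤ |K| * ‖W y‖ := by gcongr; exact le_abs_self K
            _ ≤ (1 + |K|) * ‖((‖W y‖, P y) : ℝ × ℝ)‖ := by
              gcongr
              linarith) x₁ ⟨hx.2.le, le_rfl⟩
    rw [gronwallBound_ε0] at hg
    refine hg.trans ?_
    have : x₁ - x ≤ x₁ - t := by linarith [hx.1]
    gcongr
  have hle : ‖((‖W x₁‖, P x₁) : ℝ × ℝ)‖ ≤ 0 := by
    have := hlim.mul_const (Real.exp (M * (x₁ - t)))
    rw [zero_mul] at this
    refine ge_of_tendsto this ?_
    filter_upwards [Ioo_mem_nhdsGT hx₁m.1] with x hx using hbound x hx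
  have h3 : ‖W x₁‖ ≤ 0 := by
    rw [Prod.norm_mk, norm_norm] at hle
    exact (le_max_left _ _).trans hle
  exact hne x₁ hx₁m (norm_le_zero_iff.1 h3)

theorem IsLocalProfile.reduced (hD : IsSmallDisc Γ k b c μ a₁ δ) (hs₁ : 0 < s₁)
    (h : IsLocalProfile s₀ Γ k b c μ a₁ δ s₁ W) :
    IsReducedSolution (radialForce Γ k b c μ 0) a₁ δ (fun a => ‖W a‖)
      (fun a => a * radial W a / ‖W a‖) :=
  ⟨h.continuousOn_norm, h.2.1, fun a ha => ⟨norm_pos_iff.2 (h.ne_zero hD hs₁ a ha),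
    h.2.2.2 a ⟨ha.1.le, ha.2.le⟩⟩, fun a ha => (h.hasDerivAt_norm hD ha (h.ne_zero hD hs₁ a ha)).1,
    fun a ha => (h.hasDerivAt_norm hD ha (h.ne_zero hD hs₁ a ha)).2⟩

/-- Two curves with the same Euclidean norm, radial momentum and angular momentum differ by a
rotation. -/
theorem exists_rot_of_momenta_eq {V : ℝ → Plane} {T : ℝ}
    (hW : ∀ a ∈ Ioo 0 T, HasDerivAt W (deriv W a) a)
    (hV : ∀ a ∈ Ioo 0 T, HasDerivAt V (deriv V a) a) (h0 : ∀ a ∈ Ioo 0 T, W a ≠ 0)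
    (hn : ∀ a ∈ Ioo 0 T, ‖V a‖ = ‖W a‖) (hr : ∀ a ∈ Ioo 0 T, radial V a = radial W a)
    (hc : ∀ a ∈ Ioo 0 T, cross V a = cross W a) :
    ∃ θ, ∀ a ∈ Ioo 0 T, V a = rot θ (W a) := by
  have hsq : ∀ a ∈ Ioo 0 T, V a 0 ^ 2 + V a 1 ^ 2 = W a 0 ^ 2 + W a 1 ^ 2 := fun a ha => by
    rw [← norm_sq_plane, ← norm_sq_plane, hn a ha]
  have hpos : ∀ a ∈ Ioo 0 T, 0 < W a 0 ^ 2 + W a 1 ^ 2 := fun a ha => by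
    have := norm_pos_iff.2 (h0 a ha)
    rw [← norm_sq_plane]; positivity
  have hvel : ∀ (U : ℝ → Plane) (a : ℝ),
      (U a 0 ^ 2 + U a 1 ^ 2) * deriv U a 0 = radial U a * U a 0 - cross U a * U a 1 ∧
      (U a 0 ^ 2 + U a 1 ^ 2) * deriv U a 1 = radial U a * U a 1 + cross U a * U a 0 :=
    fun U a => by constructor <;> rw [radial, cross] <;> ring
  have key : ∀ a ∈ Ioo 0 T, HasDerivAt (fun a => W a 0 ^ 2 + W a 1 ^ 2) (2 * radial W a) a :=
    fun a ha => by
      refine (((hasDerivAt_coord (hW a ha) 0).pow 2).add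
        ((hasDerivAt_coord (hW a ha) 1).pow 2)).congr_deriv ?_
      rw [radial]; push_cast; ring
  -- These quotients are the cosine and sine of the angle from `W` to `V`; equal momenta mean equal
  -- angular velocities.
  have hder : ∀ a ∈ Ioo 0 T,
      HasDerivAt (fun a => (W a 0 * V a 0 + W a 1 * V a 1) / (W a 0 ^ 2 + W a 1 ^ 2)) 0 a ∧
      HasDerivAt (fun a => (W a 0 * V a 1 - W a 1 * V a 0) / (W a 0 ^ 2 + W a 1 ^ 2)) 0 a := by
    intro a ha
    have w0 := hasDerivAt_coord (hW a ha) 0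
    have w1 := hasDerivAt_coord (hW a ha) 1
    have v0 := hasDerivAt_coord (hV a ha) 0
    have v1 := hasDerivAt_coord (hV a ha) 1
    have hp := hpos a ha
    obtain ⟨p1, p2⟩ := hvel W a
    obtain ⟨q1, q2⟩ := hvel V a
    rw [hsq a ha, hr a ha, hc a ha] at q1 q2
    constructor
    · refine (((w0.mul v0).add (w1.mul v1)).div (key a ha) hp.ne').congr_deriv ?_
      rw [div_eq_zero_iff]
      left
      simp only [Pi.add_apply, Pi.mul_apply]
      linear_combination V a 0 * p1 + W a 0 * q1 + V a 1 * p2 + W a 1 * q2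
    · refine (((w0.mul v1).sub (w1.mul v0)).div (key a ha) hp.ne').congr_deriv ?_
      rw [div_eq_zero_iff]
      left
      simp only [Pi.sub_apply, Pi.mul_apply]
      linear_combination V a 1 * p1 + W a 0 * q2 - V a 0 * p2 - W a 1 * q1
  obtain ⟨C, hC⟩ := eqOn_of_hasDerivAt_zero fun a ha => (hder a ha).1
  obtain ⟨S, hS⟩ := eqOn_of_hasDerivAt_zero fun a ha => (hder a ha).2
  by_cases hT : 0 < T
  · have hh : T / 2 ∈ Ioo 0 T := ⟨by linarith, by linarith⟩
    have hCS : C ^ 2 + S ^ 2 = 1 := by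
      have hp := hpos _ hh
      have e := hsq _ hh
      rw [← hC _ hh, ← hS _ hh]
      field_simp
      linear_combination (W (T / 2) 0 ^ 2 + W (T / 2) 1 ^ 2) * e
    set z : ℂ := ⟨C, S⟩ with hz
    have hz1 : ‖z‖ = 1 := by
      rw [Complex.norm_def, Complex.normSq_mk, ← pow_two, ← pow_two, hCS, Real.sqrt_one]
    have hz0 : z ≠ 0 := by rw [← norm_ne_zero_iff, hz1]; exact one_ne_zero
    refine ⟨Complex.arg z, fun a ha => ?_⟩
    have hcos : Real.cos (Complex.arg z) = C := by rw [Complex.cos_arg hz0, hz1, div_one]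
    have hsin : Real.sin (Complex.arg z) = S := by rw [Complex.sin_arg, hz1, div_one]
    have hp := hpos a ha
    have e1 := hC a ha
    have e2 := hS a ha
    rw [div_eq_iff hp.ne'] at e1 e2
    ext i
    fin_cases i
    · simp only [rot, hcos, hsin]
      refine mul_left_cancel₀ hp.ne' ?_
      change _ * V a 0 = _ * (C * W a 0 - S * W a 1)
      linear_combination W a 0 * e1 - W a 1 * e2
    · simp only [rot, hcos, hsin]
      refine mul_left_cancel₀ hp.ne' ?_
      change _ * V a 1 = _ * (S * W a 0 + C * W a 1)
      linear_combination W a 1 * e1 + W a 0 * e2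
  · exact ⟨0, fun a ha => absurd (ha.1.trans ha.2) hT⟩

theorem rot_zero_right (θ : ℝ) : rot θ 0 = 0 := by
  ext i; fin_cases i <;> simp [rot]

theorem continuous_rot (θ : ℝ) : Continuous (rot θ) := by
  refine (PiLp.continuous_toLp 2 _).comp (continuous_pi fun i => ?_)
  fin_cases i <;> simp <;> fun_prop

/-- The radial parts agree by the maximum principle, and zero angular momentum fixes the cross
product, so the curves differ by a rotation. For `s₁ = 0` both curves vanish identically. -/
theorem IsLocalProfile.unique (hD : IsSmallDisc Γ k b c μ a₁ δ) (hs₁ : 0 ≤ s₁) {V : ℝ → Plane}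
    (h : IsLocalProfile s₀ Γ k b c μ a₁ δ s₁ W) (h' : IsLocalProfile s₀ Γ k b c μ a₁ δ s₁ V) :
    ∃ θ : ℝ, ∀ a ∈ Icc 0 a₁, V a = rot θ (W a) := by
  have hpos := hD.pos
  rcases hs₁.eq_or_lt with h0 | hs₁
  · subst h0
    have hm : a₁ ∈ Icc 0 a₁ := ⟨hpos.le, le_rfl⟩
    refine ⟨0, fun a ha => ?_⟩
    rw [h.eq_zero_of_le hD hm (norm_eq_zero.1 h.2.2.1) a ha,
      h'.eq_zero_of_le hD hm (norm_eq_zero.1 h'.2.2.1) a ha, rot_zero_right]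
  have hR := h.reduced hD hs₁
  have hR' := h'.reduced hD hs₁
  obtain ⟨hss, hPP⟩ := hR'.eqOn hR hD.force_lt (by simp only [h.2.2.1, h'.2.2.1])
  have hδ : 0 < δ := (norm_nonneg _).trans_lt (h.2.2.2 a₁ ⟨hpos.le, le_rfl⟩)
  have hL := h.angMomentum_eq_zero hD hδ
  have hL' := h'.angMomentum_eq_zero hD hδ
  have hne := h.ne_zero hD hs₁
  obtain ⟨A, hA, hsol⟩ := h.1
  obtain ⟨A', hA', hsol'⟩ := h'.1
  have hn : ∀ a ∈ Ioo 0 a₁, ‖V a‖ = ‖W a‖ := fun a ha => hss ⟨ha.1.le, ha.2.le⟩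
  obtain ⟨θ, hθ⟩ := exists_rot_of_momenta_eq (W := W) (V := V) (T := a₁)
    (fun a ha => (hsol.hasDerivAt ⟨ha.1, ha.2.trans hA⟩).1)
    (fun a ha => (hsol'.hasDerivAt ⟨ha.1, ha.2.trans hA'⟩).1) hne hn
    (fun a ha => by
      have e := hPP ha
      have := norm_pos_iff.2 (hne a ha)
      have := ha.1
      simp only [hn a ha] at e
      field_simp at e
      exact e)
    (fun a ha => by
      have e1 := hL a ha
      have e2 := hL' a ha
      rw [angMomentum] at e1 e2
      rw [hn a ha] at e2
      have := norm_pos_iff.2 (hne a ha)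
      have := hD.Γ_pos (hR.mem a ha)
      have := ha.1
      refine mul_left_cancel₀ (a := a * (Γ ‖W a‖ / ‖W a‖) ^ 2) (by positivity) ?_
      linear_combination e2 - e1)
  have hend := eqOn_Ioc_of_eqOn_Ioo (f := V) (g := fun a => rot θ (W a)) hθ
    (hsol'.hasDerivAt ⟨hpos, hA'⟩).1.continuousAt
    ((continuous_rot θ).continuousAt.comp' (hsol.hasDerivAt ⟨hpos, hA⟩).1.continuousAt)
  refine ⟨θ, fun a ha => ?_⟩
  rcases ha.1.eq_or_lt with h1 | h1
  · subst h1
    rw [norm_eq_zero.1 h.2.1, norm_eq_zero.1 h'.2.1, rot_zero_right]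
  · exact hend ⟨h1, ha.2⟩

end ProfileUniqueness

section PolarExistence

/-! ### Existence for the polar system -/

/-- A positive solution of the reduced equation on `(0, A)` which tends to the center at the rate
`a ^ κ`. -/
structure IsUnstableSolution (Γ : ℝ → ℝ) (k b c μ κ ρ A C : ℝ) (s P : ℝ → ℝ) : Prop where
  smooth : ContDiff ℝ ∞ Γ
  Γ_zero : Γ 0 = 0
  deriv_bounds : ∀ s, |s| ≤ ρ → 1 / 2 ≤ deriv Γ s ∧ deriv Γ s ≤ 2
  κ_pos : 0 < κ
  A_pos : 0 < A
  continuous : Continuous s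
  zero : s 0 = 0
  pos : ∀ a ∈ Ioo 0 A, 0 < s a
  le_radius : ∀ a ∈ Ioo 0 A, s a ≤ ρ
  le_rpow : ∀ a ∈ Ioo 0 A, s a ≤ C * a ^ κ
  P_pos : ∀ a ∈ Ioo 0 A, 0 < P a
  P_le : ∀ a ∈ Ioo 0 A, P a ≤ 2 * κ * s a
  deriv_s : ∀ a ∈ Ioo 0 A, HasDerivAt s (P a / a) a
  deriv_P : ∀ a ∈ Ioo 0 A, HasDerivAt P (radialForce Γ k b c μ 0 a (s a) / a) a

namespace IsUnstableSolution

variable {Γ : ℝ → ℝ} {k b c μ κ ρ A C : ℝ} {s P : ℝ → ℝ}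

theorem Γ_pos (h : IsUnstableSolution Γ k b c μ κ ρ A C s P) {a : ℝ} (ha : a ∈ Ioo 0 A) :
    0 < Γ (s a) := by
  have := half_le_of_deriv_bounds h.smooth h.Γ_zero h.deriv_bounds (h.pos a ha) (h.le_radius a ha)
  linarith [h.pos a ha]

theorem strictMonoOn (h : IsUnstableSolution Γ k b c μ κ ρ A C s P) :
    StrictMonoOn s (Ico 0 A) := by
  refine strictMonoOn_of_deriv_pos (convex_Ico 0 A) h.continuous.continuousOn fun a ha => ?_
  rw [interior_Ico] at ha
  rw [(h.deriv_s a ha).deriv]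
  exact div_pos (h.P_pos a ha) ha.1

theorem abs_potF_div_le (h : IsUnstableSolution Γ k b c μ κ ρ A C s P) {a : ℝ}
    (ha : a ∈ Ioo 0 A) : |c * potF Γ (s a) / Γ (s a)| ≤ 4 * |c| * s a := by
  have h1 := half_le_of_deriv_bounds h.smooth h.Γ_zero h.deriv_bounds (h.pos a ha)
    (h.le_radius a ha)
  have h2 := abs_potF_le_of_deriv_bounds h.smooth h.Γ_zero h.deriv_bounds (h.pos a ha).le
    (h.le_radius a ha)
  have hs := h.pos a ha
  have hg := h.Γ_pos ha
  rw [abs_div, abs_mul, abs_of_pos hg, div_le_iff₀ hg]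
  calc |c| * |potF Γ (s a)| ≤ |c| * (2 * s a ^ 2) := by gcongr
    _ = 4 * |c| * s a * (s a / 2) := by ring
    _ ≤ _ := by gcongr

theorem sqrt_le (h : IsUnstableSolution Γ k b c μ κ ρ A C s P) {a : ℝ} (ha : a ∈ Ioo 0 A) :
    √(P a ^ 2 + (c * potF Γ (s a) / Γ (s a)) ^ 2) ≤ (2 * κ + 4 * |c|) * C * a ^ κ := by
  have h1 := h.abs_potF_div_le ha
  have h2 := h.P_le a ha
  have h3 := h.P_pos a ha
  have hs := h.pos a ha
  have hκ := h.κ_pos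
  calc _ ≤ P a + |c * potF Γ (s a) / Γ (s a)| := by
        refine Real.sqrt_le_iff.2 ⟨by positivity, ?_⟩
        rw [← sq_abs (c * potF Γ (s a) / Γ (s a))]
        nlinarith [abs_nonneg (c * potF Γ (s a) / Γ (s a))]
    _ ≤ (2 * κ + 4 * |c|) * s a := by linarith
    _ ≤ (2 * κ + 4 * |c|) * (C * a ^ κ) := by
        have := h.le_rpow a ha
        gcongr
    _ = _ := by ring

theorem isBigO_s (h : IsUnstableSolution Γ k b c μ κ ρ A C s P) :
    s =O[𝓝[>] 0] fun a : ℝ => a ^ κ := by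
  refine IsBigO.of_bound C ?_
  filter_upwards [Ioo_mem_nhdsGT h.A_pos] with a ha
  rw [Real.norm_eq_abs, Real.norm_eq_abs, abs_of_pos (h.pos a ha),
    abs_of_nonneg (Real.rpow_nonneg ha.1.le κ)]
  exact h.le_rpow a ha

theorem isBigO_speed (h : IsUnstableSolution Γ k b c μ κ ρ A C s P) {f : ℝ → ℝ}
    (hf : ∀ a ∈ Ioo 0 A, f a = √(P a ^ 2 + (c * potF Γ (s a) / Γ (s a)) ^ 2) / a) :
    f =O[𝓝[>] 0] fun a : ℝ => a ^ (κ - 1) := by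
  refine IsBigO.of_bound ((2 * κ + 4 * |c|) * C) ?_
  filter_upwards [Ioo_mem_nhdsGT h.A_pos] with a ha
  have ha0 := ha.1
  rw [hf a ha, Real.norm_eq_abs, Real.norm_eq_abs, abs_of_nonneg (by positivity),
    abs_of_nonneg (Real.rpow_nonneg ha0.le _), Real.rpow_sub_one ha0.ne', ← mul_div_assoc]
  gcongr
  exact h.sqrt_le ha

/-- `X = r cos γ` comes from `P = r Γ cos γ`, and `Y = r sin γ` from zero angular momentum. Since `P
> 0` gives `X > 0`, the arctangent is a smooth choice of `γ`. -/
theorem exists_localPolar (h : IsUnstableSolution Γ k b c μ κ ρ A C s P) {a₁ δ s₁ : ℝ}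
    (ha₁ : 0 < a₁) (hA : a₁ < A) (hs₁ : s a₁ = s₁) (hδ : s₁ < δ) :
    ∃ r γ : ℝ → ℝ, IsLocalPolar Γ k b c μ a₁ δ s₁ s r γ ∧
      (fun a => r a * Γ (s a) / a) =O[𝓝[>] 0] fun a : ℝ => a ^ (κ - 1) := by
  let X : ℝ → ℝ := fun a => P a / Γ (s a)
  let Y : ℝ → ℝ := fun a => -(c * potF Γ (s a) / Γ (s a) ^ 2)
  let r : ℝ → ℝ := fun a => √(X a ^ 2 + Y a ^ 2)
  let γ : ℝ → ℝ := fun a => Real.arctan (Y a / X a)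
  have hX0 : ∀ a ∈ Ioo 0 A, 0 < X a := fun a ha => div_pos (h.P_pos a ha) (h.Γ_pos ha)
  have hr0 : ∀ a ∈ Ioo 0 A, 0 < r a := fun a ha => by
    have := hX0 a ha
    exact Real.sqrt_pos.2 (by positivity)
  have hr2 : ∀ a, r a ^ 2 = X a ^ 2 + Y a ^ 2 := fun a => Real.sq_sqrt (by positivity)
  have hrX : ∀ a ∈ Ioo 0 A, √(1 + (Y a / X a) ^ 2) = r a / X a := fun a ha => by
    have hx := hX0 a ha
    have : 1 + (Y a / X a) ^ 2 = (X a ^ 2 + Y a ^ 2) / X a ^ 2 := by field_simp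
    rw [this, Real.sqrt_div (by positivity), Real.sqrt_sq hx.le]
  have hcos : ∀ a ∈ Ioo 0 A, Real.cos (γ a) = X a / r a := fun a ha => by
    have hx := hX0 a ha
    rw [Real.cos_arctan, hrX a ha, one_div_div]
  have hsin : ∀ a ∈ Ioo 0 A, Real.sin (γ a) = Y a / r a := fun a ha => by
    have hx := hX0 a ha
    rw [Real.sin_arctan, hrX a ha]
    field_simp
  have hΓs : ∀ a ∈ Ioo 0 A, HasDerivAt (fun a => Γ (s a)) (deriv Γ (s a) * (P a / a)) a :=
    fun a ha => (hasDerivAt_self h.smooth (s a)).comp a (h.deriv_s a ha)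
  have hX : ∀ a ∈ Ioo 0 A, HasDerivAt X ((deriv Γ (s a) * Y a ^ 2 + c * Y a
      - potGDeriv Γ k b (s a) / Γ (s a) + μ * a ^ 2 - deriv Γ (s a) * X a ^ 2) / a) a := by
    intro a ha
    have hg := h.Γ_pos ha
    have ha0 := ha.1
    refine ((h.deriv_P a ha).div (hΓs a ha) hg.ne').congr_deriv ?_
    simp only [X, Y, radialForce, redForce]
    field_simp
    ring
  have hY : ∀ a ∈ Ioo 0 A, HasDerivAt Y ((-(c * X a) - 2 * deriv Γ (s a) * Y a * X a) / a) a := by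
    intro a ha
    have hg := h.Γ_pos ha
    have ha0 := ha.1
    have hF := (hasDerivAt_potF h.smooth.continuous (s a)).comp a (h.deriv_s a ha)
    refine (((hF.const_mul c).div ((hΓs a ha).pow 2) (pow_ne_zero 2 hg.ne')).neg).congr_deriv ?_
    simp only [X, Y, Function.comp_apply, Pi.pow_apply]
    push_cast
    field_simp
    ring
  refine ⟨r, γ, ⟨⟨A, hA, h.continuous.continuousOn, hr0, ?_, ?_, ?_⟩, h.zero, hs₁, ?_⟩, ?_⟩
  · intro a ha
    have hg := h.Γ_pos ha
    have hr := hr0 a ha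
    have ha0 := ha.1
    refine (h.deriv_s a ha).congr_deriv ?_
    rw [hcos a ha]
    simp only [X]
    field_simp
  · intro a ha
    have hg := h.Γ_pos ha
    have hr := hr0 a ha
    have hx := hX0 a ha
    have ha0 := ha.1
    refine ((((hX a ha).pow 2).add ((hY a ha).pow 2)).sqrt (by
      simp only [Pi.add_apply, Pi.pow_apply]; positivity)).congr_deriv ?_
    simp only [Pi.add_apply, Pi.pow_apply]
    change _ / (2 * r a) = _
    rw [hcos a ha, deriv_potG h.smooth, hr2]
    push_cast
    field_simp
    ring
  · intro a ha
    have hg := h.Γ_pos ha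
    have hr := hr0 a ha
    have hx := hX0 a ha
    have ha0 := ha.1
    refine (((hY a ha).div (hX a ha) hx.ne').arctan).congr_deriv ?_
    have e : 1 + (Y a / X a) ^ 2 = r a ^ 2 / X a ^ 2 := by rw [hr2]; field_simp
    simp only [Pi.div_apply]
    rw [e, hsin a ha, deriv_potG h.smooth]
    field_simp
    rw [hr2]
    ring
  · intro a ha
    have h1 := h.strictMonoOn.monotoneOn ⟨ha.1, ha.2.trans_lt hA⟩ ⟨ha₁.le, hA⟩ ha.2
    have h2 := h.strictMonoOn.monotoneOn ⟨le_rfl, ha₁.trans hA⟩ ⟨ha.1, ha.2.trans_lt hA⟩ ha.1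
    rw [h.zero] at h2
    rw [abs_of_nonneg h2]
    linarith
  · refine h.isBigO_speed fun a ha => ?_
    have hg := h.Γ_pos ha
    congr 1
    rw [← Real.sqrt_sq hg.le, ← Real.sqrt_mul (by positivity), Real.sqrt_sq hg.le]
    congr 1
    simp only [X, Y]
    field_simp

end IsUnstableSolution

end PolarExistence

section ProfileExistence

/-! ### Existence of profile curves -/

theorem contDiffOn_succ_of_hasDerivAt {f f' : ℝ → ℝ} {S : Set ℝ} {n : ℕ} (hS : IsOpen S)
    (hf : ∀ a ∈ S, HasDerivAt f (f' a) a) (hf' : ContDiffOn ℝ n f' S) :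
    ContDiffOn ℝ (n + 1) f S :=
  (contDiffOn_succ_iff_deriv_of_isOpen hS).2
    ⟨fun a ha => (hf a ha).differentiableAt.differentiableWithinAt, fun h => by simp at h,
      hf'.congr fun a ha => (hf a ha).deriv⟩

theorem riemNorm_eq {Γ : ℝ → ℝ} {W : ℝ → Plane} {a : ℝ} (h0 : W a ≠ 0) :
    riemNorm Γ (W a) (deriv W a) = √((radial W a / ‖W a‖) ^ 2
      + (cross W a * (Γ ‖W a‖ / ‖W a‖) / ‖W a‖) ^ 2) := by
  have hn := norm_pos_iff.2 h0
  have hsq := norm_sq_plane (W a)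
  rw [riemNorm]
  congr 1
  have h1 : ∑ i, ∑ j, metric Γ (W a) i j * deriv W a i * deriv W a j
      = deriv W a 0 ^ 2 + deriv W a 1 ^ 2 + metricCoeff Γ ‖W a‖ * cross W a ^ 2 := by
    simp [Fin.sum_univ_two, metric_eq, perp, cross]
    ring
  have h2 : deriv W a 0 ^ 2 + deriv W a 1 ^ 2 = (radial W a ^ 2 + cross W a ^ 2) / ‖W a‖ ^ 2 := by
    rw [eq_div_iff (by positivity), hsq, radial, cross]
    ring
  rw [h1, h2, metricCoeff]
  field_simp
  ring

namespace IsUnstableSolution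

variable {Γ : ℝ → ℝ} {k b c μ κ ρ A C : ℝ} {s P : ℝ → ℝ}

theorem contDiffOn_s (h : IsUnstableSolution Γ k b c μ κ ρ A C s P) :
    ContDiffOn ℝ 2 s (Ioo 0 A) := by
  have hP : ContDiffOn ℝ ((0 : ℕ) + 1) P (Ioo 0 A) := by
    refine contDiffOn_succ_of_hasDerivAt isOpen_Ioo h.deriv_P ?_
    rw [Nat.cast_zero, contDiffOn_zero]
    intro a ha
    have h1 : ContinuousAt (fun a => redForce Γ k b c 0 (s a)) a :=
      (hasDerivAt_redForce h.smooth k b c (h.Γ_pos ha).ne').continuousAt.comp'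
        h.continuous.continuousAt
    have h2 : ContinuousAt (fun a => Γ (s a)) a :=
      h.smooth.continuous.continuousAt.comp' h.continuous.continuousAt
    have h3 : ContinuousAt (fun a : ℝ => μ * a ^ 2) a := by fun_prop
    exact ((h1.add (h3.mul h2)).div continuousAt_id ha.1.ne').continuousWithinAt
  have hs : ContDiffOn ℝ ((1 : ℕ) + 1) s (Ioo 0 A) := by
    refine contDiffOn_succ_of_hasDerivAt isOpen_Ioo h.deriv_s ?_
    refine ContDiffOn.div (by simpa using hP) contDiffOn_id fun a ha => ha.1.ne'
  simpa [one_add_one_eq_two] using hs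

/-- Zero angular momentum prescribes `β_a`. Integration starts at an interior point, since the
integrand behaves like `-c / (2 a)` at `0`; the curve may spiral into the center. -/
theorem exists_angle (h : IsUnstableSolution Γ k b c μ κ ρ A C s P) :
    ∃ β : ℝ → ℝ, ContDiffOn ℝ 2 β (Ioo 0 A) ∧
      ∀ a ∈ Ioo 0 A, HasDerivAt β (-(c * potF Γ (s a) / (a * Γ (s a) ^ 2))) a := by
  set v : ℝ → ℝ := fun a => -(c * potF Γ (s a) / (a * Γ (s a) ^ 2)) with hv
  have hsc : ContDiffOn ℝ (1 : ℕ) s (Ioo 0 A) := h.contDiffOn_s.of_le (by norm_num)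
  have hvc : ContDiffOn ℝ (1 : ℕ) v (Ioo 0 A) := by
    have hF : ContDiffOn ℝ (1 : ℕ) (fun a => potF Γ (s a)) (Ioo 0 A) :=
      ((contDiff_potF h.smooth).of_le (by exact_mod_cast le_top)).comp_contDiffOn hsc
    have hG : ContDiffOn ℝ (1 : ℕ) (fun a => Γ (s a)) (Ioo 0 A) :=
      (h.smooth.of_le (by exact_mod_cast le_top)).comp_contDiffOn hsc
    refine ((contDiffOn_const.mul hF).div (contDiffOn_id.mul (hG.pow 2)) fun a ha => ?_).neg
    have := h.Γ_pos ha
    have := ha.1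
    simp only [id]
    positivity
  have hA := h.A_pos
  have hmid : A / 2 ∈ Ioo 0 A := ⟨by linarith, by linarith⟩
  have hβ : ∀ a ∈ Ioo 0 A, HasDerivAt (fun a => ∫ x in (A / 2)..a, v x) (v a) a := by
    intro a ha
    refine intervalIntegral.integral_hasDerivAt_right ?_
      (hvc.continuousOn.stronglyMeasurableAtFilter isOpen_Ioo a ha)
      (hvc.continuousOn.continuousAt (isOpen_Ioo.mem_nhds ha))
    exact (hvc.continuousOn.mono (ordConnected_Ioo.uIcc_subset hmid ha)).intervalIntegrable
  refine ⟨_, ?_, hβ⟩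
  have := contDiffOn_succ_of_hasDerivAt isOpen_Ioo hβ hvc
  simpa [one_add_one_eq_two] using this

theorem exists_localProfile (h : IsUnstableSolution Γ k b c μ κ ρ A C s P) {a₁ δ s₁ : ℝ}
    {s₀ : ℝ≥0∞} (hs₀ : ENNReal.ofReal ρ < s₀)
    (ha₁ : 0 < a₁) (hA : a₁ < A) (hs₁ : s a₁ = s₁) (hδ : s₁ < δ) :
    ∃ W : ℝ → Plane, IsLocalProfile s₀ Γ k b c μ a₁ δ s₁ W ∧
      (fun a => ‖W a‖) =O[𝓝[>] 0] (fun a : ℝ => a ^ κ) ∧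
      (fun a => riemNorm Γ (W a) (deriv W a)) =O[𝓝[>] 0] fun a : ℝ => a ^ (κ - 1) := by
  obtain ⟨β, hβc, hβ⟩ := h.exists_angle
  let W : ℝ → Plane := fun a => !₂[s a * Real.cos (β a), s a * Real.sin (β a)]
  have hs_nonneg : ∀ a ∈ Ico 0 A, 0 ≤ s a := fun a ha => by
    rw [← h.zero]
    exact h.strictMonoOn.monotoneOn ⟨le_rfl, h.A_pos⟩ ha ha.1
  have hsq : ∀ a, ‖W a‖ ^ 2 = s a ^ 2 := fun a => by
    rw [norm_sq_plane]
    change (s a * Real.cos (β a)) ^ 2 + (s a * Real.sin (β a)) ^ 2 = s a ^ 2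
    linear_combination s a ^ 2 * Real.sin_sq_add_cos_sq (β a)
  have habs : ∀ a, ‖W a‖ = |s a| := fun a => by
    rw [← abs_norm, ← sq_eq_sq_iff_abs_eq_abs]
    exact hsq a
  have hnorm : ∀ a ∈ Ico 0 A, ‖W a‖ = s a := fun a ha => by
    rw [habs, abs_of_nonneg (hs_nonneg a ha)]
  have hIoo : ∀ a ∈ Ioo 0 A, ‖W a‖ = s a := fun a ha => hnorm a ⟨ha.1.le, ha.2⟩
  have hne : ∀ a ∈ Ioo 0 A, W a ≠ 0 := fun a ha => by
    rw [← norm_pos_iff, hIoo a ha]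
    exact h.pos a ha
  have hWc : ContDiffOn ℝ 2 W (Ioo 0 A) := by
    rw [contDiffOn_euclidean]
    intro i
    fin_cases i
    · exact h.contDiffOn_s.mul (Real.contDiff_cos.comp_contDiffOn hβc)
    · exact h.contDiffOn_s.mul (Real.contDiff_sin.comp_contDiffOn hβc)
  have hWd : ∀ a ∈ Ioo 0 A, HasDerivAt W (deriv W a) a ∧
      HasDerivAt (deriv W) (deriv (deriv W) a) a := by
    intro a ha
    have h1 := hWc
    rw [show (2 : WithTop ℕ∞) = 1 + 1 from rfl,
      contDiffOn_succ_iff_deriv_of_isOpen isOpen_Ioo] at h1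
    have hn := isOpen_Ioo.mem_nhds ha
    exact ⟨(h1.1.differentiableAt hn).hasDerivAt,
      ((h1.2.2.differentiableOn one_ne_zero).differentiableAt hn).hasDerivAt⟩
  have hv0 : ∀ a ∈ Ioo 0 A, deriv W a 0 = P a / a * Real.cos (β a)
      + s a * (-Real.sin (β a) * -(c * potF Γ (s a) / (a * Γ (s a) ^ 2))) := fun a ha =>
    (hasDerivAt_coord (hWd a ha).1 0).unique ((h.deriv_s a ha).mul (hβ a ha).cos)
  have hv1 : ∀ a ∈ Ioo 0 A, deriv W a 1 = P a / a * Real.sin (β a)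
      + s a * (Real.cos (β a) * -(c * potF Γ (s a) / (a * Γ (s a) ^ 2))) := fun a ha =>
    (hasDerivAt_coord (hWd a ha).1 1).unique ((h.deriv_s a ha).mul (hβ a ha).sin)
  have hW0 : ∀ a, W a 0 = s a * Real.cos (β a) := fun a => rfl
  have hW1 : ∀ a, W a 1 = s a * Real.sin (β a) := fun a => rfl
  have hrad : ∀ a ∈ Ioo 0 A, radial W a = P a * s a / a := by
    intro a ha
    rw [radial, hv0 a ha, hv1 a ha, hW0, hW1]
    linear_combination P a * s a / a * Real.sin_sq_add_cos_sq (β a)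
  have hcross : ∀ a ∈ Ioo 0 A,
      cross W a = -(c * potF Γ (s a) * s a ^ 2 / (a * Γ (s a) ^ 2)) := by
    intro a ha
    rw [cross, hv0 a ha, hv1 a ha, hW0, hW1]
    linear_combination -(c * potF Γ (s a) * s a ^ 2 / (a * Γ (s a) ^ 2))
      * Real.sin_sq_add_cos_sq (β a)
  -- Instead of differentiating the coordinates twice, `W · W_aa` and `W × W_aa` are read off from
  -- the derivatives of the known radial momentum and cross product.
  have hode : ∀ a ∈ Ioo 0 A,
      profileField Γ k b c μ a (W a) (deriv W a) (deriv (deriv W) a) = 0 := by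
    intro a ha
    have hg := h.Γ_pos ha
    have hs := h.pos a ha
    have ha0 := ha.1
    obtain ⟨hd1, hd2⟩ := hWd a ha
    have hgW : 0 < Γ ‖W a‖ := by rwa [hIoo a ha]
    have hnhds := isOpen_Ioo.mem_nhds ha
    have hΓs : HasDerivAt (fun a => Γ (s a)) (deriv Γ (s a) * (P a / a)) a :=
      (hasDerivAt_self h.smooth (s a)).comp a (h.deriv_s a ha)
    have hFs : HasDerivAt (fun a => potF Γ (s a)) (Γ (s a) * (P a / a)) a :=
      (hasDerivAt_potF h.smooth.continuous (s a)).comp a (h.deriv_s a ha)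
    have er : radial W =ᶠ[𝓝 a] fun a => P a * s a / a := by
      filter_upwards [hnhds] with x hx using hrad x hx
    have ec : cross W =ᶠ[𝓝 a] fun a => -(c * potF Γ (s a) * s a ^ 2 / (a * Γ (s a) ^ 2)) := by
      filter_upwards [hnhds] with x hx using hcross x hx
    have hr' := ((hasDerivAt_radial hd1 hd2).congr_of_eventuallyEq er.symm).unique
      (((h.deriv_P a ha).mul (h.deriv_s a ha)).div (hasDerivAt_id a) ha0.ne')
    have hc' := ((hasDerivAt_cross hd1 hd2).congr_of_eventuallyEq ec.symm).unique
      ((((hFs.const_mul c).mul ((h.deriv_s a ha).pow 2)).div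
        ((hasDerivAt_id a).mul (hΓs.pow 2)) (by simp only [Pi.mul_apply, Pi.pow_apply, id]
                                                positivity)).neg)
    have hvv : deriv W a 0 ^ 2 + deriv W a 1 ^ 2
        = (radial W a ^ 2 + cross W a ^ 2) / s a ^ 2 := by
      rw [eq_div_iff (by positivity), ← hIoo a ha, norm_sq_plane, radial, cross]
      ring
    rw [hvv, ← eq_sub_iff_add_eq', hrad a ha, hcross a ha] at hr'
    have hrW : W a 0 * deriv W a 0 + W a 1 * deriv W a 1 = P a * s a / a := hrad a ha
    have hcW : W a 0 * deriv W a 1 - W a 1 * deriv W a 0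
        = -(c * potF Γ (s a) * s a ^ 2 / (a * Γ (s a) ^ 2)) := hcross a ha
    rw [profileField_eq_zero_iff k b c μ a (hne a ha) hgW,
      radial_profileField h.smooth k b c μ a (hne a ha) hgW,
      angular_profileField h.smooth k b c μ a (hne a ha) hgW, hrW, hcW, hr', hc', hIoo a ha]
    simp only [Pi.mul_apply, Pi.pow_apply, id, radialForce, redForce]
    push_cast
    constructor
    · field_simp
      ring
    · field_simp
      ring
  -- At `0` the angle may have no limit; continuity comes from `‖W‖ = |s| → 0` alone.
  have hcontW : ContinuousOn W (Ico 0 A) := by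
    intro a ha
    rcases ha.1.eq_or_lt with h0 | h0
    · subst h0
      have hz : W 0 = 0 := by rw [← norm_eq_zero, habs, h.zero, abs_zero]
      have : Tendsto W (𝓝 0) (𝓝 0) := by
        rw [tendsto_zero_iff_norm_tendsto_zero]
        simp only [habs]
        simpa [h.zero] using (h.continuous.tendsto 0).abs
      exact (show ContinuousAt W 0 by rw [ContinuousAt, hz]; exact this).continuousWithinAt
    · exact (hWd a ⟨h0, ha.2⟩).1.continuousAt.continuousWithinAt
  refine ⟨W, ⟨⟨A, hA, ?_, hcontW, hWc, hode⟩, ?_, ?_, ?_⟩, ?_, ?_⟩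
  · intro a ha
    refine lt_of_le_of_lt (ENNReal.ofReal_le_ofReal ?_) hs₀
    rw [hnorm a ha]
    rcases ha.1.eq_or_lt with h0 | h0
    · rw [← h0, h.zero]
      exact (h.pos a₁ ⟨ha₁, hA⟩).le.trans (h.le_radius a₁ ⟨ha₁, hA⟩)
    · exact h.le_radius a ⟨h0, ha.2⟩
  · rw [habs, h.zero, abs_zero]
  · rw [hIoo a₁ ⟨ha₁, hA⟩, hs₁]
  · intro a ha
    rw [hnorm a ⟨ha.1, ha.2.trans_lt hA⟩]
    have := h.strictMonoOn.monotoneOn ⟨ha.1, ha.2.trans_lt hA⟩ ⟨ha₁.le, hA⟩ ha.2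
    linarith
  · refine (h.isBigO_s.norm_left).congr_left fun a => ?_
    rw [habs, Real.norm_eq_abs]
  · refine h.isBigO_speed fun a ha => ?_
    have hg := h.Γ_pos ha
    have hs := h.pos a ha
    have ha0 := ha.1
    rw [riemNorm_eq (hne a ha), hrad a ha, hcross a ha, hIoo a ha]
    refine (eq_div_iff ha0.ne').2 ?_
    have hmul : ∀ x, √x * a = √(x * a ^ 2) := fun x => by
      rw [Real.sqrt_mul' _ (sq_nonneg a), Real.sqrt_sq ha0.le]
    rw [hmul]
    congr 1
    field_simp

end IsUnstableSolution

/-! ### The trivial profile curve -/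

/-- The norm is not differentiable at the origin, but `f'(0) = 0` makes `f ‖x‖ - f 0` of order
`o(‖x‖)`. -/
theorem partialDeriv_comp_norm_zero {f : ℝ → ℝ} (hf : HasDerivAt f 0 0) (j : Fin 2) :
    partialDeriv (fun x => f ‖x‖) j 0 = 0 := by
  have h : HasFDerivAt (fun x : Plane => f ‖x‖) (0 : Plane →L[ℝ] ℝ) 0 := by
    rw [hasFDerivAt_iff_isLittleO]
    have h1 := hasDerivAt_iff_isLittleO.1 hf
    have h2 : Tendsto (fun x : Plane => ‖x‖) (𝓝 0) (𝓝 0) := by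
      simpa using continuous_norm.tendsto (0 : Plane)
    have h3 := h1.comp_tendsto h2
    simp only [Function.comp_def, sub_zero, smul_zero] at h3
    exact isLittleO_norm_right.1 (by simpa using h3)
  rw [partialDeriv, h.fderiv]
  rfl

theorem isLocalProfile_zero {Γ : ℝ → ℝ} (hΓ : ContDiff ℝ ∞ Γ) (h0 : Γ 0 = 0) (k b c μ : ℝ)
    {s₀ : ℝ≥0∞} (hs₀ : 0 < s₀) {a₁ δ : ℝ} (hδ : 0 < δ) :
    IsLocalProfile s₀ Γ k b c μ a₁ δ 0 fun _ => 0 := by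
  have hG : grad Γ (fun x => potG Γ k b ‖x‖) 0 = 0 := by
    have h1 : HasDerivAt (potG Γ k b) 0 0 :=
      (hasDerivAt_potG hΓ k b 0).congr_deriv (by simp [potGDeriv, h0])
    ext i
    simp [grad, partialDeriv_comp_norm_zero h1]
  have hF : grad Γ (fun x => potF Γ ‖x‖) 0 = 0 := by
    have h1 : HasDerivAt (potF Γ) 0 0 :=
      (hasDerivAt_potF hΓ.continuous 0).congr_deriv h0
    ext i
    simp [grad, partialDeriv_comp_norm_zero h1]
  have hJ : complexStructure Γ 0 0 = 0 := by
    ext i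
    fin_cases i <;> simp [complexStructure]
  have hC : ∀ a, covAccel Γ (fun _ => 0) a = 0 := by
    intro a
    ext i
    simp [covAccel]
  refine ⟨⟨a₁ + 1, by linarith, fun a _ => by simpa using hs₀, continuousOn_const,
    contDiffOn_const, fun a _ => ?_⟩, norm_zero, norm_zero, fun a _ => by simpa using hδ⟩
  rw [hC, hG, hF]
  simp [hJ]

end ProfileExistence

/-! ### Common constants for existence and uniqueness -/

section Constants

theorem IsProfileFunction.map_zero {s₀ : ℝ≥0∞} {Γ : ℝ → ℝ} (hΓ : IsProfileFunction s₀ Γ) :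
    Γ 0 = 0 := by
  have := hΓ.odd 0
  rw [neg_zero] at this
  linarith

/-- The constants `a₁`, `δ` for which both the existence and the uniqueness arguments apply. -/
theorem exists_isSmallDisc_and_unstableSolution {s₀ : ℝ≥0∞} {Γ : ℝ → ℝ}
    (hΓ : IsProfileFunction s₀ Γ) {k b c : ℝ} (μ : ℝ) (hc : c ^ 2 < -4 * (k ^ 2 + b * k)) :
    ∃ a₁ δ ρ : ℝ, 0 < δ ∧ δ ≤ ρ ∧ ENNReal.ofReal ρ < s₀ ∧ IsSmallDisc Γ k b c μ a₁ δ ∧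
      ∀ s₁ ∈ Ioo 0 δ, ∃ A C : ℝ, a₁ < A ∧ ∃ s P : ℝ → ℝ, s a₁ = s₁ ∧
        IsUnstableSolution Γ k b c μ (kappa k b c) ρ A C s P := by
  have hκsq : 0 < -(k ^ 2 + b * k) - c ^ 2 / 4 := by linarith
  have hκ : 0 < kappa k b c := Real.sqrt_pos.2 hκsq
  have hκ2 : kappa k b c ^ 2 = -(k ^ 2 + b * k) - c ^ 2 / 4 := Real.sq_sqrt hκsq.le
  have h0 := hΓ.map_zero
  obtain ⟨ρ, hρ, hρs₀, B, hB, hd, hcont, hfB⟩ :=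
    exists_small_disc hΓ.smooth h0 hΓ.deriv_zero hΓ.s₀_pos k b c
  rw [← hκ2] at hfB
  have hΓl : ∀ s t, 0 ≤ t → t ≤ s → s ≤ ρ → |Γ s - Γ t| ≤ 2 * (s - t) := by
    intro s t ht hts hs
    have := abs_sub_le_of_deriv_bounds hΓ.smooth hd (s := s) (t := t)
      (by rw [abs_of_nonneg (ht.trans hts)]; exact hs)
      (by rw [abs_of_nonneg ht]; exact hts.trans hs)
    rwa [abs_of_nonneg (sub_nonneg.2 hts)] at this
  obtain ⟨a₁, δ, ha₁, hδ, hδρ, hsmall, hex⟩ := exists_unstable_solution μ hκ hρ hB hcont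
    hΓ.smooth.continuous (redForce_zero_zero h0 k b c) h0 hfB hΓl
  -- Increments of the force lie between `κ² / 2` and `3 κ² / 2` times those of `s`. The lower bound
  -- gives strict monotonicity, the upper one linear growth.
  have hdiff : ∀ a ∈ Ioo 0 a₁, ∀ x y, 0 ≤ y → y ≤ x → x < δ →
      |radialForce Γ k b c μ 0 a x - radialForce Γ k b c μ 0 a y
        - kappa k b c ^ 2 * (x - y)| ≤ kappa k b c ^ 2 / 2 * (x - y) := by
    intro a ha x y hy hyx hx
    have h1 := hfB x y hy hyx (hx.le.trans hδρ)
    have h2 := hΓl x y hy hyx (hx.le.trans hδρ)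
    have hxy : 0 ≤ x - y := sub_nonneg.2 hyx
    have ha2 : a ^ 2 ≤ a₁ ^ 2 := pow_le_pow_left₀ ha.1.le ha.2.le 2
    calc _ = |(redForce Γ k b c 0 x - redForce Γ k b c 0 y - kappa k b c ^ 2 * (x - y))
          + μ * a ^ 2 * (Γ x - Γ y)| := by simp only [radialForce]; ring_nf
      _ ≤ B * x * (x - y) + |μ| * a ^ 2 * (2 * (x - y)) := by
          refine (abs_add_le _ _).trans (add_le_add h1 ?_)
          rw [abs_mul, abs_mul, abs_of_nonneg (sq_nonneg a)]
          gcongr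
      _ ≤ B * δ * (x - y) + |μ| * a₁ ^ 2 * (2 * (x - y)) := by gcongr
      _ = (B * δ + 2 * (|μ| * a₁ ^ 2)) * (x - y) := by ring
      _ ≤ _ := by gcongr
  refine ⟨a₁, δ, ρ, hδ, hδρ, hρs₀, ⟨hΓ.smooth, h0, hΓ.deriv_zero, ha₁,
    fun s hs => hd s (hs.trans hδρ), ?_, 2 * kappa k b c ^ 2, ?_⟩, ?_⟩
  · intro a ha x y hy hyx hx
    have h1 := (abs_le.1 (hdiff a ha x y hy hyx.le hx)).1
    have h2 : 0 < kappa k b c ^ 2 / 2 * (x - y) := mul_pos (by positivity) (sub_pos.2 hyx)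
    linarith
  · intro a ha x hx
    have h1 := abs_le.1 (hdiff a ha x 0 le_rfl hx.1.le hx.2)
    rw [radialForce_zero_right h0] at h1
    have h2 : 0 < kappa k b c ^ 2 * x := mul_pos (by positivity) hx.1
    rw [abs_le]
    constructor <;> linarith [h1.1, h1.2]
  · intro s₁ hs₁
    obtain ⟨A, C, hA, s, P, hs, hs0, hsa, h⟩ := hex s₁ hs₁
    exact ⟨A, C, hA, s, P, hsa, hΓ.smooth, h0, hd, hκ, ha₁.trans hA, hs, hs0,
      fun a ha => (h a ha).1, fun a ha => (h a ha).2.1, fun a ha => (h a ha).2.2.1,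
      fun a ha => (h a ha).2.2.2.1, fun a ha => (h a ha).2.2.2.2.1,
      fun a ha => (h a ha).2.2.2.2.2.1, fun a ha => (h a ha).2.2.2.2.2.2⟩

end Constants

end RevSurface

end

theorem proposition4p1 (s₀ : ℝ≥0∞) (Γ : ℝ → ℝ) (hΓ : RevSurface.IsProfileFunction s₀ Γ)
    (k b c μ : ℝ) (hc : c ^ 2 < -4 * (k ^ 2 + b * k)) :
    0 < RevSurface.kappa k b c ∧
    ∃ a₁ : ℝ, 0 < a₁ ∧ ∃ δ : ℝ, 0 < δ ∧ ENNReal.ofReal δ ≤ s₀ ∧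
      (∀ s₁ ∈ Ico 0 δ, ∃ W : ℝ → RevSurface.Plane,
        RevSurface.IsLocalProfile s₀ Γ k b c μ a₁ δ s₁ W ∧
        (fun a => ‖W a‖) =O[𝓝[>] 0] (fun a : ℝ => a ^ RevSurface.kappa k b c) ∧
        (fun a => RevSurface.riemNorm Γ (W a) (deriv W a))
          =O[𝓝[>] 0] (fun a : ℝ => a ^ (RevSurface.kappa k b c - 1)) ∧
        ∀ W' : ℝ → RevSurface.Plane, RevSurface.IsLocalProfile s₀ Γ k b c μ a₁ δ s₁ W' →
          ∃ θ : ℝ, ∀ a ∈ Icc 0 a₁, W' a = RevSurface.rot θ (W a)) ∧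
      (∀ s₁ ∈ Ioo 0 δ, ∃ s r γ : ℝ → ℝ,
        RevSurface.IsLocalPolar Γ k b c μ a₁ δ s₁ s r γ ∧
        s =O[𝓝[>] 0] (fun a : ℝ => a ^ RevSurface.kappa k b c) ∧
        (fun a => r a * Γ (s a) / a)
          =O[𝓝[>] 0] (fun a : ℝ => a ^ (RevSurface.kappa k b c - 1)) ∧
        ∀ s' r' γ' : ℝ → ℝ, RevSurface.IsLocalPolar Γ k b c μ a₁ δ s₁ s' r' γ' →
          ∃ n : ℤ, ∀ a ∈ Ioc 0 a₁,
            s' a = s a ∧ r' a = r a ∧ γ' a = γ a + n * (2 * Real.pi)) := by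
  have hκsq : 0 < -(k ^ 2 + b * k) - c ^ 2 / 4 := by linarith
  have hκ : 0 < RevSurface.kappa k b c := Real.sqrt_pos.2 hκsq
  refine ⟨hκ, ?_⟩
  obtain ⟨a₁, δ, ρ, hδ, hδρ, hρs₀, hD, hex⟩ :=
    RevSurface.exists_isSmallDisc_and_unstableSolution hΓ μ hc
  refine ⟨a₁, hD.pos, δ, hδ, (ENNReal.ofReal_le_ofReal hδρ).trans hρs₀.le, ?_, ?_⟩
  · intro s₁ hs₁
    rcases hs₁.1.eq_or_lt with h0 | h0
    · subst h0
      -- For final value zero the solution is the constant curve at the center, where the polar form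
      -- is unavailable.
      have hW := RevSurface.isLocalProfile_zero hD.smooth hD.zero k b c μ hΓ.s₀_pos (a₁ := a₁) hδ
      refine ⟨fun _ => 0, hW, ?_, ?_, fun W' hW' => hW.unique hD le_rfl hW'⟩
      · simpa using isBigO_zero _ _
      · simpa [RevSurface.riemNorm] using isBigO_zero _ _
    · obtain ⟨B, C, hB, s, P, hs, h⟩ := hex s₁ ⟨h0, hs₁.2⟩
      obtain ⟨W, hW, h1, h2⟩ := h.exists_localProfile hρs₀ hD.pos hB hs hs₁.2
      exact ⟨W, hW, h1, h2, fun W' hW' => hW.unique hD h0.le hW'⟩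
  · intro s₁ hs₁
    obtain ⟨B, C, hB, s, P, hs, h⟩ := hex s₁ hs₁
    obtain ⟨r, γ, hr, hO⟩ := h.exists_localPolar hD.pos hB hs hs₁.2
    exact ⟨s, r, γ, hr, h.isBigO_s, hO, fun s' r' γ' h' => hr.unique hD hs₁.1 h'⟩
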